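/- **Setting.** Let $d\in\{2,3\}$, let $\Omega\subset\mathbb R^d$ be a bounded domain with polygonal/polyhedral boundary and $\Omega=\operatorname{int}\overline\Omega$, and let $\mathcal T$ be a regular (face-to-face) triangulation of $\Omega$ into simplices with facets $\mathcal F$. Let $k\ge 1$, $\nu>0$, $f\in L^2(\Omega)^d$. Let $\bar V_h\subset H^1_0(\Omega)^d$ and $\bar Q_h\subset L^2_0(\Omega)$ be spaces of piecewise polynomials with $P_1(\mathcal T)^d\cap H^1_0(\Omega)^d\subset\bar V_h$, let $\mathcal R:\bar V_h\to L^2(\Omega)^d$ be linear with $\mathcal R v=v$ for all $v\in P_1(\mathcal T)^d\cap H_0^1(\Omega)^d$, and let $(\bar u_h,\bar p_h)\in\bar V_h\times\bar Q_h$ satisfy $$\nu(\nabla\bar u_h,\nabla v)-(\operatorname{div}v,\bar p_h)=(f,\mathcal Rv)\quad\forall v\in\bar V_h,\qquad(\operatorname{div}\bar u_h,q)=0\quad\forall q\in\bar Q_h.$$ Put $\bar\sigma_h:=\nu\nabla\bar u_h$. With the outer unit normal $n$ on $\partial T$, write $a_n=a\cdot n$, $a_t=a-a_nn$ for vectors and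 $\tau_{nn}=n\cdot\tau n$, $\tau_{nt}=(\tau n)_t$ for matrices; $[\![\cdot]\!]$ is the jump across a facet of the patch below, and the one-sided trace on its boundary facets. For a vertex $V$ with hat function $\phi_V$, let $\mathcal T_V$ be the set of cells containing $V$, $\omega_V$ their union, and $\mathcal F_V$ the set of all facets of cells in $\mathcal T_V$; if $V\in\partial\Omega$, the facets contained in $\partial\Omega$ are removed from $\mathcal F_V$. Let $\Sigma_h^V$ be the trace-free $d\times d$ matrix fields that are piecewise $P_k$ on $\mathcal T_V$ (no continuity), $V_h^V:=\mathrm{RT}_k(\mathcal T_V)=\{v\in H(\operatorname{div},\omega_V): v|_T=a_T+b_T x,\ a_T\in P_k(T)^d,\ b_T\in P_k(T)\}$, $\hat V_h^V:=\{\hat v:\hat v|_F\in P_k(F)^d,\ \hat v_n=0\ \forall F\in\mathcal F_V\}$, and $Q_h^V$ the piecewise $P_k$ functions on $\mathcal T_V$. If $V\in\Omega$, let $X_h^V$ be the factor space $(V_h^V\times\hat V_h^V)/\{(c,c_t):c\in\mathbb R^d\}$, realised by the pairs with zero mean value $$\pi^V_{\mathbb R}(v,\hat v)=\frac1{|\mathcal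 T_V|+|\mathcal F_V|}\Big(\sum_{T\in\mathcal T_V}\int_Tv\,dx+\sum_{F\in\mathcal F_V}\int_F\hat v\,ds\Big)=0;$$ if $V\in\partial\Omega$, let $X_h^V:=V_h^V\times\hat V_h^V$. Set $$\langle\operatorname{div}\tau,(v,\hat v)\rangle_{V_h^V}:=\sum_{T\in\mathcal T_V}(\operatorname{div}\tau,v)_T-\sum_{F\in\mathcal F_V}\Big(([\![\tau_{nn}]\!],v_n)_F+([\![\tau_{nt}]\!],\hat v)_F\Big),$$ and, with $B^V v|_T:=I^k_{\mathcal L}(\phi_Vv|_T)$ (component-wise nodal Lagrange interpolation into $P_k(T)$) and $\hat v:=0$ on removed facets, $$r^V(v,\hat v):=\sum_{T\in\mathcal T_V}\Big[(f+\nu\Delta\bar u_h-\nabla\bar p_h,B^Vv)_T-((\bar\sigma_h-\bar p_hI)_{nn},(B^Vv)_n)_{\partial T}-(\phi_V(\bar\sigma_h)_{nt},\hat v)_{\partial T}\Big].$$ **Theorem.** Let $(\sigma_h^V,(u_h^V,\hat u_h^V),p_h^V)\in\Sigma_h^V\times X_h^V\times Q_h^V$ solve the local problem $$\begin{aligned}(\sigma_h^V,\tau)_{\omega_V}+\langle\operatorname{div}\tau,(u_h^V,\hat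 u_h^V)\rangle_{V_h^V}&=0&&\forall\tau\in\Sigma_h^V,\\ \langle\operatorname{div}\sigma_h^V,(v,\hat v)\rangle_{V_h^V}+(\operatorname{div}v,p_h^V)_{\omega_V}&=r^V(v,\hat v)&&\forall(v,\hat v)\in X_h^V,\\(\operatorname{div}u_h^V,q)_{\omega_V}&=0&&\forall q\in Q_h^V.\end{aligned}$$ Then: 1. For all $(v,\hat v)$ in the full space $V_h^V\times\hat V_h^V$, $$\langle\operatorname{div}\sigma_h^V,(v,\hat v)\rangle_{V_h^V}+(\operatorname{div}v,p_h^V)_{\omega_V}=r^V(v,\hat v).$$ 2. For every global pair $(v,\hat v)$ with $v\in\mathrm{RT}_k(\mathcal T)\cap H_0(\operatorname{div},\Omega)$, $\operatorname{div}v=0$, and $\hat v|_F\in P_k(F)^d$, $\hat v_n=0$ for all $F\in\mathcal F$, the restrictions to the patch satisfy $$\langle\operatorname{div}\sigma_h^V,(v,\hat v)\rangle_{V_h^V}=r^V(v,\hat v).$$ 3. $(\sigma_h^V)_{nt}=0$ on every facet $F\in\mathcal F_V$ with $F\subset\partial\omega_V$; that is, on all of $\partial\omega_V$ if $V\in\Omega$,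 and on the facets of $\partial\omega_V$ not contained in $\partial\Omega$ if $V\in\partial\Omega$. -/

import Mathlib

open MeasureTheory
open scoped ContDiff

noncomputable section

/-- The Euclidean space `ℝ^d`. -/
abbrev Euc (d : ℕ) : Type := EuclideanSpace ℝ (Fin d)

/-- Real polynomials in `d` variables. -/
abbrev MPoly (d : ℕ) : Type := MvPolynomial (Fin d) ℝ

namespace MPoly

variable {d : ℕ}

/-- Value of a polynomial at a point of `ℝ^d`. -/
def ev (p : MPoly d) (x : Euc d) : ℝ := MvPolynomial.eval (fun i => x i) p

/-- `P_k`: polynomials of total degree at most `k`. -/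
def degLE (d k : ℕ) : Submodule ℝ (MPoly d) := MvPolynomial.restrictTotalDegree (Fin d) ℝ k

/-- Divergence of a polynomial vector field. -/
def divV (v : Fin d → MPoly d) : MPoly d := ∑ i, MvPolynomial.pderiv i (v i)

/-- Row-wise divergence of a polynomial matrix field. -/
def divM (τ : Matrix (Fin d) (Fin d) (MPoly d)) : Fin d → MPoly d :=
  fun i => ∑ j, MvPolynomial.pderiv j (τ i j)

/-- Gradient (Jacobian) of a polynomial vector field, `(∇v)_{ij} = ∂_j v_i`. -/
def grad (v : Fin d → MPoly d) : Matrix (Fin d) (Fin d) (MPoly d) :=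
  Matrix.of fun i j => MvPolynomial.pderiv j (v i)

/-- Component-wise Laplacian of a polynomial vector field. -/
def lap (v : Fin d → MPoly d) : Fin d → MPoly d :=
  fun i => ∑ j, MvPolynomial.pderiv j (MvPolynomial.pderiv j (v i))

end MPoly

/-- A nondegenerate `d`-simplex in `ℝ^d` (with numbered vertices `T.points i`). -/
abbrev Cell (d : ℕ) : Type := Affine.Simplex ℝ (Euc d) d

namespace Cell

variable {d : ℕ}

/-- The closed simplex. -/
def hull (T : Cell d) : Set (Euc d) := convexHull ℝ (Set.range T.points)

/-- The vertices of a `d`-simplex form an affine basis of `ℝ^d`. -/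
def basis (T : Cell d) : AffineBasis (Fin (d + 1)) ℝ (Euc d) :=
  ⟨T.points, T.independent,
    T.independent.affineSpan_eq_top_iff_card_eq_finrank_add_one.2 (by simp)⟩

/-- The components of the gradient of the `i`-th barycentric coordinate function. -/
def baryGrad (T : Cell d) (i : Fin (d + 1)) (j : Fin d) : ℝ :=
  (T.basis.coord i).linear (EuclideanSpace.single j 1)

/-- The `i`-th barycentric coordinate function, as a polynomial of degree at most one. -/
def bary (T : Cell d) (i : Fin (d + 1)) : MPoly d :=
  MvPolynomial.C (T.basis.coord i 0) + ∑ j, MvPolynomial.C (T.baryGrad i j) * MvPolynomial.X j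

open Classical in
/-- The facet opposite to the `i`-th vertex, given by its set of vertices. -/
def facet (T : Cell d) (i : Fin (d + 1)) : Finset (Euc d) :=
  (Finset.univ.erase i).image T.points

/-- Outward unit normal on the facet opposite to the `i`-th vertex:
`n = - ∇λ_i / |∇λ_i|`. -/
def normal (T : Cell d) (i : Fin (d + 1)) (j : Fin d) : ℝ :=
  -T.baryGrad i j / Real.sqrt (∑ l, T.baryGrad i l ^ 2)

/-- Normal component `v · n` of a polynomial vector field on the `i`-th facet. -/
def trN (T : Cell d) (i : Fin (d + 1)) (v : Fin d → MPoly d) (x : Euc d) : ℝ :=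
  ∑ a, (v a).ev x * T.normal i a

/-- The vector `τ n` of a polynomial matrix field on the `i`-th facet. -/
def traction (T : Cell d) (i : Fin (d + 1)) (τ : Matrix (Fin d) (Fin d) (MPoly d)) (x : Euc d)
    (a : Fin d) : ℝ :=
  ∑ b, (τ a b).ev x * T.normal i b

/-- Normal-normal trace `τ_nn = n · τ n` on the `i`-th facet. -/
def trNN (T : Cell d) (i : Fin (d + 1)) (τ : Matrix (Fin d) (Fin d) (MPoly d)) (x : Euc d) : ℝ :=
  ∑ a, T.traction i τ x a * T.normal i a

/-- Normal-tangential trace `τ_nt = τ n - (n · τ n) n` on the `i`-th facet. -/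
def trNT (T : Cell d) (i : Fin (d + 1)) (τ : Matrix (Fin d) (Fin d) (MPoly d)) (x : Euc d)
    (a : Fin d) : ℝ :=
  T.traction i τ x a - T.trNN i τ x * T.normal i a

/-- The Lagrange node with barycentric coordinates `α / k`. -/
def node (T : Cell d) (k : ℕ) (α : Fin (d + 1) → ℕ) : Euc d :=
  ∑ i, ((α i : ℝ) / (k : ℝ)) • T.points i

/-- The Lagrange basis polynomial of `P_k(T)` which is `1` at the node `α / k` and `0` at the other
nodes: `∏_i ∏_{j < α_i} (k λ_i - j) / (j + 1)`. -/
def lagrangeBasis (T : Cell d) (k : ℕ) (α : Fin (d + 1) → ℕ) : MPoly d :=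
  ∏ i, ∏ j ∈ Finset.range (α i),
    MvPolynomial.C (((j : ℝ) + 1)⁻¹) *
      (MvPolynomial.C (k : ℝ) * T.bary i - MvPolynomial.C (j : ℝ))

/-- Nodal interpolation into `P_k(T)` (for `k ≥ 1`), with the nodes `α / k`, `|α| = k`. -/
def lagrangeInterp (T : Cell d) (k : ℕ) (g : MPoly d) : MPoly d :=
  ∑ α ∈ Finset.piAntidiag (Finset.univ : Finset (Fin (d + 1))) k,
    MvPolynomial.C (g.ev (T.node k α)) * T.lagrangeBasis k α

open Classical in
/-- Restriction to `T` of the hat function of the vertex `V` (zero if `V` is not a vertex of `T`). -/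
def hat (T : Cell d) (V : Euc d) : MPoly d :=
  ∑ i, if T.points i = V then T.bary i else 0

/-- The vector-valued bubble projector on `T`, `v ↦ I_k(φ_V v)` in every component. -/
def bubble (T : Cell d) (k : ℕ) (V : Euc d) (v : Fin d → MPoly d) : Fin d → MPoly d :=
  fun j => T.lagrangeInterp k (T.hat V * v j)

end Cell

/-- The closed facet spanned by a set of vertices. -/
def facetHull {d : ℕ} (F : Finset (Euc d)) : Set (Euc d) := convexHull ℝ (F : Set (Euc d))

/-- Integral over a facet with respect to the `(d-1)`-dimensional surface measure. -/
def facetIntegral {d : ℕ} (F : Finset (Euc d)) (g : Euc d → ℝ) : ℝ :=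
  ∫ x in facetHull F, g x ∂μHE[d - 1]

/-- A regular (face-to-face) triangulation of `Ω` into finitely many simplices. -/
structure Triangulation {d : ℕ} (Ω : Set (Euc d)) where
  /-- the index set of the cells -/
  ι : Type
  [fintype : Fintype ι]
  /-- the cells -/
  cell : ι → Cell d
  /-- two cells with the same vertices are the same -/
  range_inj : ∀ S T, Set.range (cell S).points = Set.range (cell T).points → S = T
  /-- two cells meet in the face spanned by their common vertices (or not at all) -/
  conforming : ∀ S T, (cell S).hull ∩ (cell T).hull ⊆
    convexHull ℝ (Set.range (cell S).points ∩ Set.range (cell T).points)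
  /-- the cells cover the closure of the domain -/
  cover : ⋃ T, (cell T).hull = closure Ω

attribute [instance] Triangulation.fintype

namespace Triangulation

variable {d : ℕ} {Ω : Set (Euc d)} (𝒯 : Triangulation Ω)

/-! Broken fields are families of polynomials, one for every cell (or facet). The spaces and forms
below refer to a set of cells or facets and use only the members of the family that belong to it,
so that one and the same family also denotes the restriction of the field to a patch. -/

/-- Broken polynomial scalar fields. -/
abbrev Scal : Type := 𝒯.ι → MPoly d

/-- Broken polynomial vector fields. -/
abbrev Vec : Type := 𝒯.ι → Fin d → MPoly d

/-- Broken polynomial matrix fields. -/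
abbrev Mat : Type := 𝒯.ι → Matrix (Fin d) (Fin d) (MPoly d)

set_option linter.unusedVariables false in
/-- Vector fields on the facets, polynomial on every facet. -/
abbrev FacetVec (𝒯 : Triangulation Ω) : Type := Finset (Euc d) → Fin d → MPoly d

/-- The vertices of the triangulation. -/
def vertices : Set (Euc d) := {V | ∃ T i, (𝒯.cell T).points i = V}

open Classical in
/-- The facets of the triangulation. -/
def facets : Finset (Finset (Euc d)) :=
  Finset.univ.biUnion fun T => Finset.univ.image (𝒯.cell T).facet

open Classical in
/-- The cells of the patch of a vertex `V`: those that have `V` as a vertex. -/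
def patch (V : Euc d) : Finset 𝒯.ι :=
  Finset.univ.filter fun T => V ∈ Set.range (𝒯.cell T).points

open Classical in
/-- The facets of the patch of `V`, including those on the boundary of the patch. If `V` lies on the
boundary of the domain, then the facets on the boundary of the domain are removed. -/
def patchFacets (V : Euc d) : Finset (Finset (Euc d)) :=
  ((𝒯.patch V).biUnion fun T => Finset.univ.image (𝒯.cell T).facet).filter
    fun F => V ∈ frontier Ω → ¬ facetHull F ⊆ frontier Ω

/-- The closed region covered by a set of cells. -/
def region (S : Finset 𝒯.ι) : Set (Euc d) := ⋃ T ∈ S, (𝒯.cell T).hull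

/-- Integral over a cell. -/
def cellIntegral (T : 𝒯.ι) (g : Euc d → ℝ) : ℝ := ∫ x in (𝒯.cell T).hull, g x

/-- `H(div)`-conformity on the (interior of the) region covered by the cells of `S`: the broken
field has a weak divergence in `L²`. -/
def HDiv (S : Finset 𝒯.ι) (v : 𝒯.Vec) : Prop :=
  ∃ g : Euc d → ℝ, MemLp g 2 (volume.restrict (interior (𝒯.region S))) ∧
    ∀ ψ : Euc d → ℝ, ContDiff ℝ ∞ ψ → HasCompactSupport ψ →
      tsupport ψ ⊆ interior (𝒯.region S) →
      ∑ T ∈ S, 𝒯.cellIntegral T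
          (fun x => ∑ a, (v T a).ev x * fderiv ℝ ψ x (EuclideanSpace.single a 1)) =
        - ∫ x in interior (𝒯.region S), g x * ψ x

/-- Conformity in `H_0(div, Ω)`: the broken field has a weak divergence in `L²(Ω)` and its normal
trace vanishes on `∂Ω`, that is, the integration by parts formula holds for all smooth
functions, not only for those that vanish near `∂Ω`. -/
def HDivZero (v : 𝒯.Vec) : Prop :=
  ∃ g : Euc d → ℝ, MemLp g 2 (volume.restrict Ω) ∧
    ∀ ψ : Euc d → ℝ, ContDiff ℝ ∞ ψ → HasCompactSupport ψ →
      ∑ T, 𝒯.cellIntegral T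
          (fun x => ∑ a, (v T a).ev x * fderiv ℝ ψ x (EuclideanSpace.single a 1)) =
        - ∫ x in Ω, g x * ψ x

/-- The Raviart-Thomas space `RT_k` on the region covered by the cells of `S`. -/
def RT (k : ℕ) (S : Finset 𝒯.ι) : Set 𝒯.Vec :=
  {v | 𝒯.HDiv S v ∧ ∀ T ∈ S, ∃ a : Fin d → MPoly d, ∃ b : MPoly d,
    (∀ j, a j ∈ MPoly.degLE d k) ∧ b ∈ MPoly.degLE d k ∧ ∀ j, v T j = a j + b * MvPolynomial.X j}

/-- The global velocity space `RT_k ∩ H_0(div, Ω)`. -/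
def RTZero (k : ℕ) : Set 𝒯.Vec := {v | v ∈ 𝒯.RT k Finset.univ ∧ 𝒯.HDivZero v}

/-- Tangential fields of degree at most `k` on the facets of `𝓕`; the normals are those of the
cells of `S`. -/
def Tang (k : ℕ) (S : Finset 𝒯.ι) (𝓕 : Finset (Finset (Euc d))) : Set 𝒯.FacetVec :=
  {w | ∀ F ∈ 𝓕, (∀ j, w F j ∈ MPoly.degLE d k) ∧
    ∀ T ∈ S, ∀ i, (𝒯.cell T).facet i = F → ∀ x ∈ facetHull F, (𝒯.cell T).trN i (w F) x = 0}

/-- Local stress space: broken, trace-free, of degree at most `k`. -/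
def Stress (k : ℕ) (V : Euc d) : Set 𝒯.Mat :=
  {τ | ∀ T ∈ 𝒯.patch V, (∀ i j, τ T i j ∈ MPoly.degLE d k) ∧ (τ T).trace = 0}

/-- Local pressure space. -/
def Pres (k : ℕ) (V : Euc d) : Set 𝒯.Scal :=
  {q | ∀ T ∈ 𝒯.patch V, q T ∈ MPoly.degLE d k}

/-- Local velocity space `RT_k` on the patch of `V`, without boundary conditions. -/
def Vel (k : ℕ) (V : Euc d) : Set 𝒯.Vec := 𝒯.RT k (𝒯.patch V)

/-- Local space of tangential facet fields. -/
def HatVel (k : ℕ) (V : Euc d) : Set 𝒯.FacetVec := 𝒯.Tang k (𝒯.patch V) (𝒯.patchFacets V)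

/-- The mean value of a pair over the cells and the facets of the patch. -/
def meanValue (V : Euc d) (v : 𝒯.Vec) (w : 𝒯.FacetVec) (a : Fin d) : ℝ :=
  (∑ T ∈ 𝒯.patch V, 𝒯.cellIntegral T (fun x => (v T a).ev x) +
      ∑ F ∈ 𝒯.patchFacets V, facetIntegral F (fun x => (w F a).ev x)) /
    (∑ T ∈ 𝒯.patch V, 𝒯.cellIntegral T (fun _ => 1) +
      ∑ F ∈ 𝒯.patchFacets V, facetIntegral F (fun _ => 1))

/-- The space of trial and test pairs of the local problem: the factor space of the pairs modulo
`{(c, c_t) : c ∈ ℝ^d}`, realised by the pairs with mean value zero, if `V` lies in `Ω`; all pairs if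
`V` lies on the boundary. -/
def Pairs (k : ℕ) (V : Euc d) : Set (𝒯.Vec × 𝒯.FacetVec) :=
  {z | z.1 ∈ 𝒯.Vel k V ∧ z.2 ∈ 𝒯.HatVel k V ∧ (V ∈ Ω → 𝒯.meanValue V z.1 z.2 = 0)}

open Classical in
/-- The product `[[τ_nn]] v_n` on a facet `F` of the patch. With outward normals, it is the sum of
`τ_nn (v · n)` over the cells of the patch that have `F` as a facet; the sign of `v · n` makes it a
difference if there are two such cells. -/
def jumpNN (V : Euc d) (τ : 𝒯.Mat) (v : 𝒯.Vec) (F : Finset (Euc d)) (x : Euc d) : ℝ :=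
  ∑ T ∈ 𝒯.patch V, ∑ i, if (𝒯.cell T).facet i = F then
    (𝒯.cell T).trNN i (τ T) x * (𝒯.cell T).trN i (v T) x else 0

open Classical in
/-- The jump `[[τ_nt]]` on a facet `F` of the patch: the sum of the normal-tangential traces, taken
with outward normals, of the cells of the patch that have `F` as a facet. -/
def jumpNT (V : Euc d) (τ : 𝒯.Mat) (F : Finset (Euc d)) (x : Euc d) (a : Fin d) : ℝ :=
  ∑ T ∈ 𝒯.patch V, ∑ i, if (𝒯.cell T).facet i = F then (𝒯.cell T).trNT i (τ T) x a else 0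

/-- The distributional divergence `⟨div τ, (v, w)⟩` on the patch of `V`. -/
def divPair (V : Euc d) (τ : 𝒯.Mat) (v : 𝒯.Vec) (w : 𝒯.FacetVec) : ℝ :=
  ∑ T ∈ 𝒯.patch V, 𝒯.cellIntegral T (fun x => ∑ a, MPoly.ev (MPoly.divM (τ T) a) x * (v T a).ev x) -
    ∑ F ∈ 𝒯.patchFacets V,
      (facetIntegral F (𝒯.jumpNN V τ v F) +
        facetIntegral F (fun x => ∑ a, 𝒯.jumpNT V τ F x a * (w F a).ev x))

/-- `(σ, τ)` on the patch of `V`. -/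
def stressForm (V : Euc d) (σ τ : 𝒯.Mat) : ℝ :=
  ∑ T ∈ 𝒯.patch V, 𝒯.cellIntegral T (fun x => ∑ a, ∑ b, (σ T a b).ev x * (τ T a b).ev x)

/-- `(div v, q)` on the region covered by the cells of `S`. -/
def divForm (S : Finset 𝒯.ι) (v : 𝒯.Vec) (q : 𝒯.Scal) : ℝ :=
  ∑ T ∈ S, 𝒯.cellIntegral T (fun x => MPoly.ev (MPoly.divV (v T)) x * (q T).ev x)

/-- Broken vector fields that belong to `H^1_0(Ω)`: continuous and zero on `∂Ω`. -/
def H10 (v : 𝒯.Vec) : Prop :=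
  (∀ S T, ∀ x ∈ (𝒯.cell S).hull ∩ (𝒯.cell T).hull, ∀ a, (v S a).ev x = (v T a).ev x) ∧
    ∀ T, ∀ x ∈ (𝒯.cell T).hull ∩ frontier Ω, ∀ a, (v T a).ev x = 0

/-- The continuous piecewise linear vector fields with zero boundary values. -/
def P1Zero : Set 𝒯.Vec := {v | 𝒯.H10 v ∧ ∀ T a, v T a ∈ MPoly.degLE d 1}

/-- The data of a primal discretisation of the Stokes problem: a pair of finite element spaces in
`H^1_0(Ω)^d` and `L^2_0(Ω)`, and a reconstruction operator into `L^2(Ω)^d` that does not alter the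
continuous piecewise linear fields (which belong to the velocity space). -/
structure PrimalMethod where
  /-- velocity space -/
  Vbar : Submodule ℝ 𝒯.Vec
  Vbar_conforming : ∀ v ∈ Vbar, 𝒯.H10 v
  /-- pressure space -/
  Qbar : Submodule ℝ 𝒯.Scal
  Qbar_mean : ∀ q ∈ Qbar, ∑ T, 𝒯.cellIntegral T (fun x => (q T).ev x) = 0
  /-- reconstruction operator -/
  R : Vbar →ₗ[ℝ] Lp (Euc d) 2 (volume.restrict Ω)
  P1_le : 𝒯.P1Zero ⊆ Vbar
  R_P1 : ∀ v : Vbar, (v : 𝒯.Vec) ∈ 𝒯.P1Zero →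
    ∀ T, ∀ᵐ x ∂(volume.restrict Ω), x ∈ (𝒯.cell T).hull → ∀ a, R v x a = ((v : 𝒯.Vec) T a).ev x

variable {𝒯}

/-- `(u, p)` solves the discrete Stokes problem with viscosity `ν` and right-hand side `f`. -/
structure IsPrimalSolution (M : 𝒯.PrimalMethod) (ν : ℝ) (f : Lp (Euc d) 2 (volume.restrict Ω))
    (u : 𝒯.Vec) (p : 𝒯.Scal) : Prop where
  u_mem : u ∈ M.Vbar
  p_mem : p ∈ M.Qbar
  momentum : ∀ v : M.Vbar,
    ν * ∑ T, 𝒯.cellIntegral T (fun x => ∑ a, ∑ b,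
        (MPoly.grad (u T) a b).ev x * (MPoly.grad ((v : 𝒯.Vec) T) a b).ev x) -
      𝒯.divForm Finset.univ v p = ∫ x in Ω, inner ℝ (f x) (M.R v x)
  mass : ∀ q ∈ M.Qbar, 𝒯.divForm Finset.univ u q = 0

variable (𝒯)

open Classical in
/-- The local residual `r^V((v, w))` of a pair `(u, p)`, with `σ = ν ∇u`:
`∑_T (f, B v)_T + (ν Δu - ∇p, B v)_T - ((σ - p I)_nn, (B v)_n)_{∂T} - (φ_V σ_nt, w)_{∂T}`,
where `w` is zero on the facets removed from the patch. -/
def residual (k : ℕ) (ν : ℝ) (f : Lp (Euc d) 2 (volume.restrict Ω)) (u : 𝒯.Vec) (p : 𝒯.Scal)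
    (V : Euc d) (v : 𝒯.Vec) (w : 𝒯.FacetVec) : ℝ :=
  ∑ T ∈ 𝒯.patch V,
    (𝒯.cellIntegral T (fun x => ∑ a, f x a * ((𝒯.cell T).bubble k V (v T) a).ev x) +
      𝒯.cellIntegral T (fun x => ∑ a,
        (ν * MPoly.ev (MPoly.lap (u T) a) x - MPoly.ev (MvPolynomial.pderiv a (p T)) x) *
          ((𝒯.cell T).bubble k V (v T) a).ev x) -
      ∑ i, facetIntegral ((𝒯.cell T).facet i) (fun x =>
        (ν * (𝒯.cell T).trNN i (MPoly.grad (u T)) x - (p T).ev x) *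
          (𝒯.cell T).trN i ((𝒯.cell T).bubble k V (v T)) x) -
      ∑ i, if (𝒯.cell T).facet i ∈ 𝒯.patchFacets V then
        facetIntegral ((𝒯.cell T).facet i) (fun x => ∑ a,
          ((𝒯.cell T).hat V).ev x * (ν * (𝒯.cell T).trNT i (MPoly.grad (u T)) x a) *
            (w ((𝒯.cell T).facet i) a).ev x) else 0)

/-- `(σ, (u, w), p)` solves the local problem on the patch of `V` with right-hand side `r`. -/
structure IsLocalSolution (k : ℕ) (V : Euc d) (r : 𝒯.Vec → 𝒯.FacetVec → ℝ)
    (σ : 𝒯.Mat) (u : 𝒯.Vec) (w : 𝒯.FacetVec) (p : 𝒯.Scal) : Prop where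
  stress_mem : σ ∈ 𝒯.Stress k V
  pair_mem : (u, w) ∈ 𝒯.Pairs k V
  pres_mem : p ∈ 𝒯.Pres k V
  constitutive : ∀ τ ∈ 𝒯.Stress k V, 𝒯.stressForm V σ τ + 𝒯.divPair V τ u w = 0
  balance : ∀ z ∈ 𝒯.Pairs k V,
    𝒯.divPair V σ z.1 z.2 + 𝒯.divForm (𝒯.patch V) z.1 p = r z.1 z.2
  mass : ∀ q ∈ 𝒯.Pres k V, 𝒯.divForm (𝒯.patch V) u q = 0

end Triangulation

end

/-! Everything rests on one compatibility: if `V` lies in `Ω`, both sides of the balance equation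
vanish on the pairs `(c, c_t)` of a constant vector `c`. On the left, `div c = 0` removes the
pressure, and Gauss' theorem on each cell gives `(div σ, c)_T = ∫_{∂T} σn · c` with `σn · c = σ_nn
c_n + σ_nt · c_t`, which the facet terms cancel because no facet of the patch has been removed
(`divPair_const`). On the right, interpolation is exact on `φ_V c` for `k ≥ 1`, so `B c = φ_V c`,
and Green's formula on each cell turns the residual into load minus primal bilinear form, tested
with `φ_V c`. As `V` is interior, `φ_V c` is continuous, piecewise linear and zero on the boundary;
the primal equation may be tested with it, the reconstruction leaves it alone, and the residual is
zero (`residual_const`).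

Claim 1: every pair differs from a pair of mean value zero by some `(c, c_t)`, since `c ↦ ∫ (c,
c_t)` is positive definite (`integralConst_injective`). If `V` is not in `Ω`, there is no mean value
constraint. Claim 2: a global field restricts to the patch space, and `div v = 0` removes the
pressure.

Claim 3: test with velocity zero and the facet field equal to `σ_nt` on one boundary facet `F` and
zero elsewhere. Only one cell of the patch has `F` as a facet, so the left side is `-∫_F |σ_nt|²`.
The right side carries the factor `φ_V` on `F`. A boundary facet of the patch that contains `V` lies
in the boundary of `Ω` and was removed; hence `F` is opposite to `V` and `φ_V = 0` on `F`.

Two tools are proved from scratch: Gauss' theorem on a simplex for the Hausdorff surface measure, by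
Fubini along edge directions, and the exactness of Lagrange interpolation, by the Chu-Vandermonde
identity. -/

noncomputable section

/-! ### Evaluation of polynomials and differentiation along lines -/

namespace MPoly

variable {d : ℕ}

@[simp] lemma ev_add (p q : MPoly d) (x : Euc d) : (p + q).ev x = p.ev x + q.ev x := by simp [ev]
@[simp] lemma ev_sub (p q : MPoly d) (x : Euc d) : (p - q).ev x = p.ev x - q.ev x := by simp [ev]
@[simp] lemma ev_mul (p q : MPoly d) (x : Euc d) : (p * q).ev x = p.ev x * q.ev x := by simp [ev]
@[simp] lemma ev_zero (x : Euc d) : (0 : MPoly d).ev x = 0 := by simp [ev]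
@[simp] lemma ev_one (x : Euc d) : (1 : MPoly d).ev x = 1 := by simp [ev]
@[simp] lemma ev_C (r : ℝ) (x : Euc d) : MPoly.ev (MvPolynomial.C r : MPoly d) x = r := by simp [ev]
@[simp] lemma ev_X (i : Fin d) (x : Euc d) : MPoly.ev (MvPolynomial.X i : MPoly d) x = x i := by
  simp [ev]
@[simp] lemma ev_sum {ι : Type*} (s : Finset ι) (p : ι → MPoly d) (x : Euc d) :
    MPoly.ev (∑ i ∈ s, p i) x = ∑ i ∈ s, (p i).ev x := by simp [ev]
@[simp] lemma ev_prod {ι : Type*} (s : Finset ι) (p : ι → MPoly d) (x : Euc d) :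
    MPoly.ev (∏ i ∈ s, p i) x = ∏ i ∈ s, (p i).ev x := by simp [ev]

@[fun_prop] lemma continuous_ev (p : MPoly d) : Continuous p.ev := by
  induction p using MvPolynomial.induction_on with
  | C a =>
    have : MPoly.ev (MvPolynomial.C a : MPoly d) = fun _ => a := by ext; simp
    rw [this]; fun_prop
  | add p q hp hq =>
    have : MPoly.ev (p + q : MPoly d) = fun x => MPoly.ev p x + MPoly.ev q x := by ext; simp
    rw [this]; fun_prop
  | mul_X p i hp =>
    have : MPoly.ev (p * MvPolynomial.X i : MPoly d) = fun x => MPoly.ev p x * x i := by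
      ext; simp
    rw [this]; fun_prop

/-- This links the formal `MvPolynomial.pderiv` to calculus; the fundamental theorem of calculus
along an edge of a simplex needs it. -/
lemma hasDerivAt_ev_line (p : MPoly d) (y e : Euc d) (t : ℝ) :
    HasDerivAt (fun t : ℝ => p.ev (y + t • e))
      (∑ j, e j * MPoly.ev (MvPolynomial.pderiv j p) (y + t • e)) t := by
  induction p using MvPolynomial.induction_on with
  | C a => simpa using hasDerivAt_const t a
  | add p q hp hq =>
    have h1 : (fun t : ℝ => MPoly.ev (p + q : MPoly d) (y + t • e)) =
        fun t : ℝ => MPoly.ev p (y + t • e) + MPoly.ev q (y + t • e) := by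
      funext t; exact ev_add p q _
    have h2 : ∑ j, e j * MPoly.ev (MvPolynomial.pderiv j (p + q)) (y + t • e) =
        ∑ j, e j * MPoly.ev (MvPolynomial.pderiv j p) (y + t • e) +
          ∑ j, e j * MPoly.ev (MvPolynomial.pderiv j q) (y + t • e) := by
      simp only [map_add, ev_add, mul_add, Finset.sum_add_distrib]
    rw [h1, h2]
    exact hp.fun_add hq
  | mul_X p i hp =>
    have h1 : HasDerivAt (fun t : ℝ => (y + t • e) i) (e i) t := by
      simpa using ((hasDerivAt_id t).mul_const (e i)).const_add (y i)
    have h2 : (fun t : ℝ => MPoly.ev (p * MvPolynomial.X i : MPoly d) (y + t • e)) =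
        fun t : ℝ => MPoly.ev p (y + t • e) * (y + t • e) i := by
      funext t
      rw [ev_mul, ev_X]
    have h3 : ∀ j, e j * MPoly.ev (MvPolynomial.pderiv j (p * MvPolynomial.X i)) (y + t • e) =
        e j * MPoly.ev (MvPolynomial.pderiv j p) (y + t • e) * (y + t • e) i +
          if j = i then MPoly.ev p (y + t • e) * e i else 0 := by
      intro j
      rw [MvPolynomial.pderiv_mul, ev_add, ev_mul, ev_mul, ev_X]
      by_cases h : j = i
      · subst h; rw [MvPolynomial.pderiv_X_self, ev_one, if_pos rfl]; ring
      · rw [MvPolynomial.pderiv_X_of_ne (Ne.symm h), ev_zero, if_neg h]; ring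
    rw [h2]
    simp only [h3, Finset.sum_add_distrib, ← Finset.sum_mul, Finset.sum_ite_eq',
      Finset.mem_univ, if_true]
    exact hp.fun_mul h1

end MPoly

/-! ### Fubini's theorem along oblique directions and area on hyperplanes -/

section SurfaceMeasure

open Module

variable {E : Type*} [NormedAddCommGroup E] [InnerProductSpace ℝ E] [FiniteDimensional ℝ E]
  [MeasurableSpace E] [BorelSpace E]

omit [MeasurableSpace E] [BorelSpace E] in
lemma finrank_orthogonal_span_singleton_of_ne_zero {u : E} (hu : u ≠ 0) :
    finrank ℝ (ℝ ∙ u)ᗮ = finrank ℝ E - 1 := by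
  have h := (ℝ ∙ u).finrank_add_finrank_orthogonal
  rw [finrank_span_singleton hu] at h
  omega

/-- An isometric embedding preserves Hausdorff measure, and on `uᗮ` the Hausdorff measure of full
dimension is Lebesgue measure. -/
lemma volume_preimage_add_orthogonal {u : E} (hu : u ≠ 0) (p : E) (A : Set E) :
    volume ((fun w : (ℝ ∙ u)ᗮ => p + (w : E)) ⁻¹' A) =
      μHE[finrank ℝ E - 1] (A ∩ AffineSubspace.mk' p (ℝ ∙ u)ᗮ) := by
  have hiso : Isometry (fun w : (ℝ ∙ u)ᗮ => p + (w : E)) :=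
    (isometry_add_left p).comp isometry_subtype_coe
  rw [← InnerProductSpace.euclideanHausdorffMeasure_eq_volume,
    hiso.euclideanHausdorffMeasure_preimage, finrank_orthogonal_span_singleton_of_ne_zero hu]
  congr 2
  ext x
  simp only [Set.mem_range, SetLike.mem_coe, AffineSubspace.mem_mk']
  constructor
  · rintro ⟨w, rfl⟩; simp
  · intro h; exact ⟨⟨_, h⟩, by simp⟩

/-- Fubini's theorem along a direction transversal to a hyperplane. -/
lemma volume_eq_prod_transversal {u e : E} (hue : inner ℝ u e = 1) (p : E) {A : Set E}
    (hA : MeasurableSet A) :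
    volume A = ENNReal.ofReal ‖u‖⁻¹ *
      ((volume : Measure (ℝ ∙ u)ᗮ).prod (volume : Measure ℝ))
        ((fun z : (ℝ ∙ u)ᗮ × ℝ => p + (z.1 : E) + z.2 • e) ⁻¹' A) := by
  have hu : u ≠ 0 := by rintro rfl; simp at hue
  have hn : 0 < ‖u‖ := norm_pos_iff.2 hu
  have hmeas : Measurable (fun z : (ℝ ∙ u)ᗮ × ℝ => p + (z.1 : E) + z.2 • e) := by
    fun_prop
  rw [Measure.prod_apply_symm (hmeas hA), ← InnerProductSpace.euclideanHausdorffMeasure_eq_volume,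
    EuclideanGeometry.euclideanHausdorffMeasure_eq_lintegral p hu hA]
  -- Since `⟨u, e⟩ = 1`, the points `p + x u` and `p + ‖u‖² x e` lie on the same hyperplane parallel
  -- to `uᗮ`. The slices seen from them differ by a translation within `uᗮ`, which preserves volume.
  have key : ∀ x : ℝ, μHE[finrank ℝ E - 1] (A ∩ AffineSubspace.mk' (x • u +ᵥ p) (ℝ ∙ u)ᗮ) =
      volume ((fun w : (ℝ ∙ u)ᗮ => (w, ‖u‖ ^ 2 * x)) ⁻¹'
        ((fun z : (ℝ ∙ u)ᗮ × ℝ => p + (z.1 : E) + z.2 • e) ⁻¹' A)) := by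
    intro x
    rw [← volume_preimage_add_orthogonal hu]
    have hw : x • u - (‖u‖ ^ 2 * x) • e ∈ (ℝ ∙ u)ᗮ := by
      rw [Submodule.mem_orthogonal_singleton_iff_inner_right, inner_sub_right, inner_smul_right,
        inner_smul_right, hue, real_inner_self_eq_norm_sq]
      ring
    rw [← measure_preimage_add (volume : Measure (ℝ ∙ u)ᗮ) ⟨_, hw⟩
      ((fun w : (ℝ ∙ u)ᗮ => (w, ‖u‖ ^ 2 * x)) ⁻¹'
        ((fun z : (ℝ ∙ u)ᗮ × ℝ => p + (z.1 : E) + z.2 • e) ⁻¹' A))]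
    congr 1
    ext w
    simp only [Set.mem_preimage, vadd_eq_add, Submodule.coe_add]
    have : x • u + p + (w : E) = p + (x • u - (‖u‖ ^ 2 * x) • e + w) + (‖u‖ ^ 2 * x) • e := by
      abel
    rw [this]
  simp_rw [key]
  have hsq : ‖u‖ ^ 2 ≠ 0 := by positivity
  -- The substitution `t = ‖u‖² x` costs `‖u‖⁻²`, the orthogonal slicing formula carries `‖u‖`, and
  -- `‖u‖⁻¹` remains.
  have hscale := (Homeomorph.mulLeft₀ (‖u‖ ^ 2) hsq).measurableEmbedding.lintegral_map
    (μ := volume) (fun t => volume ((fun w : (ℝ ∙ u)ᗮ => (w, t)) ⁻¹'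
        ((fun z : (ℝ ∙ u)ᗮ × ℝ => p + (z.1 : E) + z.2 • e) ⁻¹' A)))
  simp only [Homeomorph.coe_mulLeft₀] at hscale
  rw [← hscale, Real.map_volume_mul_left hsq, lintegral_smul_measure, smul_eq_mul, ← mul_assoc,
    ← ofReal_norm, ← ENNReal.ofReal_mul hn.le]
  congr 2
  rw [abs_of_pos (by positivity)]
  field_simp

lemma map_prod_transversal {u e : E} (hue : inner ℝ u e = 1) (p : E) :
    ((volume : Measure (ℝ ∙ u)ᗮ).prod (volume : Measure ℝ)).map
      (fun z : (ℝ ∙ u)ᗮ × ℝ => p + (z.1 : E) + z.2 • e) = ENNReal.ofReal ‖u‖ • volume := by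
  have hu : u ≠ 0 := by rintro rfl; simp at hue
  have hn : 0 < ‖u‖ := norm_pos_iff.2 hu
  ext A hA
  rw [Measure.map_apply (by fun_prop) hA, Measure.smul_apply, smul_eq_mul,
    volume_eq_prod_transversal hue p hA, ← mul_assoc, ← ENNReal.ofReal_mul hn.le,
    mul_inv_cancel₀ hn.ne', ENNReal.ofReal_one, one_mul]

/-- Fubini's theorem along a direction transversal to a hyperplane, for integrals. -/
lemma integral_eq_integral_integral_transversal {u e : E} (hue : inner ℝ u e = 1) (p : E)
    {G : E → ℝ} (hG : Integrable G) :
    ∫ x, G x = ‖u‖⁻¹ * ∫ w : (ℝ ∙ u)ᗮ, ∫ t : ℝ, G (p + (w : E) + t • e) := by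
  have hu : u ≠ 0 := by rintro rfl; simp at hue
  have hn : 0 < ‖u‖ := norm_pos_iff.2 hu
  have hG' : Integrable G (ENNReal.ofReal ‖u‖ • volume) := hG.smul_measure ENNReal.ofReal_ne_top
  rw [← map_prod_transversal hue p] at hG'
  have hm : Measurable (fun z : (ℝ ∙ u)ᗮ × ℝ => p + (z.1 : E) + z.2 • e) := by fun_prop
  rw [integrable_map_measure hG'.aestronglyMeasurable hm.aemeasurable] at hG'
  have h1 := integral_map (μ := (volume : Measure (ℝ ∙ u)ᗮ).prod (volume : Measure ℝ))
    hm.aemeasurable (f := G) (by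
      rw [map_prod_transversal hue p]
      exact (hG.smul_measure ENNReal.ofReal_ne_top).aestronglyMeasurable)
  rw [map_prod_transversal hue p, integral_smul_measure, ENNReal.toReal_ofReal hn.le,
    smul_eq_mul] at h1
  have h2 := integral_prod _ hG'
  simp only [Function.comp_def] at h2
  rw [← h2, ← h1, ← mul_assoc, inv_mul_cancel₀ hn.ne', one_mul]

/-- The projection along `e` from the hyperplane `uᗮ` to the hyperplane `vᗮ`. -/
def hyperplaneProj {u v e : E} (hve : inner ℝ v e = -1) (w : (ℝ ∙ u)ᗮ) : (ℝ ∙ v)ᗮ :=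
  ⟨(w : E) + (inner ℝ v (w : E) : ℝ) • e, by
    rw [Submodule.mem_orthogonal_singleton_iff_inner_right, inner_add_right, inner_smul_right, hve]
    ring⟩

lemma measurable_hyperplaneProj {u v e : E} (hve : inner ℝ v e = -1) :
    Measurable (hyperplaneProj (u := u) hve) := by
  refine Measurable.subtype_mk ?_
  fun_prop

/-- Compute one volume twice. Let `A` be the part of the cylinder over `B` in direction `e` where `0
≤ ⟨u, x⟩ ≤ 1`; every line of the cylinder meets it in a parameter interval of length one. Fubini
from `uᗮ` gives `‖u‖⁻¹` times the volume of the preimage of `B`, and Fubini from `vᗮ` gives `‖v‖⁻¹`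
times the volume of `B`. -/
lemma map_hyperplaneProj {u v e : E} (hue : inner ℝ u e = 1) (hve : inner ℝ v e = -1) :
    ENNReal.ofReal ‖u‖⁻¹ • (volume : Measure (ℝ ∙ u)ᗮ).map (hyperplaneProj hve) =
      ENNReal.ofReal ‖v‖⁻¹ • (volume : Measure (ℝ ∙ v)ᗮ) := by
  have hve' : inner ℝ v (-e) = 1 := by rw [inner_neg_right, hve, neg_neg]
  ext B hB
  set top : E → (ℝ ∙ v)ᗮ := fun x => ⟨x + (inner ℝ v x : ℝ) • e, by
    rw [Submodule.mem_orthogonal_singleton_iff_inner_right, inner_add_right, inner_smul_right, hve]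
    ring⟩ with htop
  have htopm : Measurable top := by
    refine Measurable.subtype_mk ?_
    fun_prop
  set A : Set E := top ⁻¹' B ∩ (fun x => inner ℝ u x) ⁻¹' Set.Icc (0 : ℝ) 1 with hA
  have hAm : MeasurableSet A :=
    (htopm hB).inter ((by fun_prop : Measurable (fun x : E => inner ℝ u x)) measurableSet_Icc)
  have h1 := volume_eq_prod_transversal hue 0 hAm
  have h2 := volume_eq_prod_transversal hve' 0 hAm
  have e1 : (fun z : (ℝ ∙ u)ᗮ × ℝ => (0 : E) + (z.1 : E) + z.2 • e) ⁻¹' A =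
      (hyperplaneProj hve ⁻¹' B) ×ˢ Set.Icc (0 : ℝ) 1 := by
    ext ⟨w, t⟩
    have hw : inner ℝ u (w : E) = 0 :=
      Submodule.mem_orthogonal_singleton_iff_inner_right.1 w.2
    have ht : top ((0 : E) + (w : E) + t • e) = hyperplaneProj hve w := by
      apply Subtype.ext
      simp only [htop, hyperplaneProj, zero_add, inner_add_right, inner_smul_right, hve]
      module
    simp only [hA, Set.mem_preimage, Set.mem_inter_iff, Set.mem_prod, ht]
    rw [zero_add, inner_add_right, inner_smul_right, hue, hw, zero_add, mul_one]
  have e2 : ((volume : Measure (ℝ ∙ v)ᗮ).prod (volume : Measure ℝ))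
      ((fun z : (ℝ ∙ v)ᗮ × ℝ => (0 : E) + (z.1 : E) + z.2 • (-e)) ⁻¹' A) = volume B := by
    rw [Measure.prod_apply ((by fun_prop : Measurable
      (fun z : (ℝ ∙ v)ᗮ × ℝ => (0 : E) + (z.1 : E) + z.2 • (-e))) hAm), ← lintegral_indicator_one hB]
    congr 1
    ext w
    have hw : inner ℝ v (w : E) = 0 :=
      Submodule.mem_orthogonal_singleton_iff_inner_right.1 w.2
    have ht : ∀ t : ℝ, top ((0 : E) + (w : E) + t • (-e)) = w := by
      intro t
      apply Subtype.ext
      simp only [htop, zero_add, inner_add_right, inner_smul_right, hw, hve']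
      module
    by_cases hwB : w ∈ B
    · have : (Prod.mk w ⁻¹' ((fun z : (ℝ ∙ v)ᗮ × ℝ => (0 : E) + (z.1 : E) + z.2 • (-e)) ⁻¹' A)) =
          Set.Icc (inner ℝ u (w : E) - 1) (inner ℝ u (w : E)) := by
        ext t
        simp only [hA, Set.mem_preimage, Set.mem_inter_iff, ht, hwB, true_and]
        rw [zero_add, inner_add_right, inner_smul_right, inner_neg_right, hue, Set.mem_Icc,
          Set.mem_Icc]
        constructor <;> rintro ⟨h, h'⟩ <;> constructor <;> linarith
      rw [this, Real.volume_Icc, Set.indicator_of_mem hwB]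
      simp
    · have : (Prod.mk w ⁻¹' ((fun z : (ℝ ∙ v)ᗮ × ℝ => (0 : E) + (z.1 : E) + z.2 • (-e)) ⁻¹' A)) =
          ∅ := by
        ext t
        simp only [hA, Set.mem_preimage, Set.mem_inter_iff, ht, hwB, false_and,
          Set.mem_empty_iff_false]
      rw [this, Set.indicator_of_notMem hwB]
      simp
  rw [e1, Measure.prod_prod, Real.volume_Icc] at h1
  rw [e2, h1] at h2
  rw [Measure.smul_apply, Measure.smul_apply,
    Measure.map_apply (measurable_hyperplaneProj hve) hB, smul_eq_mul, smul_eq_mul, ← h2]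
  simp

lemma integral_hyperplaneProj {u v e : E} (hue : inner ℝ u e = 1) (hve : inner ℝ v e = -1)
    {h : E → ℝ} (hh : Measurable h) :
    ‖u‖⁻¹ * ∫ w : (ℝ ∙ u)ᗮ, h ((w : E) + (inner ℝ v (w : E) : ℝ) • e) =
      ‖v‖⁻¹ * ∫ w : (ℝ ∙ v)ᗮ, h w := by
  have hm : Measurable (fun w : (ℝ ∙ v)ᗮ => h w) := hh.comp measurable_subtype_coe
  have h1 := congrArg (fun μ : Measure (ℝ ∙ v)ᗮ => ∫ w, h (w : E) ∂μ) (map_hyperplaneProj hue hve)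
  simp only [integral_smul_measure] at h1
  rw [integral_map (measurable_hyperplaneProj hve).aemeasurable hm.aestronglyMeasurable,
    ENNReal.toReal_ofReal (by positivity), ENNReal.toReal_ofReal (by positivity)] at h1
  exact h1

/-- Surface integrals over subsets of a hyperplane. -/
lemma setIntegral_euclideanHausdorffMeasure {u : E} (hu : u ≠ 0) (p : E) {F : Set E}
    (hF : MeasurableSet F) (hFu : ∀ x ∈ F, inner ℝ u (x - p) = 0) (g : E → ℝ) :
    ∫ x in F, g x ∂μHE[finrank ℝ E - 1] = ∫ w : (ℝ ∙ u)ᗮ, F.indicator g (p + (w : E)) := by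
  have hiso : Isometry (fun w : (ℝ ∙ u)ᗮ => p + (w : E)) :=
    (isometry_add_left p).comp isometry_subtype_coe
  have hmap := hiso.map_euclideanHausdorffMeasure (d := finrank ℝ E - 1)
  rw [← finrank_orthogonal_span_singleton_of_ne_zero hu,
    InnerProductSpace.euclideanHausdorffMeasure_eq_volume] at hmap
  rw [← hiso.isClosedEmbedding.measurableEmbedding.integral_map (F.indicator g), hmap,
    setIntegral_indicator hF, ← finrank_orthogonal_span_singleton_of_ne_zero hu]
  congr 2
  ext x
  simp only [Set.mem_inter_iff, Set.mem_range]
  constructor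
  · intro hx
    exact ⟨⟨⟨x - p, Submodule.mem_orthogonal_singleton_iff_inner_right.2 (hFu x hx)⟩, by simp⟩, hx⟩
  · exact fun hx => hx.2

end SurfaceMeasure

/-! ### Barycentric coordinates and faces of a simplex -/

namespace Cell

variable {d : ℕ} (T : Cell d)

/-- The gradient of the `i`-th barycentric coordinate function. -/
def gradVec (i : Fin (d + 1)) : Euc d := WithLp.toLp 2 (T.baryGrad i)

lemma inner_gradVec (i : Fin (d + 1)) (x : Euc d) :
    inner ℝ (T.gradVec i) x = (T.basis.coord i).linear x := by
  conv_rhs => rw [← (EuclideanSpace.basisFun (Fin d) ℝ).sum_repr x, map_sum]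
  simp [gradVec, PiLp.inner_apply, baryGrad]

lemma inner_gradVec_sub (i : Fin (d + 1)) (x y : Euc d) :
    inner ℝ (T.gradVec i) (x - y) = T.basis.coord i x - T.basis.coord i y := by
  rw [inner_gradVec, ← vsub_eq_sub, AffineMap.linearMap_vsub, vsub_eq_sub]

lemma coord_add_smul (i : Fin (d + 1)) (x e : Euc d) (t : ℝ) :
    T.basis.coord i (x + t • e) = T.basis.coord i x + t * inner ℝ (T.gradVec i) e := by
  have h := T.inner_gradVec_sub i (x + t • e) x
  rw [add_sub_cancel_left, inner_smul_right] at h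
  linarith

@[simp] lemma coord_points_self (i : Fin (d + 1)) : T.basis.coord i (T.points i) = 1 :=
  T.basis.coord_apply_eq i

lemma coord_points_of_ne {i j : Fin (d + 1)} (h : i ≠ j) : T.basis.coord i (T.points j) = 0 :=
  T.basis.coord_apply_ne h

lemma sum_coord_smul (x : Euc d) : ∑ i, T.basis.coord i x • T.points i = x :=
  T.basis.linear_combination_coord_eq_self x

lemma continuous_coord (i : Fin (d + 1)) : Continuous (T.basis.coord i) :=
  AffineMap.continuous_of_finiteDimensional _

@[simp] lemma ev_bary (i : Fin (d + 1)) (x : Euc d) : (T.bary i).ev x = T.basis.coord i x := by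
  have h := T.inner_gradVec_sub i x 0
  rw [sub_zero] at h
  have h2 : inner ℝ (T.gradVec i) x = ∑ j, T.baryGrad i j * x j := by
    simp [gradVec, PiLp.inner_apply, mul_comm]
  rw [bary, MPoly.ev_add, MPoly.ev_sum]
  simp only [MPoly.ev_C, MPoly.ev_mul, MPoly.ev_X]
  linarith

/-- All faces at once: `J = univ` is the cell and `J = {i}ᶜ` the facet opposite to vertex `i`. From
here on the geometry of cells is a matter of signs of coordinates. -/
lemma mem_convexHull_image (J : Set (Fin (d + 1))) (x : Euc d) :
    x ∈ convexHull ℝ (T.points '' J) ↔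
      (∀ j, 0 ≤ T.basis.coord j x) ∧ ∀ j ∉ J, T.basis.coord j x = 0 := by
  classical
  constructor
  · intro hx
    have hconv : Convex ℝ (⋂ j, T.basis.coord j ⁻¹' (if j ∈ J then Set.Ici (0 : ℝ) else {0})) := by
      refine convex_iInter fun j => Convex.affine_preimage _ ?_
      split_ifs
      · exact convex_Ici 0
      · exact convex_singleton 0
    have hsub : T.points '' J ⊆
        ⋂ j, T.basis.coord j ⁻¹' (if j ∈ J then Set.Ici (0 : ℝ) else {0}) := by
      rintro _ ⟨i, hi, rfl⟩
      simp only [Set.mem_iInter, Set.mem_preimage]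
      intro j
      by_cases hji : j = i
      · subst hji; simp [hi]
      · rw [T.coord_points_of_ne hji]; split_ifs <;> simp
    have := convexHull_min hsub hconv hx
    simp only [Set.mem_iInter, Set.mem_preimage] at this
    constructor
    · intro j
      have h := this j
      split_ifs at h with hj
      · exact h
      · exact le_of_eq (Eq.symm h)
    · intro j hj
      have h := this j
      rw [if_neg hj] at h
      exact h
  · rintro ⟨h1, h2⟩
    have hs : ∀ f : Fin (d + 1) → Euc d, ∑ j, T.basis.coord j x • f j =
        ∑ j ∈ Finset.univ.filter (· ∈ J), T.basis.coord j x • f j := by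
      intro f
      rw [Finset.sum_filter]
      refine Finset.sum_congr rfl fun j _ => ?_
      split_ifs with hj
      · rfl
      · rw [h2 j hj, zero_smul]
    rw [← T.sum_coord_smul x, hs]
    refine (convex_convexHull ℝ _).sum_mem (fun j _ => h1 j) ?_ ?_
    · rw [Finset.sum_filter, ← T.basis.sum_coord_apply_eq_one x]
      refine Finset.sum_congr rfl fun j _ => ?_
      split_ifs with hj
      · rfl
      · rw [h2 j hj]
    · intro j hj
      exact subset_convexHull ℝ _ ⟨j, (Finset.mem_filter.1 hj).2, rfl⟩

lemma mem_hull (x : Euc d) : x ∈ T.hull ↔ ∀ j, 0 ≤ T.basis.coord j x := by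
  rw [hull, ← Set.image_univ, mem_convexHull_image]
  simp

lemma facetHull_facet (i : Fin (d + 1)) :
    facetHull (T.facet i) = convexHull ℝ (T.points '' {i}ᶜ) := by
  classical
  rw [facetHull, facet]
  congr 1
  ext x
  simp

lemma mem_facetHull (i : Fin (d + 1)) (x : Euc d) :
    x ∈ facetHull (T.facet i) ↔ (∀ j, 0 ≤ T.basis.coord j x) ∧ T.basis.coord i x = 0 := by
  rw [facetHull_facet, mem_convexHull_image]
  simp

lemma isCompact_hull : IsCompact T.hull := (Set.finite_range _).isCompact_convexHull ℝ

lemma convex_hull : Convex ℝ T.hull := convex_convexHull ℝ _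

lemma gradVec_ne_zero (hd : 1 ≤ d) (i : Fin (d + 1)) : T.gradVec i ≠ 0 := by
  intro h
  have : Nontrivial (Fin (d + 1)) := Fin.nontrivial_iff_two_le.2 (by omega)
  obtain ⟨j, hj⟩ := exists_ne i
  have := T.inner_gradVec_sub i (T.points i) (T.points j)
  rw [h, inner_zero_left, T.coord_points_self, T.coord_points_of_ne hj.symm] at this
  norm_num at this

lemma norm_gradVec (i : Fin (d + 1)) :
    ‖T.gradVec i‖ = Real.sqrt (∑ l, T.baryGrad i l ^ 2) := by
  simp [EuclideanSpace.norm_eq, gradVec]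

lemma normal_eq (i : Fin (d + 1)) (j : Fin d) :
    T.normal i j = -(‖T.gradVec i‖⁻¹ * T.baryGrad i j) := by
  rw [normal, norm_gradVec]
  ring

lemma sum_normal_mul_self (hd : 1 ≤ d) (i : Fin (d + 1)) : ∑ j, T.normal i j * T.normal i j = 1 := by
  have h : ‖T.gradVec i‖ ≠ 0 := norm_ne_zero_iff.2 (T.gradVec_ne_zero hd i)
  have h2 : ‖T.gradVec i‖ ^ 2 = ∑ l, T.baryGrad i l ^ 2 := by
    rw [norm_gradVec, Real.sq_sqrt (Finset.sum_nonneg fun _ _ => sq_nonneg _)]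
  simp only [normal_eq]
  calc ∑ j, -(‖T.gradVec i‖⁻¹ * T.baryGrad i j) * -(‖T.gradVec i‖⁻¹ * T.baryGrad i j)
      = (‖T.gradVec i‖ ^ 2)⁻¹ * ∑ l, T.baryGrad i l ^ 2 := by
        rw [Finset.mul_sum]
        refine Finset.sum_congr rfl fun j _ => ?_
        field_simp
    _ = 1 := by rw [← h2]; field_simp

end Cell

/-! ### Integrals over facets -/

lemma isCompact_facetHull {d : ℕ} (F : Finset (Euc d)) : IsCompact (facetHull F) :=
  F.finite_toSet.isCompact_convexHull ℝ

lemma measurableSet_facetHull {d : ℕ} (F : Finset (Euc d)) : MeasurableSet (facetHull F) :=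
  (isCompact_facetHull F).isClosed.measurableSet

namespace Cell

variable {d : ℕ} (T : Cell d)

/-- The facet lies in the hyperplane `λ_i = 0`, which passes through every vertex `m ≠ i`. The base
point `m` is left free so that two facets can be parametrised from a common vertex. -/
lemma facetIntegral_eq (hd : 1 ≤ d) {i m : Fin (d + 1)} (him : i ≠ m) (g : Euc d → ℝ) :
    facetIntegral (T.facet i) g = ∫ w : (ℝ ∙ T.gradVec i)ᗮ,
      (facetHull (T.facet i)).indicator g (T.points m + (w : Euc d)) := by
  have h := setIntegral_euclideanHausdorffMeasure (T.gradVec_ne_zero hd i) (T.points m)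
    (measurableSet_facetHull (T.facet i)) (fun x hx => by
      rw [inner_gradVec_sub, ((T.mem_facetHull i x).1 hx).2, T.coord_points_of_ne him, sub_zero]) g
  rw [finrank_euclideanSpace_fin] at h
  exact h

lemma measure_facetHull_lt_top (hd : 1 ≤ d) (i : Fin (d + 1)) :
    μHE[d - 1] (facetHull (T.facet i)) < ⊤ := by
  have : Nontrivial (Fin (d + 1)) := Fin.nontrivial_iff_two_le.2 (by omega)
  obtain ⟨m, hm⟩ := exists_ne i
  have h := volume_preimage_add_orthogonal (T.gradVec_ne_zero hd i) (T.points m)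
    (facetHull (T.facet i))
  rw [finrank_euclideanSpace_fin, Set.inter_eq_left.2] at h
  · rw [← h]
    have hiso : Isometry (fun w : (ℝ ∙ T.gradVec i)ᗮ => T.points m + (w : Euc d)) :=
      (isometry_add_left _).comp isometry_subtype_coe
    exact (hiso.isClosedEmbedding.isCompact_preimage (isCompact_facetHull _)).measure_lt_top
  · intro x hx
    rw [SetLike.mem_coe, AffineSubspace.mem_mk',
      Submodule.mem_orthogonal_singleton_iff_inner_right, vsub_eq_sub, inner_gradVec_sub,
      ((T.mem_facetHull i x).1 hx).2, T.coord_points_of_ne hm.symm, sub_zero]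

lemma integrableOn_facet (hd : 1 ≤ d) (i : Fin (d + 1)) {g : Euc d → ℝ} (hg : Continuous g) :
    IntegrableOn g (facetHull (T.facet i)) μHE[d - 1] := by
  obtain ⟨C, hC⟩ := (isCompact_facetHull (T.facet i)).exists_bound_of_continuousOn hg.continuousOn
  refine Measure.integrableOn_of_bounded (M := C) (T.measure_facetHull_lt_top hd i).ne
    hg.aestronglyMeasurable ?_
  exact (ae_restrict_iff' (measurableSet_facetHull _)).2 (Filter.Eventually.of_forall hC)

lemma integrableOn_hull {g : Euc d → ℝ} (hg : Continuous g) : IntegrableOn g T.hull :=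
  hg.continuousOn.integrableOn_compact T.isCompact_hull

lemma facetIntegral_sum (hd : 1 ≤ d) (i : Fin (d + 1)) {κ : Type*} (s : Finset κ)
    {g : κ → Euc d → ℝ} (hg : ∀ a ∈ s, Continuous (g a)) :
    facetIntegral (T.facet i) (fun x => ∑ a ∈ s, g a x) =
      ∑ a ∈ s, facetIntegral (T.facet i) (g a) :=
  integral_finsetSum _ fun a ha => T.integrableOn_facet hd i (hg a ha)

end Cell

lemma facetIntegral_mul_const {d : ℕ} (F : Finset (Euc d)) (g : Euc d → ℝ) (c : ℝ) :
    facetIntegral F (fun x => g x * c) = facetIntegral F g * c :=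
  integral_mul_const _ _

/-! ### Gauss' theorem on a simplex -/

namespace Cell

variable {d : ℕ} (T : Cell d)

/-- Along the edge from vertex `l` to vertex `i` only `λ_i` and `λ_l` change, at opposite rates.
Hence a line in this direction that meets the cell enters it through facet `i` and leaves it through
facet `l`. -/
lemma inner_gradVec_edge {i l : Fin (d + 1)} (hil : i ≠ l) (j : Fin (d + 1)) :
    inner ℝ (T.gradVec j) (T.points i - T.points l) =
      if j = i then 1 else if j = l then -1 else 0 := by
  rw [inner_gradVec_sub]
  split_ifs with h1 h2
  · subst h1; rw [coord_points_self, coord_points_of_ne _ hil, sub_zero]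
  · subst h2; rw [coord_points_self, coord_points_of_ne _ hil.symm, zero_sub]
  · rw [coord_points_of_ne _ h1, coord_points_of_ne _ h2, sub_zero]

/-- Fubini with facet `i` as base and the edge as direction: the line through `y` on the facet stays
in the cell for `0 ≤ t ≤ λ_l(y)`, and the fundamental theorem of calculus evaluates the integral
along it. -/
lemma setIntegral_deriv_edge_eq (hd : 2 ≤ d) {i l : Fin (d + 1)} (hil : i ≠ l) (g : MPoly d) :
    ∫ x in T.hull, ∑ j, (T.points i - T.points l) j * MPoly.ev (MvPolynomial.pderiv j g) x =
      ‖T.gradVec i‖⁻¹ * facetIntegral (T.facet i) (fun y =>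
        g.ev (y + T.basis.coord l y • (T.points i - T.points l)) - g.ev y) := by
  -- A common vertex of the facets `i` and `l`, used as base point; it exists because `d ≥ 2` gives
  -- at least three vertices.
  obtain ⟨m, hmi, hml⟩ : ∃ m, m ≠ i ∧ m ≠ l := by
    obtain ⟨m, hm⟩ := Finset.exists_mem_notMem_of_card_lt_card
      (s := {i, l}) (t := (Finset.univ : Finset (Fin (d + 1))))
      (lt_of_le_of_lt Finset.card_le_two (by simp; omega))
    simp only [Finset.mem_insert, Finset.mem_singleton, not_or] at hm
    exact ⟨m, hm.2⟩
  set e := T.points i - T.points l with he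
  have hue : inner ℝ (T.gradVec i) e = 1 := by simp [he, T.inner_gradVec_edge hil]
  set D : Euc d → ℝ := fun x => ∑ j, e j * MPoly.ev (MvPolynomial.pderiv j g) x with hD
  have hDc : Continuous D := by
    refine continuous_finsetSum _ fun j _ => ?_
    fun_prop
  have hint : Integrable (T.hull.indicator D) :=
    (integrable_indicator_iff T.isCompact_hull.isClosed.measurableSet).2 (T.integrableOn_hull hDc)
  rw [← integral_indicator T.isCompact_hull.isClosed.measurableSet,
    integral_eq_integral_integral_transversal hue (T.points m) hint,
    T.facetIntegral_eq (by omega) hmi.symm]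
  congr 2
  ext w
  set y := T.points m + (w : Euc d) with hy
  have hyi : T.basis.coord i y = 0 := by
    have h := T.inner_gradVec_sub i y (T.points m)
    rw [hy, add_sub_cancel_left, Submodule.mem_orthogonal_singleton_iff_inner_right.1 w.2,
      T.coord_points_of_ne hmi.symm] at h
    linarith
  have hmem : ∀ t : ℝ, y + t • e ∈ T.hull ↔
      y ∈ facetHull (T.facet i) ∧ t ∈ Set.Icc 0 (T.basis.coord l y) := by
    intro t
    rw [mem_hull, mem_facetHull, Set.mem_Icc]
    simp only [T.coord_add_smul, he, T.inner_gradVec_edge hil]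
    constructor
    · intro h
      have hi := h i
      have hl := h l
      simp only [if_true, if_neg hil.symm, hyi, zero_add, mul_one] at hi hl
      refine ⟨⟨fun j => ?_, hyi⟩, hi, by linarith⟩
      by_cases h1 : j = i
      · rw [h1, hyi]
      · by_cases h2 : j = l
        · rw [h2]; linarith
        · simpa [h1, h2] using h j
    · rintro ⟨⟨h, -⟩, h1, h2⟩ j
      split_ifs with h3 h4
      · subst h3; rw [hyi]; linarith
      · subst h4; linarith
      · simpa using h j
  by_cases hyF : y ∈ facetHull (T.facet i)
  · rw [Set.indicator_of_mem hyF]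
    have hl0 : 0 ≤ T.basis.coord l y := ((T.mem_facetHull i y).1 hyF).1 l
    have h1 : (fun t : ℝ => T.hull.indicator D (y + t • e)) =
        (Set.Icc 0 (T.basis.coord l y)).indicator (fun t : ℝ => D (y + t • e)) := by
      ext t
      by_cases ht : t ∈ Set.Icc 0 (T.basis.coord l y)
      · rw [Set.indicator_of_mem ht, Set.indicator_of_mem ((hmem t).2 ⟨hyF, ht⟩)]
      · rw [Set.indicator_of_notMem ht, Set.indicator_of_notMem (fun h => ht ((hmem t).1 h).2)]
    rw [h1, integral_indicator measurableSet_Icc, integral_Icc_eq_integral_Ioc,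
      ← intervalIntegral.integral_of_le hl0,
      intervalIntegral.integral_eq_sub_of_hasDerivAt (fun t _ => g.hasDerivAt_ev_line y e t)
        ((hDc.comp (by fun_prop : Continuous fun t : ℝ => y + t • e)).intervalIntegrable _ _)]
    simp
  · rw [Set.indicator_of_notMem hyF]
    have h1 : (fun t : ℝ => T.hull.indicator D (y + t • e)) = fun _ => 0 := by
      ext t
      exact Set.indicator_of_notMem (fun h => hyF ((hmem t).1 h).1) _
    rw [h1, integral_zero]

/-- The projection along the edge maps facet `i` bijectively onto facet `l` and multiplies area by
`‖∇λ_l‖ / ‖∇λ_i‖`. It turns the exit values on the lines into an integral over facet `l`. -/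
lemma facetIntegral_comp_edge_proj (hd : 2 ≤ d) {i l : Fin (d + 1)} (hil : i ≠ l) {g : Euc d → ℝ}
    (hg : Continuous g) :
    ‖T.gradVec i‖⁻¹ * facetIntegral (T.facet i) (fun y =>
        g (y + T.basis.coord l y • (T.points i - T.points l))) =
      ‖T.gradVec l‖⁻¹ * facetIntegral (T.facet l) g := by
  obtain ⟨m, hmi, hml⟩ : ∃ m, m ≠ i ∧ m ≠ l := by
    obtain ⟨m, hm⟩ := Finset.exists_mem_notMem_of_card_lt_card
      (s := {i, l}) (t := (Finset.univ : Finset (Fin (d + 1))))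
      (lt_of_le_of_lt Finset.card_le_two (by simp; omega))
    simp only [Finset.mem_insert, Finset.mem_singleton, not_or] at hm
    exact ⟨m, hm.2⟩
  set e := T.points i - T.points l with he
  have hue : inner ℝ (T.gradVec i) e = 1 := by simp [he, T.inner_gradVec_edge hil]
  have hve : inner ℝ (T.gradVec l) e = -1 := by simp [he, T.inner_gradVec_edge hil, hil.symm]
  have hh : Measurable fun z : Euc d =>
      (facetHull (T.facet l)).indicator g (T.points m + z) :=
    (hg.measurable.indicator (measurableSet_facetHull _)).comp (measurable_const_add _)
  rw [T.facetIntegral_eq (by omega) hml.symm, ← integral_hyperplaneProj hue hve hh,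
    T.facetIntegral_eq (by omega) hmi.symm]
  congr 2
  ext w
  set y := T.points m + (w : Euc d) with hy
  have hyi : T.basis.coord i y = 0 := by
    have h := T.inner_gradVec_sub i y (T.points m)
    rw [hy, add_sub_cancel_left, Submodule.mem_orthogonal_singleton_iff_inner_right.1 w.2,
      T.coord_points_of_ne hmi.symm] at h
    linarith
  have hyl : inner ℝ (T.gradVec l) (w : Euc d) = T.basis.coord l y := by
    have h := T.inner_gradVec_sub l y (T.points m)
    rw [hy, add_sub_cancel_left, T.coord_points_of_ne hml.symm, sub_zero] at h
    exact h
  rw [hyl, ← add_assoc, ← hy]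
  have hmem : y ∈ facetHull (T.facet i) ↔
      y + T.basis.coord l y • e ∈ facetHull (T.facet l) := by
    rw [mem_facetHull, mem_facetHull]
    simp only [T.coord_add_smul, he, T.inner_gradVec_edge hil]
    constructor
    · rintro ⟨h, -⟩
      refine ⟨fun j => ?_, by simp [hil.symm]⟩
      split_ifs with h3 h4
      · subst h3; rw [hyi]; linarith [h l]
      · subst h4; simp
      · simpa using h j
    · rintro ⟨h, -⟩
      refine ⟨fun j => ?_, hyi⟩
      by_cases h1 : j = i
      · rw [h1, hyi]
      · by_cases h2 : j = l
        · subst h2; simpa [hyi] using h i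
        · simpa [h1, h2] using h j
  by_cases hyF : y ∈ facetHull (T.facet i)
  · rw [Set.indicator_of_mem hyF, Set.indicator_of_mem (hmem.1 hyF)]
  · rw [Set.indicator_of_notMem hyF, Set.indicator_of_notMem (fun h => hyF (hmem.2 h))]

lemma setIntegral_deriv_edge (hd : 2 ≤ d) (i l : Fin (d + 1)) (g : MPoly d) :
    ∫ x in T.hull, ∑ j, (T.points i - T.points l) j * MPoly.ev (MvPolynomial.pderiv j g) x =
      ‖T.gradVec l‖⁻¹ * facetIntegral (T.facet l) g.ev -
        ‖T.gradVec i‖⁻¹ * facetIntegral (T.facet i) g.ev := by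
  by_cases hil : i = l
  · subst hil; simp
  · have hl := T.continuous_coord l
    have hc : Continuous fun y : Euc d =>
        g.ev (y + T.basis.coord l y • (T.points i - T.points l)) := by
      fun_prop
    rw [T.setIntegral_deriv_edge_eq hd hil, ← T.facetIntegral_comp_edge_proj hd hil g.continuous_ev,
      ← mul_sub]
    congr 1
    exact integral_sub (T.integrableOn_facet (by omega) i hc)
      (T.integrableOn_facet (by omega) i g.continuous_ev)

/-- Gauss' theorem on a simplex, for one partial derivative. -/
lemma setIntegral_pderiv (hd : 2 ≤ d) (j : Fin d) (g : MPoly d) :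
    ∫ x in T.hull, MPoly.ev (MvPolynomial.pderiv j g) x =
      ∑ i, facetIntegral (T.facet i) g.ev * T.normal i j := by
  have hb : ∀ i, T.baryGrad i j =
      T.basis.coord i (EuclideanSpace.single j 1) - T.basis.coord i 0 := by
    intro i
    rw [← T.inner_gradVec_sub, sub_zero, inner_gradVec, baryGrad]
  have hsum0 : ∑ i, T.baryGrad i j = 0 := by
    simp only [hb, Finset.sum_sub_distrib, T.basis.sum_coord_apply_eq_one, sub_self]
  -- The unit vector `e_j` as a combination of edge vectors issuing from vertex `0`, so that `∂_j`
  -- becomes a combination of edge derivatives.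
  have hsum : ∑ i, T.baryGrad i j • (T.points i - T.points 0) = EuclideanSpace.single j 1 := by
    simp only [smul_sub, Finset.sum_sub_distrib]
    rw [← Finset.sum_smul, hsum0, zero_smul, sub_zero]
    simp only [hb, sub_smul, Finset.sum_sub_distrib, T.sum_coord_smul, sub_zero]
  have hpt : ∀ x, MPoly.ev (MvPolynomial.pderiv j g) x = ∑ i, T.baryGrad i j *
      ∑ a, (T.points i - T.points 0) a * MPoly.ev (MvPolynomial.pderiv a g) x := by
    intro x
    simp only [Finset.mul_sum]
    rw [Finset.sum_comm]
    have : ∀ a, ∑ i, T.baryGrad i j * ((T.points i - T.points 0) a *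
        MPoly.ev (MvPolynomial.pderiv a g) x) =
        (EuclideanSpace.single j (1 : ℝ)) a * MPoly.ev (MvPolynomial.pderiv a g) x := by
      intro a
      rw [← hsum]
      simp [Finset.sum_mul, mul_assoc]
    simp only [this]
    simp
  simp only [hpt]
  rw [integral_finsetSum]
  · simp only [integral_const_mul, T.setIntegral_deriv_edge hd, mul_sub, Finset.sum_sub_distrib]
    -- The terms on facet `0` cancel because `∑ ∂_j λ_i = 0`; on facet `i` the factor `-‖∇λ_i‖⁻¹ ∂_j
    -- λ_i` is the normal component `n_j`.
    rw [← Finset.sum_mul, hsum0, zero_mul, zero_sub, ← Finset.sum_neg_distrib]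
    refine Finset.sum_congr rfl fun i _ => ?_
    rw [normal_eq]
    ring
  · intro i _
    refine T.integrableOn_hull ?_
    refine continuous_const.mul (continuous_finsetSum _ fun a _ => ?_)
    fun_prop

/-- Gauss' theorem on a simplex, for polynomial vector fields. -/
lemma setIntegral_divV (hd : 2 ≤ d) (v : Fin d → MPoly d) :
    ∫ x in T.hull, MPoly.ev (MPoly.divV v) x =
      ∑ i, facetIntegral (T.facet i) (T.trN i v) := by
  have h : ∀ i, facetIntegral (T.facet i) (T.trN i v) =
      ∑ a, facetIntegral (T.facet i) (v a).ev * T.normal i a := by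
    intro i
    unfold trN
    rw [T.facetIntegral_sum (by omega) i _ fun a _ => by fun_prop]
    simp only [facetIntegral_mul_const]
  simp only [h, MPoly.divV, MPoly.ev_sum]
  rw [integral_finsetSum _ fun a _ => T.integrableOn_hull (MPoly.continuous_ev _),
    Finset.sum_comm]
  simp only [T.setIntegral_pderiv hd]

end Cell

/-! ### The Chu-Vandermonde identity and its first moment -/

/-- At `y = k λ_i` the right side is the `i`-th factor of `lagrangeBasis`, so the basis polynomials
are products of generalised binomial coefficients. -/
lemma Ring.choose_eq_prod_range (y : ℝ) (n : ℕ) :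
    Ring.choose y n = ∏ j ∈ Finset.range n, ((j : ℝ) + 1)⁻¹ * (y - j) := by
  have h : ∀ n : ℕ, (descPochhammer ℤ n).smeval y = ∏ j ∈ Finset.range n, (y - j) := by
    intro n
    induction n with
    | zero => simp [Polynomial.smeval_one]
    | succ n ih =>
      rw [descPochhammer_succ_right, Polynomial.smeval_mul, ih, Finset.prod_range_succ]
      simp [Polynomial.smeval_sub, Polynomial.smeval_X, Polynomial.smeval_natCast]
  rw [Ring.choose_eq_smul, h, Finset.prod_mul_distrib, Finset.prod_inv_distrib, smul_eq_mul,
    ← Finset.prod_range_add_one_eq_factorial]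
  push_cast
  rfl

/-- Splits off the entry of the multi-index at `i`. The weight `G` is kept general to serve both the
plain sum and the first moment. -/
lemma Finset.sum_piAntidiag_insert_mul {ι : Type*} [DecidableEq ι] {i : ι} {s : Finset ι}
    (hi : i ∉ s) (n : ℕ) (G : ℕ → ℝ) (y : ι → ℝ) :
    ∑ α ∈ Finset.piAntidiag (insert i s) n, G (α i) * ∏ j ∈ s, Ring.choose (y j) (α j) =
      ∑ ab ∈ Finset.HasAntidiagonal.antidiagonal n, G ab.1 *
        ∑ β ∈ Finset.piAntidiag s ab.2, ∏ j ∈ s, Ring.choose (y j) (β j) := by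
  rw [← Finset.cons_eq_insert i s hi, Finset.piAntidiag_cons hi, Finset.sum_disjiUnion]
  refine Finset.sum_congr rfl fun ab _ => ?_
  rw [Finset.sum_map, Finset.mul_sum]
  refine Finset.sum_congr rfl fun β hβ => ?_
  have hβi : β i = 0 := by
    by_contra h
    exact hi ((Finset.mem_piAntidiag.1 hβ).2 i h)
  simp only [addRightEmbedding_apply, Pi.add_apply, if_true, hβi, zero_add]
  congr 1
  refine Finset.prod_congr rfl fun j hj => ?_
  rw [if_neg (by rintro rfl; exact hi hj), add_zero]

/-- The Chu-Vandermonde identity for several summands. -/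
lemma Finset.sum_piAntidiag_prod_choose {ι : Type*} [DecidableEq ι] (s : Finset ι) (n : ℕ)
    (y : ι → ℝ) :
    ∑ α ∈ Finset.piAntidiag s n, ∏ j ∈ s, Ring.choose (y j) (α j) =
      Ring.choose (∑ j ∈ s, y j) n := by
  induction s using Finset.induction_on generalizing n with
  | empty =>
    rw [Finset.piAntidiag_empty]
    split_ifs with h
    · subst h; simp
    · simp [Ring.choose_zero_pos ℝ (Nat.pos_of_ne_zero h)]
  | insert i s hi ih =>
    simp only [Finset.prod_insert hi, Finset.sum_insert hi]
    rw [Finset.sum_piAntidiag_insert_mul hi n (fun a => Ring.choose (y i) a) y,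
      Ring.add_choose_eq n (Commute.all _ _)]
    simp only [ih]

lemma Ring.add_one_mul_choose_add_one (y : ℝ) (n : ℕ) :
    ((n : ℝ) + 1) * Ring.choose y (n + 1) = y * Ring.choose (y - 1) n := by
  have h := Ring.choose_smul_choose y (n := n + 1) (k := 1) (by omega)
  simpa using h

/-- The first moment of the Chu-Vandermonde weights. -/
lemma Finset.sum_piAntidiag_mul_prod_choose {ι : Type*} [DecidableEq ι] {s : Finset ι} {i : ι}
    (hi : i ∈ s) (n : ℕ) (y : ι → ℝ) :
    ∑ α ∈ Finset.piAntidiag s (n + 1), (α i : ℝ) * ∏ j ∈ s, Ring.choose (y j) (α j) =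
      y i * Ring.choose (∑ j ∈ s, y j - 1) n := by
  obtain ⟨s, his, rfl⟩ : ∃ t, i ∉ t ∧ insert i t = s :=
    ⟨s.erase i, Finset.notMem_erase i s, Finset.insert_erase hi⟩
  simp only [Finset.prod_insert his, Finset.sum_insert his, ← mul_assoc]
  rw [Finset.sum_piAntidiag_insert_mul his (n + 1) (fun a => (a : ℝ) * Ring.choose (y i) a) y,
    Finset.Nat.antidiagonal_succ, Finset.sum_cons, Finset.sum_map]
  simp only [Nat.cast_zero, zero_mul, zero_add, Finset.sum_piAntidiag_prod_choose]
  -- The terms with `α i = 0` are gone, and absorption, `(a + 1) C(y, a + 1) = y C(y - 1, a)`,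
  -- shifts the others. What remains is Chu-Vandermonde with `y i - 1` in place of `y i`.
  rw [show y i + ∑ j ∈ s, y j - 1 = (y i - 1) + ∑ j ∈ s, y j by ring,
    Ring.add_choose_eq n (Commute.all _ _), Finset.mul_sum]
  refine Finset.sum_congr rfl fun ab _ => ?_
  simp [Ring.add_one_mul_choose_add_one, mul_assoc]

/-! ### Lagrange interpolation and hat functions -/

namespace Cell

variable {d : ℕ} (T : Cell d)

lemma ev_lagrangeBasis (k : ℕ) (α : Fin (d + 1) → ℕ) (x : Euc d) :
    (T.lagrangeBasis k α).ev x = ∏ i, Ring.choose (k * T.basis.coord i x) (α i) := by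
  rw [lagrangeBasis, MPoly.ev_prod]
  refine Finset.prod_congr rfl fun i _ => ?_
  rw [MPoly.ev_prod, Ring.choose_eq_prod_range]
  simp only [MPoly.ev_mul, MPoly.ev_sub, MPoly.ev_C, ev_bary]

lemma coord_node {k : ℕ} (hk : 1 ≤ k) {α : Fin (d + 1) → ℕ} (hα : ∑ i, α i = k)
    (i : Fin (d + 1)) : T.basis.coord i (T.node k α) = α i / k := by
  have hk' : (k : ℝ) ≠ 0 := by positivity
  have hw : ∑ i, (α i : ℝ) / (k : ℝ) = 1 := by
    rw [← Finset.sum_div, ← Nat.cast_sum, hα, div_self hk']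
  have h := T.basis.coord_apply_combination_of_mem (Finset.mem_univ i) hw
  rw [Finset.affineCombination_eq_linear_combination _ _ _ hw] at h
  exact h

/-- Lagrange interpolation reproduces multiples of the barycentric coordinates. -/
lemma ev_lagrangeInterp_bary {k : ℕ} (hk : 1 ≤ k) (i : Fin (d + 1)) (c : ℝ) (x : Euc d) :
    (T.lagrangeInterp k (T.bary i * MvPolynomial.C c)).ev x = T.basis.coord i x * c := by
  classical
  obtain ⟨n, rfl⟩ : ∃ n, k = n + 1 := ⟨k - 1, by omega⟩
  have hn : ((n + 1 : ℕ) : ℝ) ≠ 0 := by positivity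
  -- The nodal values of `λ_i` are `α_i / k`, so the interpolant is a first moment of the
  -- Chu-Vandermonde weights.
  have h1 : (T.lagrangeInterp (n + 1) (T.bary i * MvPolynomial.C c)).ev x =
      c / (n + 1 : ℕ) * ∑ α ∈ Finset.piAntidiag (Finset.univ : Finset (Fin (d + 1))) (n + 1),
        (α i : ℝ) * ∏ j, Ring.choose (((n + 1 : ℕ) : ℝ) * T.basis.coord j x) (α j) := by
    rw [lagrangeInterp, MPoly.ev_sum, Finset.mul_sum]
    refine Finset.sum_congr rfl fun α hα => ?_
    rw [MPoly.ev_mul, MPoly.ev_C, MPoly.ev_mul, MPoly.ev_C, ev_bary,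
      T.coord_node (by omega) (Finset.mem_piAntidiag.1 hα).1, ev_lagrangeBasis]
    ring
  rw [h1, Finset.sum_piAntidiag_mul_prod_choose (Finset.mem_univ i), ← Finset.mul_sum,
    T.basis.sum_coord_apply_eq_one, mul_one]
  -- As the arguments `k λ_j` sum to `k = n + 1`, the binomial coefficient left over is `C(n, n)`.
  have h2 : Ring.choose (((n + 1 : ℕ) : ℝ) - 1) n = 1 := by
    rw [show ((n + 1 : ℕ) : ℝ) - 1 = (n : ℕ) by push_cast; ring, Ring.choose_natCast,
      Nat.choose_self, Nat.cast_one]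
  rw [h2]
  field_simp

lemma lagrangeInterp_add (k : ℕ) (g h : MPoly d) :
    T.lagrangeInterp k (g + h) = T.lagrangeInterp k g + T.lagrangeInterp k h := by
  simp only [lagrangeInterp, MPoly.ev_add, MvPolynomial.C_add, add_mul, Finset.sum_add_distrib]

@[simp] lemma lagrangeInterp_zero (k : ℕ) : T.lagrangeInterp k 0 = 0 := by
  simp [lagrangeInterp]

/-- The Lagrange interpolation operator as an additive map. -/
def lagrangeInterpHom (k : ℕ) : MPoly d →+ MPoly d where
  toFun := T.lagrangeInterp k
  map_zero' := T.lagrangeInterp_zero k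
  map_add' := T.lagrangeInterp_add k

lemma bubble_sub (k : ℕ) (V : Euc d) (v w : Fin d → MPoly d) :
    T.bubble k V (v - w) = T.bubble k V v - T.bubble k V w := by
  funext j
  simp only [bubble, Pi.sub_apply, mul_sub]
  exact map_sub (T.lagrangeInterpHom k) _ _

@[simp] lemma bubble_zero (k : ℕ) (V : Euc d) : T.bubble k V 0 = 0 := by
  funext j
  simp [bubble]

/-- The field `φ_V c` is a combination of barycentric coordinates, which interpolation of degree `k
≥ 1` reproduces. The identity is one of values, because the Chu-Vandermonde argument works
pointwise. -/
lemma ev_bubble_const {k : ℕ} (hk : 1 ≤ k) (V : Euc d) (c : Fin d → ℝ) (j : Fin d) (x : Euc d) :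
    (T.bubble k V (fun a => MvPolynomial.C (c a)) j).ev x = (T.hat V).ev x * c j := by
  classical
  rw [bubble, hat, Finset.sum_mul]
  change MPoly.ev (T.lagrangeInterpHom k _) x = _
  rw [map_sum, MPoly.ev_sum, MPoly.ev_sum, Finset.sum_mul]
  refine Finset.sum_congr rfl fun i _ => ?_
  split_ifs
  · rw [ev_bary]
    exact T.ev_lagrangeInterp_bary hk i (c j) x
  · rw [zero_mul, map_zero, MPoly.ev_zero, zero_mul]

lemma ev_hat_points (i : Fin (d + 1)) (x : Euc d) :
    (T.hat (T.points i)).ev x = T.basis.coord i x := by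
  classical
  rw [hat, MPoly.ev_sum, Finset.sum_eq_single i]
  · simp
  · intro j _ hj
    rw [if_neg (fun h => hj (T.independent.injective h)), MPoly.ev_zero]
  · simp

lemma hat_eq_zero {V : Euc d} (hV : V ∉ Set.range T.points) : T.hat V = 0 := by
  classical
  rw [hat]
  refine Finset.sum_eq_zero fun i _ => if_neg fun h => hV ⟨i, h⟩

lemma bary_mem_degLE (i : Fin (d + 1)) : T.bary i ∈ MPoly.degLE d 1 := by
  refine Submodule.add_mem _ ?_ (Submodule.sum_mem _ fun j _ => ?_)
  · rw [MPoly.degLE, MvPolynomial.mem_restrictTotalDegree, MvPolynomial.totalDegree_C]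
    exact zero_le_one
  · rw [← MvPolynomial.smul_eq_C_mul]
    refine Submodule.smul_mem _ _ ?_
    rw [MPoly.degLE, MvPolynomial.mem_restrictTotalDegree, MvPolynomial.totalDegree_X]

lemma hat_mem_degLE (V : Euc d) : T.hat V ∈ MPoly.degLE d 1 := by
  classical
  refine Submodule.sum_mem _ fun i _ => ?_
  split_ifs
  · exact T.bary_mem_degLE i
  · exact Submodule.zero_mem _

end Cell

/-! ### Cells that share a facet -/

open Topology

namespace Cell

variable {d : ℕ} (T : Cell d)

lemma coord_sum {κ : Type*} [Fintype κ] (j : Fin (d + 1)) {w : κ → ℝ} (hw : ∑ i, w i = 1)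
    (P : κ → Euc d) : T.basis.coord j (∑ i, w i • P i) = ∑ i, w i * T.basis.coord j (P i) := by
  have h : ∀ x, T.basis.coord j x = inner ℝ (T.gradVec j) x + T.basis.coord j 0 := by
    intro x
    have := T.inner_gradVec_sub j x 0
    rw [sub_zero] at this
    linarith
  rw [h, inner_sum]
  calc ∑ i, inner ℝ (T.gradVec j) (w i • P i) + T.basis.coord j 0
      = ∑ i, w i * inner ℝ (T.gradVec j) (P i) + (∑ i, w i) * T.basis.coord j 0 := by
        simp only [inner_smul_right, hw, one_mul]
    _ = ∑ i, w i * T.basis.coord j (P i) := by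
        rw [Finset.sum_mul, ← Finset.sum_add_distrib]
        refine Finset.sum_congr rfl fun i _ => ?_
        rw [h (P i)]
        ring

lemma baryGrad_eq (i : Fin (d + 1)) (j : Fin d) : T.baryGrad i j =
    T.basis.coord i (EuclideanSpace.single j 1) - T.basis.coord i 0 := by
  rw [← T.inner_gradVec_sub, sub_zero, inner_gradVec, baryGrad]

lemma coord_lineMap (j : Fin (d + 1)) (x y : Euc d) (t : ℝ) :
    T.basis.coord j (x + t • (y - x)) =
      T.basis.coord j x + t * (T.basis.coord j y - T.basis.coord j x) := by
  rw [coord_add_smul, inner_gradVec_sub]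

lemma mem_facet {i : Fin (d + 1)} {x : Euc d} : x ∈ T.facet i ↔ ∃ j, j ≠ i ∧ T.points j = x := by
  classical
  simp [facet]

lemma facet_injective : Function.Injective T.facet := by
  intro i j hij
  by_contra h
  have h1 : T.points i ∈ T.facet j := T.mem_facet.2 ⟨i, h, rfl⟩
  rw [← hij] at h1
  obtain ⟨l, hl, hl'⟩ := T.mem_facet.1 h1
  exact hl (T.independent.injective hl')

lemma facetHull_facet_subset (i : Fin (d + 1)) : facetHull (T.facet i) ⊆ T.hull := fun x hx =>
  (T.mem_hull x).2 ((T.mem_facetHull i x).1 hx).1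

lemma range_subset_of_range_subset {S T : Cell d}
    (h : Set.range T.points ⊆ Set.range S.points) : Set.range S.points = Set.range T.points := by
  refine Set.Subset.antisymm ?_ h
  choose f hf using fun j => h ⟨j, rfl⟩
  have hinj : Function.Injective f := fun a b hab => by
    apply T.independent.injective
    rw [← hf a, ← hf b, hab]
  rintro _ ⟨i, rfl⟩
  obtain ⟨j, rfl⟩ := (Finite.injective_iff_surjective.1 hinj) i
  exact ⟨j, (hf j).symm⟩

/-- The barycentre of a finite set of `d` points. -/
def _root_.facetCenter (F : Finset (Euc d)) : Euc d := (d : ℝ)⁻¹ • ∑ p ∈ F, p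

lemma coord_facetCenter (hd : 1 ≤ d) (i j : Fin (d + 1)) :
    T.basis.coord j (facetCenter (T.facet i)) = if j = i then 0 else (d : ℝ)⁻¹ := by
  classical
  have hd' : (d : ℝ) ≠ 0 := by positivity
  have h1 : facetCenter (T.facet i) =
      ∑ l, (if l = i then 0 else (d : ℝ)⁻¹) • T.points l := by
    rw [facetCenter, facet, Finset.sum_image fun _ _ _ _ h => T.independent.injective h,
      Finset.smul_sum, ← Finset.add_sum_erase _ _ (Finset.mem_univ i), if_pos rfl, zero_smul,
      zero_add]
    refine Finset.sum_congr rfl fun l hl => ?_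
    rw [if_neg (Finset.ne_of_mem_erase hl)]
  have hw : ∑ l : Fin (d + 1), (if l = i then 0 else (d : ℝ)⁻¹) = 1 := by
    rw [← Finset.add_sum_erase _ _ (Finset.mem_univ i), if_pos rfl, zero_add,
      Finset.sum_congr rfl fun l hl => if_neg (Finset.ne_of_mem_erase hl), Finset.sum_const,
      Finset.card_erase_of_mem (Finset.mem_univ i), Finset.card_univ, Fintype.card_fin]
    simp [hd']
  rw [h1, T.coord_sum j hw, Finset.sum_eq_single j]
  · simp
  · intro l _ hl
    rw [T.coord_points_of_ne hl.symm, mul_zero]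
  · simp

lemma facetCenter_mem (hd : 1 ≤ d) (i : Fin (d + 1)) :
    facetCenter (T.facet i) ∈ facetHull (T.facet i) := by
  rw [mem_facetHull]
  simp only [T.coord_facetCenter hd, if_true, and_true]
  intro j
  split_ifs <;> positivity

/-- Both coordinates are affine and vanish at the vertices of the common facet, so they are
proportional. The sign of the factor tells whether the cells lie on the same side of the facet
(positive) or on opposite sides. -/
lemma exists_coord_eq_mul {S T : Cell d} {i i' : Fin (d + 1)} (h : T.facet i = S.facet i') :
    S.basis.coord i' (T.points i) ≠ 0 ∧
      ∀ x, S.basis.coord i' x = S.basis.coord i' (T.points i) * T.basis.coord i x := by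
  have key : ∀ x, S.basis.coord i' x = S.basis.coord i' (T.points i) * T.basis.coord i x := by
    intro x
    conv_lhs => rw [← T.sum_coord_smul x]
    rw [S.coord_sum i' (T.basis.sum_coord_apply_eq_one x), Finset.sum_eq_single i, mul_comm]
    · intro j _ hj
      have : T.points j ∈ S.facet i' := h ▸ T.mem_facet.2 ⟨j, hj, rfl⟩
      obtain ⟨l, hl, hl'⟩ := S.mem_facet.1 this
      rw [← hl', S.coord_points_of_ne hl.symm, mul_zero]
    · simp
  refine ⟨fun h0 => ?_, key⟩
  have := key (S.points i')
  rw [h0, zero_mul, S.coord_points_self] at this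
  exact one_ne_zero this

/-- Proportional coordinates have proportional gradients. The sign may stay open, since the
tangential projection is even in the normal. -/
lemma normal_eq_or_eq_neg {S T : Cell d} {i i' : Fin (d + 1)} (h : T.facet i = S.facet i') :
    (∀ j, S.normal i' j = T.normal i j) ∨ ∀ j, S.normal i' j = -T.normal i j := by
  obtain ⟨hc, key⟩ := exists_coord_eq_mul h
  set c := S.basis.coord i' (T.points i)
  have hg : ∀ j, S.baryGrad i' j = c * T.baryGrad i j := by
    intro j
    rw [baryGrad_eq, baryGrad_eq, key, key 0]
    ring
  have hn : ‖S.gradVec i'‖ = |c| * ‖T.gradVec i‖ := by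
    have : S.gradVec i' = c • T.gradVec i := by
      ext j
      simpa [gradVec] using hg j
    rw [this, norm_smul, Real.norm_eq_abs]
  simp only [normal_eq, hn, hg]
  rcases lt_or_gt_of_ne hc with h0 | h0
  · right
    intro j
    rw [abs_of_neg h0]
    field_simp
  · left
    intro j
    rw [abs_of_pos h0]
    field_simp

lemma volume_hull_inter_coord_eq_zero (j : Fin (d + 1)) :
    volume (T.hull ∩ {x | T.basis.coord j x = 0}) = 0 := by
  refine measure_mono_null ?_ (T.convex_hull.addHaar_frontier volume)
  rintro x ⟨hx, hx0⟩
  rw [T.isCompact_hull.isClosed.frontier_eq]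
  refine ⟨hx, fun hi => ?_⟩
  have h := T.basis.interior_convexHull
  change interior T.hull = _ at h
  rw [h] at hi
  exact (hi j).ne' hx0

end Cell

/-! ### Consequences of conformity: hat functions, patches, null overlaps -/

namespace Triangulation

variable {d : ℕ} {Ω : Set (Euc d)} (𝒯 : Triangulation Ω)

lemma mem_patch {V : Euc d} {T : 𝒯.ι} : T ∈ 𝒯.patch V ↔ V ∈ Set.range (𝒯.cell T).points := by
  simp [patch]

lemma mem_closure {x : Euc d} : x ∈ closure Ω ↔ ∃ T, x ∈ (𝒯.cell T).hull := by
  rw [← 𝒯.cover, Set.mem_iUnion]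

lemma mem_region {S : Finset 𝒯.ι} {x : Euc d} :
    x ∈ 𝒯.region S ↔ ∃ T ∈ S, x ∈ (𝒯.cell T).hull := by
  simp [region]

/-- At a point of two cells, only the coordinates that belong to common vertices are nonzero. -/
lemma coord_eq_zero {S T : 𝒯.ι} {x : Euc d} (hS : x ∈ (𝒯.cell S).hull) (hT : x ∈ (𝒯.cell T).hull)
    {j : Fin (d + 1)} (hj : (𝒯.cell T).points j ∉ Set.range (𝒯.cell S).points) :
    (𝒯.cell T).basis.coord j x = 0 := by
  have h := 𝒯.conforming S T ⟨hS, hT⟩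
  have hr : Set.range (𝒯.cell S).points ∩ Set.range (𝒯.cell T).points =
      (𝒯.cell T).points '' {j | (𝒯.cell T).points j ∈ Set.range (𝒯.cell S).points} := by
    ext y
    constructor
    · rintro ⟨h1, j, rfl⟩; exact ⟨j, h1, rfl⟩
    · rintro ⟨j, h1, rfl⟩; exact ⟨h1, j, rfl⟩
  rw [hr, Cell.mem_convexHull_image] at h
  exact h.2 j hj

lemma mem_range_of_coord_pos {S T : 𝒯.ι} {x : Euc d} (hS : x ∈ (𝒯.cell S).hull)
    (hT : x ∈ (𝒯.cell T).hull) {j : Fin (d + 1)} (hj : 0 < (𝒯.cell T).basis.coord j x) :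
    (𝒯.cell T).points j ∈ Set.range (𝒯.cell S).points := by
  by_contra h
  exact hj.ne' (𝒯.coord_eq_zero hS hT h)

/-- Expand `x` in the vertices of `T`: only common vertices carry weight, and among those only the
shared vertex in question has a nonzero `i`-th coordinate in `S`. -/
lemma coord_eq_coord {S T : 𝒯.ι} {x : Euc d} (hS : x ∈ (𝒯.cell S).hull)
    (hT : x ∈ (𝒯.cell T).hull) {i j : Fin (d + 1)}
    (hij : (𝒯.cell S).points i = (𝒯.cell T).points j) :
    (𝒯.cell S).basis.coord i x = (𝒯.cell T).basis.coord j x := by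
  conv_lhs => rw [← (𝒯.cell T).sum_coord_smul x]
  rw [Cell.coord_sum _ i ((𝒯.cell T).basis.sum_coord_apply_eq_one x), Finset.sum_eq_single j]
  · rw [← hij, Cell.coord_points_self, mul_one]
  · intro l _ hl
    by_cases hlS : (𝒯.cell T).points l ∈ Set.range (𝒯.cell S).points
    · obtain ⟨m, hm⟩ := hlS
      have : i ≠ m := by
        rintro rfl
        exact hl ((𝒯.cell T).independent.injective (hm.symm.trans hij))
      rw [← hm, Cell.coord_points_of_ne _ this, mul_zero]
    · rw [𝒯.coord_eq_zero hS hT hlS, zero_mul]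
  · simp

/-- The hat functions are continuous across the cells. -/
lemma ev_hat_eq {S T : 𝒯.ι} {x : Euc d} (hS : x ∈ (𝒯.cell S).hull)
    (hT : x ∈ (𝒯.cell T).hull) (V : Euc d) :
    ((𝒯.cell S).hat V).ev x = ((𝒯.cell T).hat V).ev x := by
  by_cases h1 : V ∈ Set.range (𝒯.cell S).points
  · obtain ⟨i, rfl⟩ := h1
    rw [Cell.ev_hat_points]
    by_cases h2 : (𝒯.cell S).points i ∈ Set.range (𝒯.cell T).points
    · obtain ⟨j, hj⟩ := h2
      rw [← hj, Cell.ev_hat_points, 𝒯.coord_eq_coord hS hT hj.symm]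
    · rw [Cell.hat_eq_zero _ h2, MPoly.ev_zero, 𝒯.coord_eq_zero hT hS h2]
  · rw [Cell.hat_eq_zero _ h1, MPoly.ev_zero]
    by_cases h2 : V ∈ Set.range (𝒯.cell T).points
    · obtain ⟨j, rfl⟩ := h2
      rw [Cell.ev_hat_points, 𝒯.coord_eq_zero hS hT h1]
    · rw [Cell.hat_eq_zero _ h2, MPoly.ev_zero]

/-- There are finitely many cells and they are closed, so those that miss `x` also miss a
neighbourhood of `x`. -/
lemma eventually_mem_hull_imp (x : Euc d) :
    ∀ᶠ y in 𝓝 x, ∀ S, y ∈ (𝒯.cell S).hull → x ∈ (𝒯.cell S).hull := by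
  rw [Filter.eventually_all]
  intro S
  by_cases h : x ∈ (𝒯.cell S).hull
  · exact Filter.Eventually.of_forall fun _ _ => h
  · filter_upwards [(𝒯.cell S).isCompact_hull.isClosed.isOpen_compl.mem_nhds h] with y hy hy'
    exact absurd hy' hy

/-- The open star of an interior vertex is contained in the domain. -/
lemma mem_of_coord_pos (hΩo : IsOpen Ω) (hΩr : interior (closure Ω) = Ω) {T : 𝒯.ι}
    {l : Fin (d + 1)} (hV : (𝒯.cell T).points l ∈ Ω) {x : Euc d} (hx : x ∈ (𝒯.cell T).hull)
    (hl : 0 < (𝒯.cell T).basis.coord l x) : x ∈ Ω := by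
  set V := (𝒯.cell T).points l with hVdef
  have hcont : Continuous fun t : ℝ => V + t • (x - V) := by fun_prop
  -- Contract towards `V` by a factor `t` so small that the image `y` of `x` lies in `Ω`. For `z`
  -- near `x` the contracted point lies in some cell `S`; this cell contains `y` and therefore has
  -- `V` as a vertex. Undoing the contraction shows `z ∈ S`, so `x` is interior to the closure of
  -- `Ω`, which is `Ω`.
  have hev : ∀ᶠ t in 𝓝[>] (0 : ℝ), V + t • (x - V) ∈ Ω :=
    (hcont.tendsto' 0 V (by simp)).eventually (hΩo.mem_nhds hV) |>.filter_mono nhdsWithin_le_nhds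
  obtain ⟨t, htΩ, ht0, ht1⟩ := (hev.and (Ioc_mem_nhdsGT zero_lt_one)).exists
  set y := V + t • (x - V) with hy
  have hyT : y ∈ (𝒯.cell T).hull := by
    have hVT : V ∈ (𝒯.cell T).hull := subset_convexHull ℝ _ ⟨l, rfl⟩
    rw [Cell.mem_hull] at hVT hx ⊢
    intro j
    rw [hy, Cell.coord_lineMap]
    nlinarith [hVT j, hx j, mul_nonneg ht0.le (hx j), mul_nonneg (sub_nonneg.2 ht1) (hVT j)]
  have hyl : 0 < (𝒯.cell T).basis.coord l y := by
    rw [hy, Cell.coord_lineMap, hVdef, Cell.coord_points_self]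
    nlinarith
  have hφ : Continuous fun z : Euc d => V + t • (z - V) := by fun_prop
  have e1 : ∀ᶠ z in 𝓝 x, V + t • (z - V) ∈ Ω :=
    (hφ.tendsto' x y rfl).eventually (hΩo.mem_nhds htΩ)
  have e2 : ∀ᶠ z in 𝓝 x, ∀ S, V + t • (z - V) ∈ (𝒯.cell S).hull → y ∈ (𝒯.cell S).hull :=
    (hφ.tendsto' x y rfl).eventually (𝒯.eventually_mem_hull_imp y)
  -- The coordinates of `S` and `T` that belong to `V` agree at `y` and at `V`, hence at the
  -- collinear point `x`, where the one of `T` is positive.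
  have e3 : ∀ᶠ z in 𝓝 x, ∀ S i, (𝒯.cell S).points i = V → y ∈ (𝒯.cell S).hull →
      0 < (𝒯.cell S).basis.coord i z := by
    rw [Filter.eventually_all]
    intro S
    rw [Filter.eventually_all]
    intro i
    by_cases h : (𝒯.cell S).points i = V ∧ y ∈ (𝒯.cell S).hull
    · have h1 : 0 < (𝒯.cell S).basis.coord i x := by
        have h2 := 𝒯.coord_eq_coord h.2 hyT h.1
        have h3 : (𝒯.cell S).basis.coord i V = 1 := by rw [← h.1, Cell.coord_points_self]
        have h4 : (𝒯.cell T).basis.coord l V = 1 := by rw [hVdef, Cell.coord_points_self]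
        rw [hy, Cell.coord_lineMap, Cell.coord_lineMap, h3, h4] at h2
        have h5 : (𝒯.cell S).basis.coord i x = (𝒯.cell T).basis.coord l x := by
          have := mul_left_cancel₀ ht0.ne' (add_left_cancel h2)
          linarith
        rw [h5]
        exact hl
      filter_upwards [((𝒯.cell S).continuous_coord i).continuousAt.eventually
        (lt_mem_nhds h1)] with z hz _ _ using hz
    · exact Filter.Eventually.of_forall fun z h1 h2 => absurd ⟨h1, h2⟩ h
  rw [← hΩr, mem_interior_iff_mem_nhds]
  filter_upwards [e1, e2, e3] with z h1 h2 h3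
  obtain ⟨S, hS⟩ := 𝒯.mem_closure.1 (subset_closure h1)
  have hyS := h2 S hS
  obtain ⟨i, hi⟩ := 𝒯.mem_range_of_coord_pos hyS hyT hyl
  refine 𝒯.mem_closure.2 ⟨S, ((𝒯.cell S).mem_hull z).2 fun j => ?_⟩
  by_cases hj : j = i
  · subst hj
    exact (h3 S j hi hyS).le
  -- Coordinates of the other vertices vanish at `V`; the contraction multiplies them by `t > 0` and
  -- keeps their sign.
  · have h4 := ((𝒯.cell S).mem_hull _).1 hS j
    have h5 : (𝒯.cell S).basis.coord j V = 0 := by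
      rw [hVdef, ← hi, Cell.coord_points_of_ne _ hj]
    rw [Cell.coord_lineMap, h5] at h4
    simp only [sub_zero, zero_add] at h4
    exact nonneg_of_mul_nonneg_right h4 ht0

/-- A facet of the patch of `V` that contains `V` and lies on the boundary of the patch lies on the
boundary of the domain. -/
lemma facetHull_subset_frontier (hd : 1 ≤ d) (hΩo : IsOpen Ω) {V : Euc d} {T : 𝒯.ι}
    {i l : Fin (d + 1)} (hl : (𝒯.cell T).points l = V) (hil : l ≠ i)
    (hF : facetHull ((𝒯.cell T).facet i) ⊆ frontier (𝒯.region (𝒯.patch V))) :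
    facetHull ((𝒯.cell T).facet i) ⊆ frontier Ω := by
  intro x hxF
  by_contra hx
  have hxΩ : x ∈ Ω := by
    have h1 : x ∈ closure Ω := 𝒯.mem_closure.2 ⟨T, Cell.facetHull_facet_subset _ i hxF⟩
    rw [hΩo.frontier_eq] at hx
    by_contra h
    exact hx ⟨h1, h⟩
  -- If the facet had a point `x` in `Ω`, a small move towards the barycentre would give `y` in `Ω`
  -- and in the relative interior of the facet. The coordinate of `V` is positive at `y`, so all
  -- cells near `y` have `V` as a vertex and `y` is interior to the patch.
  set c := facetCenter ((𝒯.cell T).facet i) with hc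
  have hcont : Continuous fun t : ℝ => x + t • (c - x) := by fun_prop
  have hev : ∀ᶠ t in 𝓝[>] (0 : ℝ), x + t • (c - x) ∈ Ω :=
    (hcont.tendsto' 0 x (by simp)).eventually (hΩo.mem_nhds hxΩ) |>.filter_mono nhdsWithin_le_nhds
  obtain ⟨t, htΩ, ht0, ht1⟩ := (hev.and (Ioc_mem_nhdsGT zero_lt_one)).exists
  set y := x + t • (c - x) with hy
  rw [Cell.mem_facetHull] at hxF
  have hpos : ∀ j ≠ i, 0 < (𝒯.cell T).basis.coord j y := by
    intro j hj
    rw [hy, Cell.coord_lineMap, hc, Cell.coord_facetCenter _ hd, if_neg hj]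
    have : (0 : ℝ) < (d : ℝ)⁻¹ := by positivity
    nlinarith [hxF.1 j, mul_nonneg (sub_nonneg.2 ht1) (hxF.1 j), mul_pos ht0 this]
  have hyF : y ∈ facetHull ((𝒯.cell T).facet i) := by
    rw [Cell.mem_facetHull]
    have hi : (𝒯.cell T).basis.coord i y = 0 := by
      rw [hy, Cell.coord_lineMap, hc, Cell.coord_facetCenter _ hd, if_pos rfl, hxF.2]
      ring
    refine ⟨fun j => ?_, hi⟩
    by_cases hj : j = i
    · rw [hj, hi]
    · exact (hpos j hj).le
  refine (hF hyF).2 ?_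
  rw [mem_interior_iff_mem_nhds]
  filter_upwards [hΩo.mem_nhds htΩ, 𝒯.eventually_mem_hull_imp y] with z hz hzS
  obtain ⟨S, hS⟩ := 𝒯.mem_closure.1 (subset_closure hz)
  have h1 := 𝒯.mem_range_of_coord_pos (hzS S hS) (Cell.facetHull_facet_subset _ i hyF)
    (hpos l hil)
  rw [hl] at h1
  exact 𝒯.mem_region.2 ⟨S, 𝒯.mem_patch.2 h1, hS⟩

/-- Facets on the boundary of the patch belong to one cell of the patch only. -/
lemma eq_of_facet_eq (hd : 1 ≤ d) {V : Euc d} {S T : 𝒯.ι} (hS : S ∈ 𝒯.patch V)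
    (hT : T ∈ 𝒯.patch V) {i i' : Fin (d + 1)} (h : (𝒯.cell T).facet i = (𝒯.cell S).facet i')
    (hF : facetHull ((𝒯.cell T).facet i) ⊆ frontier (𝒯.region (𝒯.patch V))) : S = T := by
  by_contra hne
  obtain ⟨hc, key⟩ := Cell.exists_coord_eq_mul h
  set c := (𝒯.cell S).basis.coord i' ((𝒯.cell T).points i) with hcdef
  set y := facetCenter ((𝒯.cell T).facet i) with hy
  have hd' : (0 : ℝ) < (d : ℝ)⁻¹ := by positivity
  have hyT : ∀ j ≠ i, 0 < (𝒯.cell T).basis.coord j y := by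
    intro j hj
    rw [hy, Cell.coord_facetCenter _ hd, if_neg hj]
    exact hd'
  have hyS : ∀ j ≠ i', 0 < (𝒯.cell S).basis.coord j y := by
    intro j hj
    rw [hy, h, Cell.coord_facetCenter _ hd, if_neg hj]
    exact hd'
  have hyi : (𝒯.cell T).basis.coord i y = 0 := by
    rw [hy, Cell.coord_facetCenter _ hd, if_pos rfl]
  have evT : ∀ᶠ z in 𝓝 y, ∀ j, j ≠ i → 0 < (𝒯.cell T).basis.coord j z := by
    rw [Filter.eventually_all]
    intro j
    by_cases hj : j = i
    · exact Filter.Eventually.of_forall fun _ h => absurd hj h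
    · filter_upwards [((𝒯.cell T).continuous_coord j).continuousAt.eventually
        (lt_mem_nhds (hyT j hj))] with z hz _ using hz
  have evS : ∀ᶠ z in 𝓝 y, ∀ j, j ≠ i' → 0 < (𝒯.cell S).basis.coord j z := by
    rw [Filter.eventually_all]
    intro j
    by_cases hj : j = i'
    · exact Filter.Eventually.of_forall fun _ h => absurd hj h
    · filter_upwards [((𝒯.cell S).continuous_coord j).continuousAt.eventually
        (lt_mem_nhds (hyS j hj))] with z hz _ using hz
  -- If `c < 0`, the cells lie on opposite sides and together cover a neighbourhood of the
  -- barycentre of the facet, which then is not on the boundary of the patch. If `c > 0`, they lie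
  -- on the same side and share a point where all coordinates are positive; conformity makes their
  -- vertices equal.
  rcases lt_or_gt_of_ne hc with hneg | hpos
  · have hyF := (𝒯.cell T).facetCenter_mem hd i
    refine (hF hyF).2 ?_
    rw [mem_interior_iff_mem_nhds]
    filter_upwards [evT, evS] with z hzT hzS
    by_cases hz : 0 ≤ (𝒯.cell T).basis.coord i z
    · refine 𝒯.mem_region.2 ⟨T, hT, (Cell.mem_hull _ _).2 fun j => ?_⟩
      by_cases hj : j = i
      · rw [hj]; exact hz
      · exact (hzT j hj).le
    · refine 𝒯.mem_region.2 ⟨S, hS, (Cell.mem_hull _ _).2 fun j => ?_⟩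
      by_cases hj : j = i'
      · rw [hj, key]
        exact mul_nonneg_of_nonpos_of_nonpos hneg.le (not_le.1 hz).le
      · exact (hzS j hj).le
  · have hcont : Continuous fun t : ℝ => y + t • ((𝒯.cell T).points i - y) := by fun_prop
    have hev := ((hcont.tendsto' 0 y (by simp)).eventually (evT.and evS)).filter_mono
      (nhdsWithin_le_nhds (s := Set.Ioi 0))
    obtain ⟨t, ⟨hzT, hzS⟩, ht0⟩ := (hev.and self_mem_nhdsWithin).exists
    set z := y + t • ((𝒯.cell T).points i - y) with hz
    have hzi : 0 < (𝒯.cell T).basis.coord i z := by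
      rw [hz, Cell.coord_lineMap, hyi, Cell.coord_points_self]
      have : 0 < t := ht0
      linarith
    have hzT' : z ∈ (𝒯.cell T).hull := by
      refine (Cell.mem_hull _ _).2 fun j => ?_
      by_cases hj : j = i
      · rw [hj]; exact hzi.le
      · exact (hzT j hj).le
    have hzS' : z ∈ (𝒯.cell S).hull := by
      refine (Cell.mem_hull _ _).2 fun j => ?_
      by_cases hj : j = i'
      · rw [hj, key]; exact (mul_pos hpos hzi).le
      · exact (hzS j hj).le
    refine hne (𝒯.range_inj S T (Cell.range_subset_of_range_subset ?_))
    rintro _ ⟨j, rfl⟩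
    refine 𝒯.mem_range_of_coord_pos hzS' hzT' ?_
    by_cases hj : j = i
    · rw [hj]; exact hzi
    · exact hzT j hj

/-- Some vertex of `T` is missing in `S`. By conformity its coordinate vanishes on the overlap,
which therefore lies in the frontier of a convex set. -/
lemma volume_hull_inter_hull {S T : 𝒯.ι} (hST : S ≠ T) :
    volume ((𝒯.cell S).hull ∩ (𝒯.cell T).hull) = 0 := by
  obtain ⟨j, hj⟩ : ∃ j, (𝒯.cell T).points j ∉ Set.range (𝒯.cell S).points := by
    by_contra! h
    refine hST (𝒯.range_inj S T (Cell.range_subset_of_range_subset ?_))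
    rintro _ ⟨j, rfl⟩
    exact h j
  refine measure_mono_null ?_ ((𝒯.cell T).volume_hull_inter_coord_eq_zero j)
  rintro x ⟨hxS, hxT⟩
  exact ⟨hxT, 𝒯.coord_eq_zero hxS hxT hj⟩

lemma setIntegral_region (S : Finset 𝒯.ι) {g : Euc d → ℝ}
    (hg : ∀ T ∈ S, IntegrableOn g (𝒯.cell T).hull) :
    ∫ x in 𝒯.region S, g x = ∑ T ∈ S, ∫ x in (𝒯.cell T).hull, g x := by
  classical
  induction S using Finset.induction_on with
  | empty => simp [region]
  | insert T S hT ih =>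
    have hr : 𝒯.region (insert T S) = 𝒯.region S ∪ (𝒯.cell T).hull := by
      rw [region, Finset.set_biUnion_insert, Set.union_comm, region]
    have hdisj : AEDisjoint volume (𝒯.region S) (𝒯.cell T).hull := by
      have : 𝒯.region S ∩ (𝒯.cell T).hull =
          ⋃ R ∈ S, (𝒯.cell R).hull ∩ (𝒯.cell T).hull := by
        simp [region, Set.iUnion_inter]
      rw [AEDisjoint, this]
      refine (measure_biUnion_null_iff S.countable_toSet).2 fun R hR => ?_
      exact 𝒯.volume_hull_inter_hull (by rintro rfl; exact hT hR)
    rw [hr, setIntegral_union₀ hdisj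
      (𝒯.cell T).isCompact_hull.isClosed.measurableSet.nullMeasurableSet, Finset.sum_insert hT,
      ih fun R hR => hg R (Finset.mem_insert_of_mem hR), add_comm]
    · refine (integrableOn_finset_iUnion (s := S)).2 fun R hR => ?_
      exact hg R (Finset.mem_insert_of_mem hR)
    · exact hg T (Finset.mem_insert_self T S)

lemma region_univ : 𝒯.region Finset.univ = closure Ω := by
  rw [← 𝒯.cover, region]
  simp

lemma region_subset (S : Finset 𝒯.ι) : 𝒯.region S ⊆ closure Ω := fun _ hx =>
  let ⟨T, _, h⟩ := 𝒯.mem_region.1 hx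
  𝒯.mem_closure.2 ⟨T, h⟩

/-- An interior point of a cell is interior to the closure of `Ω`, hence belongs to `Ω`. What the
closure adds lies on the frontiers of finitely many convex cells. -/
theorem ae_eq_closure {d : ℕ} {Ω : Set (Euc d)} (𝒯 : Triangulation Ω)
    (hΩr : interior (closure Ω) = Ω) : Ω =ᵐ[volume] closure Ω := by
  have hsub : closure Ω \ Ω ⊆ ⋃ T, frontier (𝒯.cell T).hull := by
    rintro x ⟨hx, hxΩ⟩
    obtain ⟨T, hT⟩ := 𝒯.mem_closure.1 hx
    refine Set.mem_iUnion.2 ⟨T, ?_⟩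
    rw [(𝒯.cell T).isCompact_hull.isClosed.frontier_eq]
    refine ⟨hT, fun hi => hxΩ ?_⟩
    rw [← hΩr]
    exact interior_mono (fun y hy => 𝒯.mem_closure.2 ⟨T, hy⟩) hi
  have h0 : volume (closure Ω \ Ω) = 0 :=
    measure_mono_null hsub (measure_iUnion_null fun T =>
      (𝒯.cell T).convex_hull.addHaar_frontier volume)
  exact (subset_closure.eventuallyLE).antisymm (ae_le_set.2 h0)

end Triangulation

/-! ### Traces on facets and tangential projection -/

namespace Cell

variable {d : ℕ} (T : Cell d)

@[fun_prop] lemma continuous_trN (i : Fin (d + 1)) (v : Fin d → MPoly d) :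
    Continuous (T.trN i v) := by
  unfold trN
  exact continuous_finsetSum _ fun a _ => by fun_prop

@[fun_prop] lemma continuous_traction (i : Fin (d + 1)) (τ : Matrix (Fin d) (Fin d) (MPoly d))
    (a : Fin d) : Continuous fun x => T.traction i τ x a := by
  unfold traction
  exact continuous_finsetSum _ fun a _ => by fun_prop

@[fun_prop] lemma continuous_trNN (i : Fin (d + 1)) (τ : Matrix (Fin d) (Fin d) (MPoly d)) :
    Continuous (T.trNN i τ) := by
  unfold trNN
  exact continuous_finsetSum _ fun a _ => by fun_prop

@[fun_prop] lemma continuous_trNT (i : Fin (d + 1)) (τ : Matrix (Fin d) (Fin d) (MPoly d))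
    (a : Fin d) : Continuous fun x => T.trNT i τ x a := by
  unfold trNT
  fun_prop

@[simp] lemma trN_sub (i : Fin (d + 1)) (v w : Fin d → MPoly d) (x : Euc d) :
    T.trN i (v - w) x = T.trN i v x - T.trN i w x := by
  simp [trN, sub_mul]

@[simp] lemma trN_zero (i : Fin (d + 1)) (x : Euc d) : T.trN i 0 x = 0 := by
  simp [trN]

lemma facetIntegral_sub (hd : 1 ≤ d) (i : Fin (d + 1)) {g h : Euc d → ℝ} (hg : Continuous g)
    (hh : Continuous h) : facetIntegral (T.facet i) (fun x => g x - h x) =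
      facetIntegral (T.facet i) g - facetIntegral (T.facet i) h :=
  integral_sub (T.integrableOn_facet hd i hg) (T.integrableOn_facet hd i hh)

lemma facetIntegral_add (hd : 1 ≤ d) (i : Fin (d + 1)) {g h : Euc d → ℝ} (hg : Continuous g)
    (hh : Continuous h) : facetIntegral (T.facet i) (fun x => g x + h x) =
      facetIntegral (T.facet i) g + facetIntegral (T.facet i) h :=
  integral_add (T.integrableOn_facet hd i hg) (T.integrableOn_facet hd i hh)

/-- A nonnegative continuous function with vanishing integral over a facet vanishes there. -/
lemma eq_zero_of_facetIntegral_eq_zero (hd : 1 ≤ d) (i : Fin (d + 1)) {g : Euc d → ℝ}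
    (hg : Continuous g) (h0 : ∀ x, 0 ≤ g x) (hint : facetIntegral (T.facet i) g = 0) :
    ∀ x ∈ facetHull (T.facet i), g x = 0 := by
  intro x hx
  by_contra hgx
  have hpos : 0 < g x := lt_of_le_of_ne (h0 x) (Ne.symm hgx)
  have hnt : Nontrivial (Fin (d + 1)) := Fin.nontrivial_iff_two_le.2 (by omega)
  obtain ⟨m, hm⟩ := exists_ne i
  have hae := (setIntegral_eq_zero_iff_of_nonneg_ae (Filter.Eventually.of_forall h0)
    (T.integrableOn_facet hd i hg)).1 hint
  have hnull : μHE[d - 1] (facetHull (T.facet i) ∩ {z | g z ≠ 0}) = 0 := by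
    have h1 : (μHE[d - 1]).restrict (facetHull (T.facet i)) {z | g z ≠ 0} = 0 := hae
    rwa [Measure.restrict_apply (isOpen_ne_fun hg continuous_const).measurableSet,
      Set.inter_comm] at h1
  have hvol : volume ((fun w : (ℝ ∙ T.gradVec i)ᗮ => T.points m + (w : Euc d)) ⁻¹'
      (facetHull (T.facet i) ∩ {z | g z ≠ 0})) = 0 := by
    have h1 := volume_preimage_add_orthogonal (T.gradVec_ne_zero hd i) (T.points m)
      (facetHull (T.facet i) ∩ {z | g z ≠ 0})
    rw [finrank_euclideanSpace_fin] at h1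
    rw [h1]
    exact measure_mono_null Set.inter_subset_left hnull
  -- The point `x` may lie on the relative boundary of the facet. A small move towards the
  -- barycentre keeps `g` positive and reaches the relative interior, where the facet contains a
  -- nonempty open piece of its hyperplane; such a piece is not null.
  have hcont : Continuous fun t : ℝ => x + t • (facetCenter (T.facet i) - x) := by fun_prop
  have hev : ∀ᶠ t in 𝓝[>] (0 : ℝ), 0 < g (x + t • (facetCenter (T.facet i) - x)) :=
    ((hg.comp hcont).tendsto' 0 (g x) (by simp)).eventually (lt_mem_nhds hpos) |>.filter_mono
      nhdsWithin_le_nhds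
  obtain ⟨t, ht, ht0, ht1⟩ := (hev.and (Ioc_mem_nhdsGT zero_lt_one)).exists
  set y := x + t • (facetCenter (T.facet i) - x) with hy
  rw [mem_facetHull] at hx
  have hyi : T.basis.coord i y = 0 := by
    rw [hy, coord_lineMap, coord_facetCenter _ hd, if_pos rfl, hx.2]
    ring
  have hyj : ∀ j ≠ i, 0 < T.basis.coord j y := by
    intro j hj
    rw [hy, coord_lineMap, coord_facetCenter _ hd, if_neg hj]
    have : (0 : ℝ) < (d : ℝ)⁻¹ := by positivity
    nlinarith [hx.1 j, mul_nonneg (sub_nonneg.2 ht1) (hx.1 j), mul_pos ht0 this]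
  set U : Set (Euc d) := {z | 0 < g z} ∩ ⋂ j, {z | j ≠ i → 0 < T.basis.coord j z} with hU
  have hUo : IsOpen U := by
    refine (isOpen_lt continuous_const hg).inter (isOpen_iInter_of_finite fun j => ?_)
    by_cases hj : j = i
    · simp [hj]
    · simpa [hj] using isOpen_lt continuous_const (T.continuous_coord j)
  have hφ : Continuous fun w : (ℝ ∙ T.gradVec i)ᗮ => T.points m + (w : Euc d) := by fun_prop
  have hyW : y - T.points m ∈ (ℝ ∙ T.gradVec i)ᗮ := by
    rw [Submodule.mem_orthogonal_singleton_iff_inner_right, inner_gradVec_sub, hyi,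
      T.coord_points_of_ne hm.symm, sub_zero]
  have hne : ((fun w : (ℝ ∙ T.gradVec i)ᗮ => T.points m + (w : Euc d)) ⁻¹' U).Nonempty := by
    refine ⟨⟨_, hyW⟩, ?_⟩
    simp only [hU, Set.mem_preimage, add_sub_cancel, Set.mem_inter_iff, Set.mem_iInter]
    exact ⟨ht, hyj⟩
  refine ((hUo.preimage hφ).measure_pos volume hne).ne' (measure_mono_null ?_ hvol)
  rintro w ⟨hw1, hw2⟩
  simp only [Set.mem_iInter] at hw2
  have hwi : T.basis.coord i (T.points m + (w : Euc d)) = 0 := by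
    have h := T.inner_gradVec_sub i (T.points m + (w : Euc d)) (T.points m)
    rw [add_sub_cancel_left, Submodule.mem_orthogonal_singleton_iff_inner_right.1 w.2,
      T.coord_points_of_ne hm.symm] at h
    linarith
  refine ⟨(T.mem_facetHull i _).2 ⟨fun j => ?_, hwi⟩, ne_of_gt hw1⟩
  by_cases hj : j = i
  · rw [hj, hwi]
  · exact (hw2 j hj).le

/-- The tangential part of a constant vector on a facet of a cell. -/
def tangent (i : Fin (d + 1)) (c : Fin d → ℝ) (a : Fin d) : ℝ :=
  c a - (∑ b, c b * T.normal i b) * T.normal i a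

lemma sum_tangent_mul_normal (hd : 1 ≤ d) (i : Fin (d + 1)) (c : Fin d → ℝ) :
    ∑ a, T.tangent i c a * T.normal i a = 0 := by
  simp only [tangent, sub_mul, Finset.sum_sub_distrib, mul_assoc]
  rw [← Finset.mul_sum, T.sum_normal_mul_self hd, mul_one, sub_self]

lemma tangent_eq_tangent {S T : Cell d} {i i' : Fin (d + 1)} (h : T.facet i = S.facet i') :
    T.tangent i = S.tangent i' := by
  funext c a
  rcases normal_eq_or_eq_neg h with h | h <;> simp [tangent, h]

lemma sum_trNT_mul_normal (hd : 1 ≤ d) (i : Fin (d + 1)) (τ : Matrix (Fin d) (Fin d) (MPoly d))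
    (x : Euc d) : ∑ a, T.trNT i τ x a * T.normal i a = 0 := by
  simp only [trNT, sub_mul, Finset.sum_sub_distrib, mul_assoc]
  rw [← Finset.mul_sum, T.sum_normal_mul_self hd, mul_one, trNN, sub_self]

/-- The traction tested with a constant vector splits into normal and tangential parts. -/
lemma trNN_mul_add_trNT_mul (hd : 1 ≤ d) (i : Fin (d + 1))
    (τ : Matrix (Fin d) (Fin d) (MPoly d)) (x : Euc d) (c : Fin d → ℝ) :
    T.trNN i τ x * (∑ a, c a * T.normal i a) + ∑ a, T.trNT i τ x a * T.tangent i c a =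
      ∑ a, T.traction i τ x a * c a := by
  have h : ∑ a, T.trNT i τ x a * T.tangent i c a = ∑ a, T.trNT i τ x a * c a := by
    simp only [tangent, mul_sub, Finset.sum_sub_distrib]
    rw [sub_eq_self]
    calc ∑ a, T.trNT i τ x a * ((∑ b, c b * T.normal i b) * T.normal i a)
        = (∑ b, c b * T.normal i b) * ∑ a, T.trNT i τ x a * T.normal i a := by
          rw [Finset.mul_sum]
          exact Finset.sum_congr rfl fun a _ => by ring
      _ = 0 := by rw [T.sum_trNT_mul_normal hd, mul_zero]
  rw [h, Finset.mul_sum, ← Finset.sum_add_distrib]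
  refine Finset.sum_congr rfl fun a _ => ?_
  rw [trNT]
  ring

end Cell

/-! ### The distributional divergence on a patch -/

namespace Triangulation

variable {d : ℕ} {Ω : Set (Euc d)} (𝒯 : Triangulation Ω)

lemma cellIntegral_sub (T : 𝒯.ι) {g h : Euc d → ℝ} (hg : IntegrableOn g (𝒯.cell T).hull)
    (hh : IntegrableOn h (𝒯.cell T).hull) :
    𝒯.cellIntegral T (fun x => g x - h x) = 𝒯.cellIntegral T g - 𝒯.cellIntegral T h :=
  integral_sub hg hh

lemma mem_patchFacets {V : Euc d} {F : Finset (Euc d)} : F ∈ 𝒯.patchFacets V ↔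
    (∃ T ∈ 𝒯.patch V, ∃ i, (𝒯.cell T).facet i = F) ∧
      (V ∈ frontier Ω → ¬ facetHull F ⊆ frontier Ω) := by
  simp [patchFacets]

lemma facet_mem_patchFacets (hΩo : IsOpen Ω) {V : Euc d} (hV : V ∈ Ω) {T : 𝒯.ι}
    (hT : T ∈ 𝒯.patch V) (i : Fin (d + 1)) : (𝒯.cell T).facet i ∈ 𝒯.patchFacets V := by
  rw [mem_patchFacets]
  refine ⟨⟨T, hT, i, rfl⟩, fun h => ?_⟩
  rw [hΩo.frontier_eq] at h
  exact absurd hV h.2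

open Classical in
/-- The distributional divergence, summed cell by cell. -/
lemma divPair_eq (hd : 1 ≤ d) (V : Euc d) (τ : 𝒯.Mat) (v : 𝒯.Vec) (w : 𝒯.FacetVec) :
    𝒯.divPair V τ v w = ∑ T ∈ 𝒯.patch V,
      (𝒯.cellIntegral T (fun x => ∑ a, MPoly.ev (MPoly.divM (τ T) a) x * (v T a).ev x) -
        ∑ i, if (𝒯.cell T).facet i ∈ 𝒯.patchFacets V then
          facetIntegral ((𝒯.cell T).facet i) (fun x =>
            (𝒯.cell T).trNN i (τ T) x * (𝒯.cell T).trN i (v T) x +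
              ∑ a, (𝒯.cell T).trNT i (τ T) x a * (w ((𝒯.cell T).facet i) a).ev x) else 0) := by
  rw [divPair, Finset.sum_sub_distrib]
  congr 1
  -- For fixed `F` the jumps expand into contributions of the adjacent cells. Exchanging the sums
  -- then leaves, for every cell and every `i`, the single facet `F = facet i`.
  have hF : ∀ F ∈ 𝒯.patchFacets V, facetIntegral F (𝒯.jumpNN V τ v F) +
        facetIntegral F (fun x => ∑ a, 𝒯.jumpNT V τ F x a * (w F a).ev x) =
      ∑ T ∈ 𝒯.patch V, ∑ i, if (𝒯.cell T).facet i = F then facetIntegral F (fun x =>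
        (𝒯.cell T).trNN i (τ T) x * (𝒯.cell T).trN i (v T) x +
          ∑ a, (𝒯.cell T).trNT i (τ T) x a * (w F a).ev x) else 0 := by
    intro F hF
    obtain ⟨⟨S, -, l, hl⟩, -⟩ := 𝒯.mem_patchFacets.1 hF
    set G : 𝒯.ι → Fin (d + 1) → Euc d → ℝ := fun T i x => if (𝒯.cell T).facet i = F then
        ((𝒯.cell T).trNN i (τ T) x * (𝒯.cell T).trN i (v T) x +
          ∑ a, (𝒯.cell T).trNT i (τ T) x a * (w F a).ev x) else 0 with hG
    have hGc : ∀ T i, Continuous (G T i) := by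
      intro T i
      by_cases h : (𝒯.cell T).facet i = F
      · simp only [hG, h, if_true]
        have := continuous_finsetSum Finset.univ (fun (a : Fin d) _ =>
          (by fun_prop : Continuous fun x => (𝒯.cell T).trNT i (τ T) x a * (w F a).ev x))
        fun_prop
      · simp only [hG, h, if_false]
        exact continuous_const
    have hNN : Continuous (𝒯.jumpNN V τ v F) := by
      unfold jumpNN
      refine continuous_finsetSum _ fun T _ => continuous_finsetSum _ fun i _ => ?_
      split_ifs <;> fun_prop
    have hNT : Continuous (fun x => ∑ a, 𝒯.jumpNT V τ F x a * (w F a).ev x) := by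
      unfold jumpNT
      refine continuous_finsetSum _ fun a _ => Continuous.mul ?_ (MPoly.continuous_ev _)
      refine continuous_finsetSum _ fun T _ => continuous_finsetSum _ fun i _ => ?_
      split_ifs <;> fun_prop
    have h1 : ∀ x, 𝒯.jumpNN V τ v F x + ∑ a, 𝒯.jumpNT V τ F x a * (w F a).ev x =
        ∑ T ∈ 𝒯.patch V, ∑ i, G T i x := by
      intro x
      simp only [jumpNN, jumpNT, Finset.sum_mul]
      rw [Finset.sum_comm (s := Finset.univ) (t := 𝒯.patch V), ← Finset.sum_add_distrib]
      refine Finset.sum_congr rfl fun T _ => ?_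
      rw [Finset.sum_comm, ← Finset.sum_add_distrib]
      refine Finset.sum_congr rfl fun i _ => ?_
      simp only [hG]
      split_ifs <;> simp
    -- As a facet of a cell, `F` has finite surface measure, so integrals of continuous functions
    -- over it may be split.
    subst hl
    rw [← Cell.facetIntegral_add _ hd l hNN hNT]
    simp only [h1]
    rw [Cell.facetIntegral_sum _ hd l _ fun T _ => continuous_finsetSum _ fun i _ => hGc T i]
    refine Finset.sum_congr rfl fun T _ => ?_
    rw [Cell.facetIntegral_sum _ hd l _ fun i _ => hGc T i]
    refine Finset.sum_congr rfl fun i _ => ?_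
    simp only [hG]
    split_ifs
    · rfl
    · simp [facetIntegral]
  rw [Finset.sum_congr rfl hF, Finset.sum_comm]
  refine Finset.sum_congr rfl fun T _ => ?_
  rw [Finset.sum_comm]
  refine Finset.sum_congr rfl fun i _ => ?_
  rw [Finset.sum_ite_eq]

lemma divPair_sub (hd : 1 ≤ d) (V : Euc d) (τ : 𝒯.Mat) (v v' : 𝒯.Vec) (w w' : 𝒯.FacetVec) :
    𝒯.divPair V τ (v - v') (w - w') = 𝒯.divPair V τ v w - 𝒯.divPair V τ v' w' := by
  rw [divPair_eq _ hd, divPair_eq _ hd, divPair_eq _ hd, ← Finset.sum_sub_distrib]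
  refine Finset.sum_congr rfl fun T _ => ?_
  have hc : ∀ v : 𝒯.Vec, Continuous
      fun x => ∑ a, MPoly.ev (MPoly.divM (τ T) a) x * (v T a).ev x := fun v =>
    continuous_finsetSum _ fun a _ => by fun_prop
  have hf : ∀ (v : 𝒯.Vec) (w : 𝒯.FacetVec) (i : Fin (d + 1)), Continuous fun x =>
      (𝒯.cell T).trNN i (τ T) x * (𝒯.cell T).trN i (v T) x +
        ∑ a, (𝒯.cell T).trNT i (τ T) x a * (w ((𝒯.cell T).facet i) a).ev x := fun v w i =>
    (by fun_prop : Continuous fun x =>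
      (𝒯.cell T).trNN i (τ T) x * (𝒯.cell T).trN i (v T) x).add
      (continuous_finsetSum _ fun a _ => by fun_prop)
  have h1 : 𝒯.cellIntegral T
        (fun x => ∑ a, MPoly.ev (MPoly.divM (τ T) a) x * ((v - v') T a).ev x) =
      𝒯.cellIntegral T (fun x => ∑ a, MPoly.ev (MPoly.divM (τ T) a) x * (v T a).ev x) -
        𝒯.cellIntegral T (fun x => ∑ a, MPoly.ev (MPoly.divM (τ T) a) x * (v' T a).ev x) := by
    rw [← 𝒯.cellIntegral_sub T ((𝒯.cell T).integrableOn_hull (hc v))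
      ((𝒯.cell T).integrableOn_hull (hc v'))]
    simp only [Pi.sub_apply, MPoly.ev_sub, mul_sub, Finset.sum_sub_distrib]
  have h2 : ∀ i, facetIntegral ((𝒯.cell T).facet i) (fun x =>
        (𝒯.cell T).trNN i (τ T) x * (𝒯.cell T).trN i ((v - v') T) x +
          ∑ a, (𝒯.cell T).trNT i (τ T) x a * ((w - w') ((𝒯.cell T).facet i) a).ev x) =
      facetIntegral ((𝒯.cell T).facet i) (fun x =>
        (𝒯.cell T).trNN i (τ T) x * (𝒯.cell T).trN i (v T) x +
          ∑ a, (𝒯.cell T).trNT i (τ T) x a * (w ((𝒯.cell T).facet i) a).ev x) -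
      facetIntegral ((𝒯.cell T).facet i) (fun x =>
        (𝒯.cell T).trNN i (τ T) x * (𝒯.cell T).trN i (v' T) x +
          ∑ a, (𝒯.cell T).trNT i (τ T) x a * (w' ((𝒯.cell T).facet i) a).ev x) := by
    intro i
    rw [← Cell.facetIntegral_sub _ hd i (hf v w i) (hf v' w' i)]
    congr 1
    funext x
    simp only [Pi.sub_apply, MPoly.ev_sub, mul_sub, Finset.sum_sub_distrib, Cell.trN_sub]
    ring
  rw [h1]
  simp only [h2]
  rw [sub_sub_sub_comm, ← Finset.sum_sub_distrib]
  congr 1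
  refine Finset.sum_congr rfl fun i _ => ?_
  split_ifs <;> simp

lemma divForm_sub (S : Finset 𝒯.ι) (v v' : 𝒯.Vec) (q : 𝒯.Scal) :
    𝒯.divForm S (v - v') q = 𝒯.divForm S v q - 𝒯.divForm S v' q := by
  rw [divForm, divForm, divForm, ← Finset.sum_sub_distrib]
  refine Finset.sum_congr rfl fun T _ => ?_
  rw [← 𝒯.cellIntegral_sub T]
  · congr 1
    funext x
    simp [MPoly.divV, sub_mul, Finset.sum_sub_distrib]
  · exact (𝒯.cell T).integrableOn_hull (by fun_prop)
  · exact (𝒯.cell T).integrableOn_hull (by fun_prop)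

/-- Constant vector fields. -/
def constVec (c : Fin d → ℝ) : 𝒯.Vec := fun _ a => MvPolynomial.C (c a)

open Classical in
/-- The tangential part of a constant vector on the facets of the triangulation. -/
def constTang (c : Fin d → ℝ) : 𝒯.FacetVec := fun F a =>
  if h : ∃ T i, (𝒯.cell T).facet i = F then
    MvPolynomial.C ((𝒯.cell h.choose).tangent h.choose_spec.choose c a) else 0

/-- The tangential part does not depend on the sign of the normal, so the cell chosen in `constTang`
is immaterial. -/
lemma constTang_facet (T : 𝒯.ι) (i : Fin (d + 1)) (c : Fin d → ℝ) (a : Fin d) :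
    𝒯.constTang c ((𝒯.cell T).facet i) a = MvPolynomial.C ((𝒯.cell T).tangent i c a) := by
  have h : ∃ S l, (𝒯.cell S).facet l = (𝒯.cell T).facet i := ⟨T, i, rfl⟩
  rw [constTang, dif_pos h, Cell.tangent_eq_tangent h.choose_spec.choose_spec]

lemma divForm_constVec (S : Finset 𝒯.ι) (c : Fin d → ℝ) (q : 𝒯.Scal) :
    𝒯.divForm S (𝒯.constVec c) q = 0 := by
  simp [divForm, constVec, MPoly.divV, cellIntegral]

/-- The distributional divergence vanishes on the constants. -/
lemma divPair_const (hd : 2 ≤ d) (hΩo : IsOpen Ω) {V : Euc d} (hV : V ∈ Ω) (τ : 𝒯.Mat)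
    (c : Fin d → ℝ) : 𝒯.divPair V τ (𝒯.constVec c) (𝒯.constTang c) = 0 := by
  rw [divPair_eq _ (by omega)]
  refine Finset.sum_eq_zero fun T hT => ?_
  -- Gauss' theorem for `τᵀ c`, whose divergence is `(div τ) · c` and whose normal trace is `τn ·
  -- c`.
  have h1 := (𝒯.cell T).setIntegral_divV hd
    (fun j => ∑ a, MvPolynomial.C (c a) * τ T a j)
  have h2 : ∀ x, MPoly.ev (MPoly.divV fun j => ∑ a, MvPolynomial.C (c a) * τ T a j) x =
      ∑ a, MPoly.ev (MPoly.divM (τ T) a) x * (𝒯.constVec c T a).ev x := by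
    intro x
    simp only [MPoly.divV, map_sum, MPoly.ev_sum, MPoly.divM, constVec, MPoly.ev_C,
      Finset.sum_mul, MvPolynomial.pderiv_C_mul, MPoly.ev_mul]
    rw [Finset.sum_comm]
    refine Finset.sum_congr rfl fun a _ => Finset.sum_congr rfl fun j _ => ?_
    ring
  have h3 : ∀ i x, (𝒯.cell T).trN i (fun j => ∑ a, MvPolynomial.C (c a) * τ T a j) x =
      (𝒯.cell T).trNN i (τ T) x * (𝒯.cell T).trN i (𝒯.constVec c T) x +
        ∑ a, (𝒯.cell T).trNT i (τ T) x a *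
          (𝒯.constTang c ((𝒯.cell T).facet i) a).ev x := by
    intro i x
    simp only [constTang_facet, MPoly.ev_C]
    have : (𝒯.cell T).trN i (𝒯.constVec c T) x = ∑ a, c a * (𝒯.cell T).normal i a := by
      simp [Cell.trN, constVec]
    rw [this, Cell.trNN_mul_add_trNT_mul _ (by omega)]
    simp only [Cell.trN, Cell.traction, MPoly.ev_sum, MPoly.ev_mul, MPoly.ev_C, Finset.sum_mul]
    rw [Finset.sum_comm]
    refine Finset.sum_congr rfl fun a _ => Finset.sum_congr rfl fun j _ => ?_
    ring
  simp only [h2] at h1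
  rw [cellIntegral, h1, sub_eq_zero]
  refine Finset.sum_congr rfl fun i _ => ?_
  -- As `V ∈ Ω`, no facet is removed and the kept facets make up the whole boundary of the cell.
  rw [if_pos (𝒯.facet_mem_patchFacets hΩo hV hT i)]
  congr 1
  funext x
  exact h3 i x

end Triangulation

/-! ### Linearity of the residual and Green's formula for hat functions -/

namespace Triangulation

variable {d : ℕ} {Ω : Set (Euc d)} (𝒯 : Triangulation Ω)

lemma hull_subset_closure (T : 𝒯.ι) : (𝒯.cell T).hull ⊆ closure Ω := fun _ hx =>
  𝒯.mem_closure.2 ⟨T, hx⟩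

lemma integrableOn_hull_of_integrableOn (hΩr : interior (closure Ω) = Ω) {g : Euc d → ℝ}
    (hg : IntegrableOn g Ω) (T : 𝒯.ι) : IntegrableOn g (𝒯.cell T).hull := by
  have h : IntegrableOn g (closure Ω) := by
    rw [IntegrableOn, ← Measure.restrict_congr_set (𝒯.ae_eq_closure hΩr)]
    exact hg
  exact h.mono_set (𝒯.hull_subset_closure T)

lemma setIntegral_domain (hΩr : interior (closure Ω) = Ω) {g : Euc d → ℝ}
    (hg : IntegrableOn g Ω) : ∫ x in Ω, g x = ∑ T, 𝒯.cellIntegral T g := by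
  rw [setIntegral_congr_set (𝒯.ae_eq_closure hΩr), ← 𝒯.region_univ,
    𝒯.setIntegral_region _ fun T _ => 𝒯.integrableOn_hull_of_integrableOn hΩr hg T]
  rfl

theorem measure_domain_lt_top {d : ℕ} {Ω : Set (Euc d)} (𝒯 : Triangulation Ω) : volume Ω < ⊤ := by
  have : IsCompact (closure Ω) := by
    rw [← 𝒯.cover]
    exact isCompact_iUnion fun T => (𝒯.cell T).isCompact_hull
  exact (measure_mono subset_closure).trans_lt this.measure_lt_top

lemma integrableOn_hull_source (hΩr : interior (closure Ω) = Ω)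
    (f : Lp (Euc d) 2 (volume.restrict Ω)) (T : 𝒯.ι) {v : Fin d → Euc d → ℝ}
    (hv : ∀ a, Continuous (v a)) :
    IntegrableOn (fun x => ∑ a, f x a * v a x) (𝒯.cell T).hull := by
  have : IsFiniteMeasure (volume.restrict Ω) :=
    isFiniteMeasure_restrict.2 𝒯.measure_domain_lt_top.ne
  have hf : Integrable f (volume.restrict Ω) := (Lp.memLp f).integrable (by norm_num)
  refine integrable_finsetSum _ fun a _ => ?_
  have hfa : IntegrableOn (fun x => f x a) Ω :=
    ((EuclideanSpace.proj a : Euc d →L[ℝ] ℝ).integrable_comp hf)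
  exact (𝒯.integrableOn_hull_of_integrableOn hΩr hfa T).mul_continuousOn (hv a).continuousOn
    (𝒯.cell T).isCompact_hull

lemma residual_sub (hd : 1 ≤ d) (hΩr : interior (closure Ω) = Ω) (k : ℕ) (ν : ℝ)
    (f : Lp (Euc d) 2 (volume.restrict Ω)) (u : 𝒯.Vec) (p : 𝒯.Scal) (V : Euc d)
    (v v' : 𝒯.Vec) (w w' : 𝒯.FacetVec) :
    𝒯.residual k ν f u p V (v - v') (w - w') =
      𝒯.residual k ν f u p V v w - 𝒯.residual k ν f u p V v' w' := by
  classical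
  rw [residual, residual, residual, ← Finset.sum_sub_distrib]
  refine Finset.sum_congr rfl fun T _ => ?_
  set B := (𝒯.cell T).bubble k V with hB
  have hB1 : B ((v - v') T) = B (v T) - B (v' T) := Cell.bubble_sub _ k V _ _
  have hB2 : ∀ a, B ((v - v') T) a = B (v T) a - B (v' T) a := fun a => congrFun hB1 a
  have h1 : 𝒯.cellIntegral T (fun x => ∑ a, f x a * (B ((v - v') T) a).ev x) =
      𝒯.cellIntegral T (fun x => ∑ a, f x a * (B (v T) a).ev x) -
        𝒯.cellIntegral T (fun x => ∑ a, f x a * (B (v' T) a).ev x) := by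
    rw [← 𝒯.cellIntegral_sub T
      (𝒯.integrableOn_hull_source hΩr f T fun a => MPoly.continuous_ev _)
      (𝒯.integrableOn_hull_source hΩr f T fun a => MPoly.continuous_ev _)]
    simp only [hB2, MPoly.ev_sub, mul_sub, Finset.sum_sub_distrib]
  have hc : ∀ z : Fin d → MPoly d, Continuous fun x => ∑ a,
      (ν * MPoly.ev (MPoly.lap (u T) a) x - MPoly.ev (MvPolynomial.pderiv a (p T)) x) *
        (z a).ev x := fun z => continuous_finsetSum _ fun a _ => by fun_prop
  have h2 : 𝒯.cellIntegral T (fun x => ∑ a,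
        (ν * MPoly.ev (MPoly.lap (u T) a) x - MPoly.ev (MvPolynomial.pderiv a (p T)) x) *
          (B ((v - v') T) a).ev x) =
      𝒯.cellIntegral T (fun x => ∑ a,
        (ν * MPoly.ev (MPoly.lap (u T) a) x - MPoly.ev (MvPolynomial.pderiv a (p T)) x) *
          (B (v T) a).ev x) -
      𝒯.cellIntegral T (fun x => ∑ a,
        (ν * MPoly.ev (MPoly.lap (u T) a) x - MPoly.ev (MvPolynomial.pderiv a (p T)) x) *
          (B (v' T) a).ev x) := by
    rw [← 𝒯.cellIntegral_sub T ((𝒯.cell T).integrableOn_hull (hc _))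
      ((𝒯.cell T).integrableOn_hull (hc _))]
    simp only [hB2, MPoly.ev_sub, mul_sub, Finset.sum_sub_distrib]
  have h3 : ∀ i, facetIntegral ((𝒯.cell T).facet i) (fun x =>
        (ν * (𝒯.cell T).trNN i (MPoly.grad (u T)) x - (p T).ev x) *
          (𝒯.cell T).trN i (B ((v - v') T)) x) =
      facetIntegral ((𝒯.cell T).facet i) (fun x =>
        (ν * (𝒯.cell T).trNN i (MPoly.grad (u T)) x - (p T).ev x) *
          (𝒯.cell T).trN i (B (v T)) x) -
      facetIntegral ((𝒯.cell T).facet i) (fun x =>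
        (ν * (𝒯.cell T).trNN i (MPoly.grad (u T)) x - (p T).ev x) *
          (𝒯.cell T).trN i (B (v' T)) x) := by
    intro i
    rw [← Cell.facetIntegral_sub _ hd i (by fun_prop) (by fun_prop)]
    simp only [hB1, Cell.trN_sub, mul_sub]
  have hc4 : ∀ (i : Fin (d + 1)) (z : 𝒯.FacetVec), Continuous fun x => ∑ a,
      ((𝒯.cell T).hat V).ev x * (ν * (𝒯.cell T).trNT i (MPoly.grad (u T)) x a) *
        (z ((𝒯.cell T).facet i) a).ev x := fun i z =>
    continuous_finsetSum _ fun a _ => by fun_prop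
  have h4 : ∀ i, facetIntegral ((𝒯.cell T).facet i) (fun x => ∑ a,
          ((𝒯.cell T).hat V).ev x * (ν * (𝒯.cell T).trNT i (MPoly.grad (u T)) x a) *
            ((w - w') ((𝒯.cell T).facet i) a).ev x) =
      facetIntegral ((𝒯.cell T).facet i) (fun x => ∑ a,
          ((𝒯.cell T).hat V).ev x * (ν * (𝒯.cell T).trNT i (MPoly.grad (u T)) x a) *
            (w ((𝒯.cell T).facet i) a).ev x) -
      facetIntegral ((𝒯.cell T).facet i) (fun x => ∑ a,
          ((𝒯.cell T).hat V).ev x * (ν * (𝒯.cell T).trNT i (MPoly.grad (u T)) x a) *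
            (w' ((𝒯.cell T).facet i) a).ev x) := by
    intro i
    rw [← Cell.facetIntegral_sub _ hd i (hc4 i w) (hc4 i w')]
    simp only [Pi.sub_apply, MPoly.ev_sub, mul_sub, Finset.sum_sub_distrib]
  have h5 : ∀ F : Fin (d + 1) → ℝ, ∀ G : Fin (d + 1) → ℝ,
      (∑ i, if (𝒯.cell T).facet i ∈ 𝒯.patchFacets V then F i - G i else 0) =
        (∑ i, if (𝒯.cell T).facet i ∈ 𝒯.patchFacets V then F i else 0) -
          ∑ i, if (𝒯.cell T).facet i ∈ 𝒯.patchFacets V then G i else 0 := by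
    intro F G
    rw [← Finset.sum_sub_distrib]
    refine Finset.sum_congr rfl fun i _ => ?_
    split_ifs <;> simp
  simp only [h1, h2, h3, h4, h5, Finset.sum_sub_distrib]
  ring

/-- The product of a hat function and a constant vector. -/
def hatVec (V : Euc d) (c : Fin d → ℝ) : 𝒯.Vec := fun T a =>
  (𝒯.cell T).hat V * MvPolynomial.C (c a)

lemma hatVec_eq_zero {V : Euc d} {T : 𝒯.ι} (hT : T ∉ 𝒯.patch V) (c : Fin d → ℝ) :
    𝒯.hatVec V c T = 0 := by
  funext a
  rw [hatVec, Cell.hat_eq_zero _ fun h => hT (𝒯.mem_patch.2 h), zero_mul, Pi.zero_apply]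

/-- Hat functions agree across cells, and the open star of an interior vertex stays inside `Ω`,
which gives the zero boundary values. This is what admits `φ_V c` as a test function of the primal
method. -/
lemma hatVec_mem_P1Zero (hΩo : IsOpen Ω) (hΩr : interior (closure Ω) = Ω) {V : Euc d}
    (hV : V ∈ Ω) (c : Fin d → ℝ) : 𝒯.hatVec V c ∈ 𝒯.P1Zero := by
  refine ⟨⟨fun S T x hx a => ?_, fun T x hx a => ?_⟩, fun T a => ?_⟩
  · rw [hatVec, hatVec, MPoly.ev_mul, MPoly.ev_mul, 𝒯.ev_hat_eq hx.1 hx.2]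
  · rw [hatVec, MPoly.ev_mul]
    by_cases hT : V ∈ Set.range (𝒯.cell T).points
    · obtain ⟨l, rfl⟩ := hT
      rw [Cell.ev_hat_points]
      have h0 : (𝒯.cell T).basis.coord l x = 0 := by
        by_contra h
        have h1 : 0 < (𝒯.cell T).basis.coord l x :=
          lt_of_le_of_ne (((𝒯.cell T).mem_hull x).1 hx.1 l) (Ne.symm h)
        have h2 := hx.2
        rw [hΩo.frontier_eq] at h2
        exact h2.2 (𝒯.mem_of_coord_pos hΩo hΩr hV hx.1 h1)
      rw [h0, zero_mul]
    · rw [Cell.hat_eq_zero _ hT, MPoly.ev_zero, zero_mul]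
  · rw [hatVec, mul_comm, ← MvPolynomial.smul_eq_C_mul]
    exact Submodule.smul_mem _ _ ((𝒯.cell T).hat_mem_degLE V)

/-- The algebra left after the product rule, with `Φ = φ_V`, `D = ∇φ_V`, `U = ∇u`, `P = ∇p` and `W a
j = ∂_j ∂_j u_a` as free symbols. -/
lemma sum_green {n : ℕ} (Φ ν p : ℝ) (c P D : Fin n → ℝ) (U W : Fin n → Fin n → ℝ) :
    ∑ j, (Φ * (ν * ∑ a, c a * W a j - c j * P j) + (ν * ∑ a, c a * U a j - c j * p) * D j) =
      ∑ a, (ν * ∑ j, W a j - P a) * (Φ * c a) +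
        (ν * ∑ a, ∑ j, U a j * (c a * D j) - (∑ a, c a * D a) * p) := by
  have h1 : ∑ j, Φ * (ν * ∑ a, c a * W a j) = ∑ a, ν * (∑ j, W a j) * (Φ * c a) := by
    simp only [Finset.mul_sum, Finset.sum_mul]
    rw [Finset.sum_comm]
    exact Finset.sum_congr rfl fun a _ => Finset.sum_congr rfl fun j _ => by ring
  have h2 : ∑ j, ν * (∑ a, c a * U a j) * D j = ν * ∑ a, ∑ j, U a j * (c a * D j) := by
    simp only [Finset.mul_sum, Finset.sum_mul]
    rw [Finset.sum_comm]
    exact Finset.sum_congr rfl fun a _ => Finset.sum_congr rfl fun j _ => by ring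
  have h3 : ∑ j, Φ * (c j * P j) = ∑ a, P a * (Φ * c a) :=
    Finset.sum_congr rfl fun a _ => by ring
  have h4 : ∑ j, c j * p * D j = (∑ a, c a * D a) * p := by
    rw [Finset.sum_mul]
    exact Finset.sum_congr rfl fun a _ => by ring
  simp only [mul_sub, sub_mul, Finset.sum_add_distrib, Finset.sum_sub_distrib, h1, h2, h3, h4]

lemma _root_.Cell.setIntegral_add_mul_sub (T : Cell d) {A B C : Euc d → ℝ} (hA : Continuous A)
    (hB : Continuous B) (hC : Continuous C) (ν : ℝ) :
    ∫ x in T.hull, (A x + (ν * B x - C x)) =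
      (∫ x in T.hull, A x) + (ν * (∫ x in T.hull, B x) - ∫ x in T.hull, C x) := by
  have hB' : IntegrableOn (fun x => ν * B x) T.hull := T.integrableOn_hull (hB.const_mul ν)
  have hC' := T.integrableOn_hull hC
  have hBC : IntegrableOn (fun x => ν * B x - C x) T.hull := hB'.sub hC'
  rw [integral_add (T.integrableOn_hull hA) hBC, integral_sub hB' hC', integral_const_mul]

/-- Green's formula on one cell, tested with a hat function times a constant vector. -/
lemma green_hatVec (hd : 2 ≤ d) (ν : ℝ) (u : 𝒯.Vec) (p : 𝒯.Scal) (V : Euc d) (c : Fin d → ℝ)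
    (T : 𝒯.ι) :
    𝒯.cellIntegral T (fun x => ∑ a,
        (ν * MPoly.ev (MPoly.lap (u T) a) x - MPoly.ev (MvPolynomial.pderiv a (p T)) x) *
          (𝒯.hatVec V c T a).ev x) +
      (ν * 𝒯.cellIntegral T (fun x => ∑ a, ∑ b,
        (MPoly.grad (u T) a b).ev x * (MPoly.grad (𝒯.hatVec V c T) a b).ev x) -
      𝒯.cellIntegral T (fun x => MPoly.ev (MPoly.divV (𝒯.hatVec V c T)) x * (p T).ev x)) =
    ∑ i, facetIntegral ((𝒯.cell T).facet i) (fun x => ((𝒯.cell T).hat V).ev x *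
      (ν * (∑ a, (𝒯.cell T).traction i (MPoly.grad (u T)) x a * c a) -
        (p T).ev x * ∑ a, c a * (𝒯.cell T).normal i a)) := by
  set φ := (𝒯.cell T).hat V with hφ
  -- The field is `φ_V (ν∇u - pI)ᵀ c`; its normal trace is `φ_V` times the traction `(ν∇u - pI) n`
  -- tested with `c`.
  have hgauss := (𝒯.cell T).setIntegral_divV hd (fun j => φ *
    (MvPolynomial.C ν * (∑ a, MvPolynomial.C (c a) * MvPolynomial.pderiv j (u T a)) -
      MvPolynomial.C (c j) * p T))
  have hl : ∀ x, MPoly.ev (MPoly.divV fun j => φ *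
      (MvPolynomial.C ν * (∑ a, MvPolynomial.C (c a) * MvPolynomial.pderiv j (u T a)) -
        MvPolynomial.C (c j) * p T)) x =
      (∑ a, (ν * MPoly.ev (MPoly.lap (u T) a) x - MPoly.ev (MvPolynomial.pderiv a (p T)) x) *
          (𝒯.hatVec V c T a).ev x) +
      (ν * (∑ a, ∑ b,
        (MPoly.grad (u T) a b).ev x * (MPoly.grad (𝒯.hatVec V c T) a b).ev x) -
        MPoly.ev (MPoly.divV (𝒯.hatVec V c T)) x * (p T).ev x) := by
    intro x
    simp only [MPoly.divV, MPoly.lap, MPoly.grad, hatVec, Matrix.of_apply, MPoly.ev_sum,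
      Derivation.leibniz, smul_eq_mul, MPoly.ev_add, MPoly.ev_mul, MPoly.ev_C, map_sub, map_sum,
      MPoly.ev_sub, MvPolynomial.pderiv_C, mul_zero, add_zero, zero_add, ← hφ]
    exact sum_green _ _ _ _ _ _ _ _
  have hr : ∀ i x, (𝒯.cell T).trN i (fun j => φ *
      (MvPolynomial.C ν * (∑ a, MvPolynomial.C (c a) * MvPolynomial.pderiv j (u T a)) -
        MvPolynomial.C (c j) * p T)) x = φ.ev x *
      (ν * (∑ a, (𝒯.cell T).traction i (MPoly.grad (u T)) x a * c a) -
        (p T).ev x * ∑ a, c a * (𝒯.cell T).normal i a) := by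
    intro i x
    simp only [Cell.trN, Cell.traction, MPoly.grad, Matrix.of_apply, MPoly.ev_mul, MPoly.ev_sub,
      MPoly.ev_sum, MPoly.ev_C, Finset.sum_mul, Finset.mul_sum, mul_sub, sub_mul,
      Finset.sum_sub_distrib]
    rw [Finset.sum_comm]
    congr 1
    · refine Finset.sum_congr rfl fun a _ => Finset.sum_congr rfl fun j _ => ?_
      ring
    · refine Finset.sum_congr rfl fun j _ => ?_
      ring
  have hc1 : Continuous fun x => ∑ a,
      (ν * MPoly.ev (MPoly.lap (u T) a) x - MPoly.ev (MvPolynomial.pderiv a (p T)) x) *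
        (𝒯.hatVec V c T a).ev x := continuous_finsetSum _ fun a _ => by fun_prop
  have hc2 : Continuous fun x => ∑ a, ∑ b,
      (MPoly.grad (u T) a b).ev x * (MPoly.grad (𝒯.hatVec V c T) a b).ev x :=
    continuous_finsetSum _ fun a _ => continuous_finsetSum _ fun b _ => by fun_prop
  have hc3 : Continuous fun x =>
      MPoly.ev (MPoly.divV (𝒯.hatVec V c T)) x * (p T).ev x := by fun_prop
  simp only [hl] at hgauss
  refine ((𝒯.cell T).setIntegral_add_mul_sub hc1 hc2 hc3 ν).symm.trans ?_
  refine hgauss.trans (Finset.sum_congr rfl fun i _ => ?_)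
  congr 1
  funext x
  exact hr i x

end Triangulation

/-! ### The residual on constants -/

namespace Triangulation

variable {d : ℕ} {Ω : Set (Euc d)} (𝒯 : Triangulation Ω)

variable {𝒯} in
/-- The load functional on a continuous piecewise linear field, cell by cell. -/
lemma load_eq_sum (hΩr : interior (closure Ω) = Ω) (M : 𝒯.PrimalMethod)
    (f : Lp (Euc d) 2 (volume.restrict Ω)) (z : M.Vbar) (hz : (z : 𝒯.Vec) ∈ 𝒯.P1Zero) :
    ∫ x in Ω, inner ℝ (f x) (M.R z x) =
      ∑ T, 𝒯.cellIntegral T (fun x => ∑ a, f x a * ((z : 𝒯.Vec) T a).ev x) := by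
  rw [𝒯.setIntegral_domain hΩr (L2.integrable_inner f (M.R z))]
  refine Finset.sum_congr rfl fun T _ => ?_
  have h1 := M.R_P1 z hz T
  have hle : volume.restrict (𝒯.cell T).hull ≤ volume.restrict Ω := by
    rw [Measure.restrict_congr_set (𝒯.ae_eq_closure hΩr)]
    exact Measure.restrict_mono (𝒯.hull_subset_closure T) le_rfl
  have h2 := ae_mono hle h1
  have h3 := ae_restrict_mem (μ := volume) (𝒯.cell T).isCompact_hull.isClosed.measurableSet
  refine integral_congr_ae ?_
  filter_upwards [h2, h3] with x hx hxT
  rw [PiLp.inner_apply]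
  refine Finset.sum_congr rfl fun a _ => ?_
  rw [hx hxT a]
  simp [mul_comm]

/-- The residual vanishes on the constants. -/
lemma residual_const (hd : 2 ≤ d) (hΩo : IsOpen Ω) (hΩr : interior (closure Ω) = Ω) {k : ℕ}
    (hk : 1 ≤ k) (ν : ℝ) (f : Lp (Euc d) 2 (volume.restrict Ω)) (M : 𝒯.PrimalMethod)
    {u : 𝒯.Vec} {p : 𝒯.Scal} (hup : IsPrimalSolution M ν f u p) {V : Euc d} (hV : V ∈ Ω)
    (c : Fin d → ℝ) :
    𝒯.residual k ν f u p V (𝒯.constVec c) (𝒯.constTang c) = 0 := by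
  classical
  have hz := 𝒯.hatVec_mem_P1Zero hΩo hΩr hV c
  have hmom := hup.momentum ⟨𝒯.hatVec V c, M.P1_le hz⟩
  rw [load_eq_sum hΩr M f ⟨𝒯.hatVec V c, M.P1_le hz⟩ hz, divForm, Finset.mul_sum,
    ← Finset.sum_sub_distrib] at hmom
  dsimp only at hmom
  -- The primal equation sums over all cells, the residual over the patch only; outside the patch
  -- `φ_V c` is zero.
  have hout : ∀ T ∉ 𝒯.patch V,
      𝒯.cellIntegral T (fun x => ∑ a, f x a * (𝒯.hatVec V c T a).ev x) -
        (ν * 𝒯.cellIntegral T (fun x => ∑ a, ∑ b,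
          (MPoly.grad (u T) a b).ev x * (MPoly.grad (𝒯.hatVec V c T) a b).ev x) -
        𝒯.cellIntegral T (fun x => MPoly.ev (MPoly.divV (𝒯.hatVec V c T)) x * (p T).ev x))
        = 0 := by
    intro T hT
    simp [𝒯.hatVec_eq_zero hT c, MPoly.grad, MPoly.divV, cellIntegral]
  have hbub : ∀ T a x, ((𝒯.cell T).bubble k V (𝒯.constVec c T) a).ev x =
      (𝒯.hatVec V c T a).ev x := by
    intro T a x
    rw [hatVec, MPoly.ev_mul, MPoly.ev_C]
    exact (𝒯.cell T).ev_bubble_const hk V c a x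
  -- On each cell the normal and tangential facet terms of the residual recombine to the full
  -- traction, and Green's formula leaves load minus primal form.
  have hcell : ∀ T ∈ 𝒯.patch V,
      (𝒯.cellIntegral T (fun x => ∑ a, f x a *
          ((𝒯.cell T).bubble k V (𝒯.constVec c T) a).ev x) +
        𝒯.cellIntegral T (fun x => ∑ a,
          (ν * MPoly.ev (MPoly.lap (u T) a) x - MPoly.ev (MvPolynomial.pderiv a (p T)) x) *
            ((𝒯.cell T).bubble k V (𝒯.constVec c T) a).ev x) -
        ∑ i, facetIntegral ((𝒯.cell T).facet i) (fun x =>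
          (ν * (𝒯.cell T).trNN i (MPoly.grad (u T)) x - (p T).ev x) *
            (𝒯.cell T).trN i ((𝒯.cell T).bubble k V (𝒯.constVec c T)) x) -
        ∑ i, if (𝒯.cell T).facet i ∈ 𝒯.patchFacets V then
          facetIntegral ((𝒯.cell T).facet i) (fun x => ∑ a,
            ((𝒯.cell T).hat V).ev x * (ν * (𝒯.cell T).trNT i (MPoly.grad (u T)) x a) *
              (𝒯.constTang c ((𝒯.cell T).facet i) a).ev x) else 0) =
      𝒯.cellIntegral T (fun x => ∑ a, f x a * (𝒯.hatVec V c T a).ev x) -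
        (ν * 𝒯.cellIntegral T (fun x => ∑ a, ∑ b,
          (MPoly.grad (u T) a b).ev x * (MPoly.grad (𝒯.hatVec V c T) a b).ev x) -
        𝒯.cellIntegral T
          (fun x => MPoly.ev (MPoly.divV (𝒯.hatVec V c T)) x * (p T).ev x)) := by
    intro T hT
    have hgreen := 𝒯.green_hatVec hd ν u p V c T
    have hfac : ∀ i, facetIntegral ((𝒯.cell T).facet i) (fun x => ((𝒯.cell T).hat V).ev x *
          (ν * (∑ a, (𝒯.cell T).traction i (MPoly.grad (u T)) x a * c a) -
            (p T).ev x * ∑ a, c a * (𝒯.cell T).normal i a)) =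
        facetIntegral ((𝒯.cell T).facet i) (fun x =>
          (ν * (𝒯.cell T).trNN i (MPoly.grad (u T)) x - (p T).ev x) *
            (𝒯.cell T).trN i ((𝒯.cell T).bubble k V (𝒯.constVec c T)) x) +
        if (𝒯.cell T).facet i ∈ 𝒯.patchFacets V then
          facetIntegral ((𝒯.cell T).facet i) (fun x => ∑ a,
            ((𝒯.cell T).hat V).ev x * (ν * (𝒯.cell T).trNT i (MPoly.grad (u T)) x a) *
              (𝒯.constTang c ((𝒯.cell T).facet i) a).ev x) else 0 := by
      intro i
      rw [if_pos (𝒯.facet_mem_patchFacets hΩo hV hT i), ← Cell.facetIntegral_add _ (by omega) i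
        (by fun_prop) (continuous_finsetSum _ fun a _ => by fun_prop)]
      congr 1
      funext x
      have htr : (𝒯.cell T).trN i ((𝒯.cell T).bubble k V (𝒯.constVec c T)) x =
          ((𝒯.cell T).hat V).ev x * ∑ a, c a * (𝒯.cell T).normal i a := by
        rw [Cell.trN, Finset.mul_sum]
        refine Finset.sum_congr rfl fun a _ => ?_
        rw [hbub, hatVec, MPoly.ev_mul, MPoly.ev_C, mul_assoc]
      have htang : ∑ a, ((𝒯.cell T).hat V).ev x *
            (ν * (𝒯.cell T).trNT i (MPoly.grad (u T)) x a) *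
              (𝒯.constTang c ((𝒯.cell T).facet i) a).ev x =
          ((𝒯.cell T).hat V).ev x * (ν * ∑ a, (𝒯.cell T).trNT i (MPoly.grad (u T)) x a *
            (𝒯.cell T).tangent i c a) := by
        simp only [Finset.mul_sum, constTang_facet, MPoly.ev_C]
        exact Finset.sum_congr rfl fun a _ => by ring
      rw [htr, htang, ← Cell.trNN_mul_add_trNT_mul _ (by omega)]
      ring
    simp only [hfac, Finset.sum_add_distrib] at hgreen
    simp only [hbub]
    linarith
  rw [residual, Finset.sum_congr rfl hcell, Finset.sum_subset (Finset.subset_univ _)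
    (fun T _ hT => hout T hT), Finset.sum_sub_distrib, hmom, sub_self]

/-! ### Membership in the test spaces of the patch -/

lemma fderiv_ae_eq_zero {S : Finset 𝒯.ι} {T : 𝒯.ι} (hT : T ∉ S) {ψ : Euc d → ℝ}
    (hψ : tsupport ψ ⊆ interior (𝒯.region S)) :
    ∀ᵐ x ∂volume, x ∈ (𝒯.cell T).hull → fderiv ℝ ψ x = 0 := by
  have hnull : volume (⋃ R ∈ S, (𝒯.cell R).hull ∩ (𝒯.cell T).hull) = 0 :=
    (measure_biUnion_null_iff S.countable_toSet).2 fun R hR =>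
      𝒯.volume_hull_inter_hull (by rintro rfl; exact hT hR)
  filter_upwards [measure_eq_zero_iff_ae_notMem.1 hnull] with x hx hxT
  refine fderiv_of_notMem_tsupport _ fun hxψ => hx ?_
  obtain ⟨R, hR, hxR⟩ := 𝒯.mem_region.1 (interior_subset (hψ hxψ))
  exact Set.mem_biUnion hR ⟨hxR, hxT⟩

/-- A test function supported in the smaller region is also one for the whole domain, and its
derivative vanishes almost everywhere on the cells outside `S`. The same weak divergence therefore
serves. -/
lemma RT_univ_subset_RT (k : ℕ) (S : Finset 𝒯.ι) : 𝒯.RT k Finset.univ ⊆ 𝒯.RT k S := by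
  rintro v ⟨⟨g, hg, hint⟩, hv⟩
  have hsub : interior (𝒯.region S) ⊆ interior (𝒯.region Finset.univ) := by
    refine interior_mono ?_
    rw [region_univ]
    exact 𝒯.region_subset S
  refine ⟨⟨g, hg.mono_measure (Measure.restrict_mono hsub le_rfl), fun ψ h1 h2 h3 => ?_⟩,
    fun T _ => hv T (Finset.mem_univ T)⟩
  have h := hint ψ h1 h2 (h3.trans hsub)
  rw [← Finset.sum_subset (Finset.subset_univ S) (fun T _ hT => ?_)] at h
  · rw [h]
    congr 1
    refine setIntegral_eq_of_subset_of_forall_sdiff_eq_zero isOpen_interior.measurableSet hsub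
      fun x hx => ?_
    rw [image_eq_zero_of_notMem_tsupport fun hxψ => hx.2 (h3 hxψ), mul_zero]
  · refine setIntegral_eq_zero_of_ae_eq_zero ?_
    filter_upwards [𝒯.fderiv_ae_eq_zero hT h3] with x hx hxT
    simp [hx hxT]

/-- Constants are weakly divergence-free. -/
lemma sum_cellIntegral_const_mul_fderiv (S : Finset 𝒯.ι) (c : Fin d → ℝ) {ψ : Euc d → ℝ}
    (h1 : ContDiff ℝ ∞ ψ) (h2 : HasCompactSupport ψ)
    (h3 : tsupport ψ ⊆ interior (𝒯.region S)) :
    ∑ T ∈ S, 𝒯.cellIntegral T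
      (fun x => ∑ a, c a * fderiv ℝ ψ x (EuclideanSpace.single a 1)) = 0 := by
  have hc : ∀ e : Euc d, Continuous fun x => fderiv ℝ ψ x e := fun e =>
    (h1.continuous_fderiv (by simp)).clm_apply continuous_const
  have hci : ∀ e : Euc d, Integrable fun x => fderiv ℝ ψ x e := fun e =>
    (hc e).integrable_of_hasCompactSupport (h2.fderiv_apply ℝ e)
  have hzero : ∀ e : Euc d, ∫ x, fderiv ℝ ψ x e = 0 := by
    intro e
    -- Integration by parts against the constant function `1`.
    have h := integral_mul_fderiv_eq_neg_fderiv_mul_of_integrable (μ := volume)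
      (f := fun _ : Euc d => (1 : ℝ)) (g := ψ) (v := e) (by simp) (by simpa using hci e)
      (by simpa using h1.continuous.integrable_of_hasCompactSupport h2)
      (fun _ _ => differentiableAt_const _)
      (fun x _ => h1.differentiable (by simp) x)
    simpa using h
  have hs : Continuous fun x => ∑ a, c a * fderiv ℝ ψ x (EuclideanSpace.single a 1) :=
    continuous_finsetSum _ fun a _ => (hc _).const_mul _
  have h := 𝒯.setIntegral_region S (g := fun x => ∑ a, c a *
    fderiv ℝ ψ x (EuclideanSpace.single a 1)) fun T _ => (𝒯.cell T).integrableOn_hull hs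
  refine h.symm.trans ?_
  rw [setIntegral_eq_integral_of_forall_compl_eq_zero]
  · rw [integral_finsetSum _ fun a _ => (hci _).const_mul _]
    simp [integral_const_mul, hzero]
  · intro x hx
    rw [fderiv_of_notMem_tsupport _ fun h => hx (interior_subset (h3 h))]
    simp

/-- Constants have weak divergence zero, so `v - c` keeps the weak divergence of `v`. -/
lemma sub_constVec_mem_Vel {k : ℕ} {V : Euc d} {v : 𝒯.Vec} (hv : v ∈ 𝒯.Vel k V)
    (c : Fin d → ℝ) : v - 𝒯.constVec c ∈ 𝒯.Vel k V := by
  obtain ⟨⟨g, hg, hint⟩, hpoly⟩ := hv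
  refine ⟨⟨g, hg, fun ψ h1 h2 h3 => ?_⟩, fun T hT => ?_⟩
  · have hc : ∀ a, Continuous fun x => fderiv ℝ ψ x (EuclideanSpace.single a (1 : ℝ)) := fun a =>
      (h1.continuous_fderiv (by simp)).clm_apply continuous_const
    rw [← hint ψ h1 h2 h3, ← sub_zero (∑ T ∈ 𝒯.patch V, 𝒯.cellIntegral T
      (fun x => ∑ a, (v T a).ev x * fderiv ℝ ψ x (EuclideanSpace.single a 1))),
      ← 𝒯.sum_cellIntegral_const_mul_fderiv (𝒯.patch V) c h1 h2 h3, ← Finset.sum_sub_distrib]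
    refine Finset.sum_congr rfl fun T _ => ?_
    rw [← 𝒯.cellIntegral_sub T]
    · congr 1
      funext x
      simp [constVec, sub_mul, Finset.sum_sub_distrib]
    · exact (𝒯.cell T).integrableOn_hull
        (continuous_finsetSum _ fun a _ => (MPoly.continuous_ev _).mul (hc a))
    · exact (𝒯.cell T).integrableOn_hull
        (continuous_finsetSum _ fun a _ => continuous_const.mul (hc a))
  · obtain ⟨a, b, ha, hb, hab⟩ := hpoly T hT
    refine ⟨fun j => a j - MvPolynomial.C (c j), b, fun j => Submodule.sub_mem _ (ha j) ?_, hb,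
      fun j => ?_⟩
    · rw [MPoly.degLE, MvPolynomial.mem_restrictTotalDegree, MvPolynomial.totalDegree_C]
      exact Nat.zero_le _
    · simp only [Pi.sub_apply, hab, constVec]
      ring

lemma sub_constTang_mem_HatVel (hd : 1 ≤ d) {k : ℕ} {V : Euc d} {w : 𝒯.FacetVec}
    (hw : w ∈ 𝒯.HatVel k V) (c : Fin d → ℝ) : w - 𝒯.constTang c ∈ 𝒯.HatVel k V := by
  intro F hF
  obtain ⟨⟨S, -, l, rfl⟩, -⟩ := 𝒯.mem_patchFacets.1 hF
  refine ⟨fun j => Submodule.sub_mem _ ((hw _ hF).1 j) ?_, fun T hT i hi x hx => ?_⟩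
  · rw [constTang_facet, MPoly.degLE, MvPolynomial.mem_restrictTotalDegree,
      MvPolynomial.totalDegree_C]
    exact Nat.zero_le _
  · have h1 := (hw _ hF).2 T hT i hi x hx
    rw [Pi.sub_apply, Cell.trN_sub, h1, zero_sub, neg_eq_zero, ← hi]
    simp only [Cell.trN, constTang_facet, MPoly.ev_C]
    exact (𝒯.cell T).sum_tangent_mul_normal hd i c

/-! ### Mean values of constants -/

lemma cellIntegral_one_pos (T : 𝒯.ι) : 0 < 𝒯.cellIntegral T (fun _ => 1) := by
  have hpos : 0 < volume (𝒯.cell T).hull := by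
    have h : (interior (𝒯.cell T).hull).Nonempty :=
      ⟨_, (𝒯.cell T).basis.centroid_mem_interior_convexHull⟩
    exact (isOpen_interior.measure_pos volume h).trans_le (measure_mono interior_subset)
  rw [cellIntegral, setIntegral_const, smul_eq_mul, mul_one]
  exact ENNReal.toReal_pos hpos.ne' (𝒯.cell T).isCompact_hull.measure_lt_top.ne

lemma facetIntegral_one_nonneg (F : Finset (Euc d)) : 0 ≤ facetIntegral F (fun _ => 1) :=
  integral_nonneg fun _ => zero_le_one

lemma cellIntegral_const (T : 𝒯.ι) (c : ℝ) :
    𝒯.cellIntegral T (fun _ => c) = 𝒯.cellIntegral T (fun _ => 1) * c := by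
  rw [cellIntegral, cellIntegral, ← integral_mul_const]
  simp

lemma facetIntegral_const (F : Finset (Euc d)) (c : ℝ) :
    facetIntegral F (fun _ => c) = facetIntegral F (fun _ => 1) * c := by
  rw [← facetIntegral_mul_const]
  simp

lemma meanValue_sub (hd : 1 ≤ d) (V : Euc d) (v v' : 𝒯.Vec) (w w' : 𝒯.FacetVec) (a : Fin d) :
    𝒯.meanValue V (v - v') (w - w') a = 𝒯.meanValue V v w a - 𝒯.meanValue V v' w' a := by
  have h1 : ∀ T, 𝒯.cellIntegral T (fun x => ((v - v') T a).ev x) =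
      𝒯.cellIntegral T (fun x => (v T a).ev x) - 𝒯.cellIntegral T (fun x => (v' T a).ev x) := by
    intro T
    rw [← 𝒯.cellIntegral_sub T ((𝒯.cell T).integrableOn_hull (MPoly.continuous_ev _))
      ((𝒯.cell T).integrableOn_hull (MPoly.continuous_ev _))]
    simp
  have h2 : ∀ F ∈ 𝒯.patchFacets V, facetIntegral F (fun x => ((w - w') F a).ev x) =
      facetIntegral F (fun x => (w F a).ev x) - facetIntegral F (fun x => (w' F a).ev x) := by
    intro F hF
    obtain ⟨⟨S, -, l, rfl⟩, -⟩ := 𝒯.mem_patchFacets.1 hF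
    rw [← Cell.facetIntegral_sub _ hd l (MPoly.continuous_ev _) (MPoly.continuous_ev _)]
    simp
  rw [meanValue, meanValue, meanValue, Finset.sum_congr rfl h2]
  simp only [h1, Finset.sum_sub_distrib]
  ring

lemma ev_constTang (T : 𝒯.ι) (i : Fin (d + 1)) (c : Fin d → ℝ) (a : Fin d) (x : Euc d) :
    (𝒯.constTang c ((𝒯.cell T).facet i) a).ev x = (𝒯.cell T).tangent i c a := by
  rw [constTang_facet, MPoly.ev_C]

/-- The integral of the constants over the cells and facets of the patch, as a linear map of the
constant. -/
def integralConst (V : Euc d) : (Fin d → ℝ) →ₗ[ℝ] (Fin d → ℝ) where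
  -- The field `constTang` is constant on each facet, so its value at the origin stands for all
  -- values.
  toFun c a := ∑ T ∈ 𝒯.patch V, 𝒯.cellIntegral T (fun _ => 1) * c a +
    ∑ F ∈ 𝒯.patchFacets V, facetIntegral F (fun _ => 1) * (𝒯.constTang c F a).ev 0
  map_add' c c' := by
    funext a
    simp only [Pi.add_apply]
    rw [add_add_add_comm, ← Finset.sum_add_distrib, ← Finset.sum_add_distrib]
    congr 1
    · exact Finset.sum_congr rfl fun T _ => mul_add _ _ _
    · refine Finset.sum_congr rfl fun F hF => ?_
      obtain ⟨⟨T, -, i, rfl⟩, -⟩ := 𝒯.mem_patchFacets.1 hF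
      simp only [ev_constTang, Cell.tangent, Pi.add_apply, add_mul, Finset.sum_add_distrib]
      ring
  map_smul' r c := by
    funext a
    simp only [Pi.smul_apply, smul_eq_mul, RingHom.id_apply, mul_add, Finset.mul_sum]
    congr 1
    · exact Finset.sum_congr rfl fun T _ => by ring
    · refine Finset.sum_congr rfl fun F hF => ?_
      obtain ⟨⟨T, -, i, rfl⟩, -⟩ := 𝒯.mem_patchFacets.1 hF
      simp only [ev_constTang, Cell.tangent, Pi.smul_apply, smul_eq_mul, mul_assoc,
        ← Finset.mul_sum]
      ring

lemma meanValue_const (V : Euc d) (c : Fin d → ℝ) (a : Fin d) :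
    𝒯.meanValue V (𝒯.constVec c) (𝒯.constTang c) a = 𝒯.integralConst V c a /
      (∑ T ∈ 𝒯.patch V, 𝒯.cellIntegral T (fun _ => 1) +
        ∑ F ∈ 𝒯.patchFacets V, facetIntegral F (fun _ => 1)) := by
  rw [meanValue]
  congr 1
  refine congrArg₂ (· + ·) (Finset.sum_congr rfl fun T _ => ?_)
    (Finset.sum_congr rfl fun F hF => ?_)
  · simp only [constVec, MPoly.ev_C]
    exact 𝒯.cellIntegral_const T (c a)
  · obtain ⟨⟨T, -, i, rfl⟩, -⟩ := 𝒯.mem_patchFacets.1 hF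
    simp only [ev_constTang]
    exact facetIntegral_const _ _

/-- The sum is `|c|² - (c · n)²`, and Cauchy-Schwarz applies because `|n| = 1`. -/
lemma _root_.Cell.sum_mul_tangent_nonneg (T : Cell d) (hd : 1 ≤ d) (i : Fin (d + 1))
    (c : Fin d → ℝ) : 0 ≤ ∑ a, c a * T.tangent i c a := by
  have h1 : ∑ a, c a * T.tangent i c a = ∑ a, c a ^ 2 - (∑ b, c b * T.normal i b) ^ 2 := by
    simp only [Cell.tangent, mul_sub, Finset.sum_sub_distrib]
    congr 1
    · exact Finset.sum_congr rfl fun a _ => by ring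
    · rw [sq, Finset.mul_sum]
      exact Finset.sum_congr rfl fun a _ => by ring
  have h2 := Finset.sum_mul_sq_le_sq_mul_sq Finset.univ c (T.normal i)
  have h3 : ∑ j, T.normal i j ^ 2 = 1 := by
    rw [← T.sum_normal_mul_self hd i]
    exact Finset.sum_congr rfl fun a _ => sq _
  rw [h3, mul_one] at h2
  linarith

lemma patch_nonempty {V : Euc d} (hV : V ∈ 𝒯.vertices) : (𝒯.patch V).Nonempty := by
  obtain ⟨T, i, h⟩ := hV
  exact ⟨T, 𝒯.mem_patch.2 ⟨i, h⟩⟩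

/-- The quadratic form of this map is positive definite: the cells contribute their volume times
`|c|²`, and the facets contribute nonnegative multiples of `c · c_t`. -/
lemma integralConst_injective (hd : 1 ≤ d) {V : Euc d} (hV : V ∈ 𝒯.vertices) :
    Function.Injective (𝒯.integralConst V) := by
  refine (injective_iff_map_eq_zero _).2 fun c hc => ?_
  have h0 : ∑ a, c a * 𝒯.integralConst V c a = 0 := by simp [hc]
  have h1 : ∑ a, c a * 𝒯.integralConst V c a =
      (∑ T ∈ 𝒯.patch V, 𝒯.cellIntegral T (fun _ => 1)) * ∑ a, c a * c a +
        ∑ F ∈ 𝒯.patchFacets V, facetIntegral F (fun _ => 1) *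
          ∑ a, c a * (𝒯.constTang c F a).ev 0 := by
    change ∑ a, c a * (∑ T ∈ 𝒯.patch V, 𝒯.cellIntegral T (fun _ => 1) * c a +
      ∑ F ∈ 𝒯.patchFacets V, facetIntegral F (fun _ => 1) * (𝒯.constTang c F a).ev 0) = _
    simp only [mul_add, Finset.sum_add_distrib, ← Finset.sum_mul]
    congr 1
    · rw [Finset.mul_sum]
      exact Finset.sum_congr rfl fun a _ => by ring
    · simp only [Finset.mul_sum]
      rw [Finset.sum_comm]
      exact Finset.sum_congr rfl fun F _ => Finset.sum_congr rfl fun a _ => by ring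
  have h2 : 0 ≤ ∑ F ∈ 𝒯.patchFacets V, facetIntegral F (fun _ => 1) *
      ∑ a, c a * (𝒯.constTang c F a).ev 0 := by
    refine Finset.sum_nonneg fun F hF => mul_nonneg (facetIntegral_one_nonneg F) ?_
    obtain ⟨⟨T, -, i, rfl⟩, -⟩ := 𝒯.mem_patchFacets.1 hF
    simp only [ev_constTang]
    exact (𝒯.cell T).sum_mul_tangent_nonneg hd i c
  have h3 : 0 < ∑ T ∈ 𝒯.patch V, 𝒯.cellIntegral T (fun _ => 1) :=
    Finset.sum_pos (fun T _ => 𝒯.cellIntegral_one_pos T) (𝒯.patch_nonempty hV)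
  have h4 : 0 ≤ ∑ a, c a * c a := Finset.sum_nonneg fun a _ => mul_self_nonneg _
  have h5 : ∑ a, c a * c a = 0 := by
    rcases h4.eq_or_lt with h | h
    · exact h.symm
    · exfalso
      have := mul_pos h3 h
      linarith
  funext a
  exact mul_self_eq_zero.1
    ((Finset.sum_eq_zero_iff_of_nonneg fun a _ => mul_self_nonneg (c a)).1 h5 a (Finset.mem_univ a))

/-- Every mean value is the mean value of a constant. -/
lemma exists_meanValue_const (hd : 1 ≤ d) {V : Euc d} (hV : V ∈ 𝒯.vertices) (b : Fin d → ℝ) :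
    ∃ c : Fin d → ℝ, 𝒯.meanValue V (𝒯.constVec c) (𝒯.constTang c) = b := by
  have hpos : 0 < ∑ T ∈ 𝒯.patch V, 𝒯.cellIntegral T (fun _ => 1) +
      ∑ F ∈ 𝒯.patchFacets V, facetIntegral F (fun _ => 1) :=
    add_pos_of_pos_of_nonneg
      (Finset.sum_pos (fun T _ => 𝒯.cellIntegral_one_pos T) (𝒯.patch_nonempty hV))
      (Finset.sum_nonneg fun F _ => facetIntegral_one_nonneg F)
  obtain ⟨c, hc⟩ := LinearMap.injective_iff_surjective.1 (𝒯.integralConst_injective hd hV)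
    ((∑ T ∈ 𝒯.patch V, 𝒯.cellIntegral T (fun _ => 1) +
      ∑ F ∈ 𝒯.patchFacets V, facetIntegral F (fun _ => 1)) • b)
  refine ⟨c, funext fun a => ?_⟩
  rw [meanValue_const, hc, Pi.smul_apply, smul_eq_mul, mul_div_cancel_left₀ _ hpos.ne']

/-! ### The balance equation for all test pairs -/

/-- The balance equation of the local problem holds for all test pairs, not only for those with mean
value zero. -/
lemma IsLocalSolution.balance_all {𝒯 : Triangulation Ω} (hd : 2 ≤ d) (hΩo : IsOpen Ω)
    (hΩr : interior (closure Ω) = Ω) {k : ℕ} (hk : 1 ≤ k) {ν : ℝ}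
    {f : Lp (Euc d) 2 (volume.restrict Ω)} {M : 𝒯.PrimalMethod} {ubar : 𝒯.Vec} {pbar : 𝒯.Scal}
    (hprimal : IsPrimalSolution M ν f ubar pbar) {V : Euc d} (hV : V ∈ 𝒯.vertices)
    {σ : 𝒯.Mat} {u : 𝒯.Vec} {uhat : 𝒯.FacetVec} {p : 𝒯.Scal}
    (hsol : 𝒯.IsLocalSolution k V (𝒯.residual k ν f ubar pbar V) σ u uhat p)
    {v : 𝒯.Vec} (hv : v ∈ 𝒯.Vel k V) {w : 𝒯.FacetVec} (hw : w ∈ 𝒯.HatVel k V) :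
    𝒯.divPair V σ v w + 𝒯.divForm (𝒯.patch V) v p = 𝒯.residual k ν f ubar pbar V v w := by
  by_cases hVΩ : V ∈ Ω
  -- Subtract the constant pair with the same mean value; every term of the equation vanishes on it.
  · obtain ⟨c, hc⟩ := 𝒯.exists_meanValue_const (by omega) hV (𝒯.meanValue V v w)
    have h := hsol.balance (v - 𝒯.constVec c, w - 𝒯.constTang c)
      ⟨𝒯.sub_constVec_mem_Vel hv c, 𝒯.sub_constTang_mem_HatVel (by omega) hw c, fun _ => by
        funext a
        rw [meanValue_sub _ (by omega), hc, sub_self, Pi.zero_apply]⟩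
    dsimp only at h
    rw [divPair_sub _ (by omega), 𝒯.divPair_const hd hΩo hVΩ, divForm_sub, divForm_constVec,
      residual_sub _ (by omega) hΩr, 𝒯.residual_const hd hΩo hΩr hk ν f M hprimal hVΩ, sub_zero,
      sub_zero, sub_zero] at h
    exact h
  -- For `V` outside `Ω` the mean value condition is void.
  · exact hsol.balance (v, w) ⟨hv, hw, fun h => absurd h hVΩ⟩

/-! ### The normal-tangential trace on the boundary of the patch -/

/-- The normal-tangential trace as a polynomial vector field. -/
def _root_.Cell.polyNT (T : Cell d) (i : Fin (d + 1)) (τ : Matrix (Fin d) (Fin d) (MPoly d))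
    (a : Fin d) : MPoly d :=
  ∑ b, T.normal i b • τ a b - T.normal i a • ∑ e, T.normal i e • ∑ b, T.normal i b • τ e b

lemma _root_.Cell.ev_polyNT (T : Cell d) (i : Fin (d + 1))
    (τ : Matrix (Fin d) (Fin d) (MPoly d)) (a : Fin d) (x : Euc d) :
    (T.polyNT i τ a).ev x = T.trNT i τ x a := by
  simp only [Cell.polyNT, Cell.trNT, Cell.trNN, Cell.traction, MPoly.ev_sub, MPoly.ev_sum,
    MvPolynomial.smul_eq_C_mul, MPoly.ev_mul, MPoly.ev_C, mul_comm]

lemma _root_.Cell.polyNT_mem_degLE (T : Cell d) (i : Fin (d + 1)) {k : ℕ}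
    {τ : Matrix (Fin d) (Fin d) (MPoly d)} (hτ : ∀ a b, τ a b ∈ MPoly.degLE d k) (a : Fin d) :
    T.polyNT i τ a ∈ MPoly.degLE d k := by
  refine Submodule.sub_mem _ (Submodule.sum_mem _ fun b _ => Submodule.smul_mem _ _ (hτ a b))
    (Submodule.smul_mem _ _ (Submodule.sum_mem _ fun e _ => Submodule.smul_mem _ _
      (Submodule.sum_mem _ fun b _ => Submodule.smul_mem _ _ (hτ e b))))

lemma _root_.Cell.trN_polyNT (T : Cell d) (hd : 1 ≤ d) (i : Fin (d + 1))
    (τ : Matrix (Fin d) (Fin d) (MPoly d)) (x : Euc d) : T.trN i (T.polyNT i τ) x = 0 := by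
  simp only [Cell.trN, Cell.ev_polyNT]
  exact T.sum_trNT_mul_normal hd i τ x

lemma zero_mem_Vel (k : ℕ) (V : Euc d) : (0 : 𝒯.Vec) ∈ 𝒯.Vel k V := by
  refine ⟨⟨0, MemLp.zero, fun ψ _ _ _ => by simp [cellIntegral]⟩, fun T _ =>
    ⟨0, 0, fun _ => Submodule.zero_mem _, Submodule.zero_mem _, fun j => by simp⟩⟩

/-- The hat function vanishes on the facets of the patch that lie on its boundary. -/
lemma ev_hat_eq_zero (hd : 1 ≤ d) (hΩo : IsOpen Ω) {V : Euc d} {T : 𝒯.ι}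
    (hT : T ∈ 𝒯.patch V) {i : Fin (d + 1)}
    (hF : (𝒯.cell T).facet i ∈ 𝒯.patchFacets V)
    (hFr : facetHull ((𝒯.cell T).facet i) ⊆ frontier (𝒯.region (𝒯.patch V))) {x : Euc d}
    (hx : x ∈ facetHull ((𝒯.cell T).facet i)) : ((𝒯.cell T).hat V).ev x = 0 := by
  obtain ⟨l, hl⟩ := 𝒯.mem_patch.1 hT
  by_cases hil : l = i
  · rw [← hl, hil, Cell.ev_hat_points]
    exact (((𝒯.cell T).mem_facetHull i x).1 hx).2
  -- Otherwise the facet contains `V` and lies in the boundary of `Ω`; then so does `V`, and the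
  -- facet would have been removed.
  · exfalso
    have hsub := 𝒯.facetHull_subset_frontier hd hΩo hl hil hFr
    have hVF : V ∈ facetHull ((𝒯.cell T).facet i) :=
      subset_convexHull ℝ _ ((𝒯.cell T).mem_facet.2 ⟨l, hil, hl⟩)
    exact (𝒯.mem_patchFacets.1 hF).2 (hsub hVF) hsub

open Classical in
/-- The normal-tangential trace of the solution vanishes on the boundary of the patch. -/
lemma IsLocalSolution.trNT_eq_zero {𝒯 : Triangulation Ω} (hd : 2 ≤ d) (hΩo : IsOpen Ω)
    (hΩr : interior (closure Ω) = Ω) {k : ℕ} (hk : 1 ≤ k) {ν : ℝ}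
    {f : Lp (Euc d) 2 (volume.restrict Ω)} {M : 𝒯.PrimalMethod} {ubar : 𝒯.Vec} {pbar : 𝒯.Scal}
    (hprimal : IsPrimalSolution M ν f ubar pbar) {V : Euc d} (hV : V ∈ 𝒯.vertices)
    {σ : 𝒯.Mat} {u : 𝒯.Vec} {uhat : 𝒯.FacetVec} {p : 𝒯.Scal}
    (hsol : 𝒯.IsLocalSolution k V (𝒯.residual k ν f ubar pbar V) σ u uhat p)
    {T : 𝒯.ι} (hT : T ∈ 𝒯.patch V) {i : Fin (d + 1)}
    (hF : (𝒯.cell T).facet i ∈ 𝒯.patchFacets V)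
    (hFr : facetHull ((𝒯.cell T).facet i) ⊆ frontier (𝒯.region (𝒯.patch V))) {x : Euc d}
    (hx : x ∈ facetHull ((𝒯.cell T).facet i)) (a : Fin d) : (𝒯.cell T).trNT i (σ T) x a = 0 := by
  have huniq : ∀ S ∈ 𝒯.patch V, ∀ j, (𝒯.cell S).facet j = (𝒯.cell T).facet i →
      S = T ∧ j = i := by
    intro S hS j hj
    obtain rfl := 𝒯.eq_of_facet_eq (by omega) hS hT hj.symm hFr
    exact ⟨rfl, (𝒯.cell S).facet_injective hj⟩
  -- The test field is `σ_nt` itself on the one facet and zero on all others. It has degree at most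
  -- `k` and is tangential, so it is admissible.
  set w : 𝒯.FacetVec := fun F => if F = (𝒯.cell T).facet i then
    (𝒯.cell T).polyNT i (σ T) else 0 with hw
  have hwF : w ((𝒯.cell T).facet i) = (𝒯.cell T).polyNT i (σ T) := if_pos rfl
  have hw0 : ∀ F, F ≠ (𝒯.cell T).facet i → w F = 0 := fun F h => if_neg h
  have hwmem : w ∈ 𝒯.HatVel k V := by
    intro F hF'
    by_cases h : F = (𝒯.cell T).facet i
    · subst h
      rw [hwF]
      refine ⟨fun j => (𝒯.cell T).polyNT_mem_degLE i (hsol.stress_mem T hT).1 j, ?_⟩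
      intro S hS j hj y _
      obtain ⟨rfl, rfl⟩ := huniq S hS j hj
      exact (𝒯.cell S).trN_polyNT (by omega) j _ y
    · rw [hw0 F h]
      exact ⟨fun j => Submodule.zero_mem _, fun S _ j _ y _ => (𝒯.cell S).trN_zero j y⟩
  have hbal := hsol.balance_all hd hΩo hΩr hk hprimal hV (𝒯.zero_mem_Vel k V) hwmem
  have hform : 𝒯.divForm (𝒯.patch V) (0 : 𝒯.Vec) p = 0 := by
    simp [divForm, MPoly.divV, cellIntegral]
  -- The bubble of zero is zero, and the only facet term left carries `φ_V`, which vanishes on that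
  -- facet.
  have hres : 𝒯.residual k ν f ubar pbar V 0 w = 0 := by
    rw [residual]
    refine Finset.sum_eq_zero fun S hS => ?_
    have h1 : ∀ j, (if (𝒯.cell S).facet j ∈ 𝒯.patchFacets V then
        facetIntegral ((𝒯.cell S).facet j) (fun y => ∑ b,
          ((𝒯.cell S).hat V).ev y * (ν * (𝒯.cell S).trNT j (MPoly.grad (ubar S)) y b) *
            (w ((𝒯.cell S).facet j) b).ev y) else 0) = 0 := by
      intro j
      split_ifs
      · by_cases h : (𝒯.cell S).facet j = (𝒯.cell T).facet i
        · obtain ⟨rfl, rfl⟩ := huniq S hS j h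
          refine setIntegral_eq_zero_of_forall_eq_zero fun y hy => ?_
          simp [𝒯.ev_hat_eq_zero (by omega) hΩo hS hF hFr hy]
        · simp [hw0 _ h, facetIntegral]
      · rfl
    simp only [h1, Pi.zero_apply, Cell.bubble_zero]
    simp [cellIntegral, facetIntegral]
  have hdiv : 𝒯.divPair V σ 0 w = -facetIntegral ((𝒯.cell T).facet i)
      (fun y => ∑ b, (𝒯.cell T).trNT i (σ T) y b ^ 2) := by
    rw [divPair_eq _ (by omega), Finset.sum_eq_single_of_mem T hT]
    · rw [Finset.sum_eq_single i, if_pos hF]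
      · simp [cellIntegral, hwF, Cell.ev_polyNT, sq]
      · intro j _ hj
        have h : (𝒯.cell T).facet j ≠ (𝒯.cell T).facet i := fun h =>
          hj ((𝒯.cell T).facet_injective h)
        simp [hw0 _ h, facetIntegral]
      · simp
    · intro S hS hST
      have h : ∀ j, (𝒯.cell S).facet j ≠ (𝒯.cell T).facet i := fun j hj =>
        hST (huniq S hS j hj).1
      simp [hw0 _ (h _), facetIntegral, cellIntegral]
  rw [hform, hres, hdiv, add_zero, neg_eq_zero] at hbal
  have hzero := (𝒯.cell T).eq_zero_of_facetIntegral_eq_zero (by omega) i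
    (continuous_finsetSum _ fun b _ => by fun_prop)
    (fun y => Finset.sum_nonneg fun b _ => sq_nonneg _) hbal x hx
  exact pow_eq_zero_iff (two_ne_zero) |>.1
    ((Finset.sum_eq_zero_iff_of_nonneg fun b _ => sq_nonneg _).1 hzero a (Finset.mem_univ a))

end Triangulation

end

/-- Properties of the solution of the local problem on the patch of a vertex `V`. -/
theorem theorem6p6 {d : ℕ} (hd : d = 2 ∨ d = 3) {Ω : Set (Euc d)} (hΩo : IsOpen Ω)
    (hΩc : IsConnected Ω) (hΩr : interior (closure Ω) = Ω) (𝒯 : Triangulation Ω)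
    (k : ℕ) (hk : 1 ≤ k) (ν : ℝ) (hν : 0 < ν) (f : Lp (Euc d) 2 (volume.restrict Ω))
    (M : 𝒯.PrimalMethod) (ubar : 𝒯.Vec) (pbar : 𝒯.Scal)
    (hprimal : Triangulation.IsPrimalSolution M ν f ubar pbar)
    (V : Euc d) (hV : V ∈ 𝒯.vertices)
    (σ : 𝒯.Mat) (u : 𝒯.Vec) (uhat : 𝒯.FacetVec) (p : 𝒯.Scal)
    (hsol : 𝒯.IsLocalSolution k V (𝒯.residual k ν f ubar pbar V) σ u uhat p) :
    (∀ v ∈ 𝒯.Vel k V, ∀ w ∈ 𝒯.HatVel k V,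
      𝒯.divPair V σ v w + 𝒯.divForm (𝒯.patch V) v p = 𝒯.residual k ν f ubar pbar V v w) ∧
    (∀ v ∈ 𝒯.RTZero k, ∀ w ∈ 𝒯.Tang k Finset.univ 𝒯.facets,
      (∀ T, MPoly.divV (v T) = 0) →
      𝒯.divPair V σ v w = 𝒯.residual k ν f ubar pbar V v w) ∧
    (∀ T ∈ 𝒯.patch V, ∀ i, (𝒯.cell T).facet i ∈ 𝒯.patchFacets V →
      facetHull ((𝒯.cell T).facet i) ⊆ frontier (𝒯.region (𝒯.patch V)) →
      ∀ x ∈ facetHull ((𝒯.cell T).facet i), ∀ a, (𝒯.cell T).trNT i (σ T) x a = 0) := by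
  have hd2 : 2 ≤ d := by omega
  refine ⟨fun v hv w hw => hsol.balance_all hd2 hΩo hΩr hk hprimal hV hv hw,
    fun v hv w hw hdiv => ?_, fun T hT i hF hFr x hx a =>
      hsol.trNT_eq_zero hd2 hΩo hΩr hk hprimal hV hT hF hFr hx a⟩
  have hvV : v ∈ 𝒯.Vel k V := 𝒯.RT_univ_subset_RT k _ hv.1
  have hwV : w ∈ 𝒯.HatVel k V := by
    intro F hF
    obtain ⟨⟨T, -, i, rfl⟩, -⟩ := 𝒯.mem_patchFacets.1 hF
    obtain ⟨h1, h2⟩ := hw ((𝒯.cell T).facet i) (by simp [Triangulation.facets])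
    exact ⟨h1, fun S _ => h2 S (Finset.mem_univ S)⟩
  have h := hsol.balance_all hd2 hΩo hΩr hk hprimal hV hvV hwV
  have hform : 𝒯.divForm (𝒯.patch V) v p = 0 := by
    simp [Triangulation.divForm, Triangulation.cellIntegral, hdiv]
  rwa [hform, add_zero] at h
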